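/- **Theorem 3 (APMC-RED).** Let $\ell(x)=\ell(y|x)>0$ be the likelihood of a fixed measurement $y$ and $p>0$ a prior probability density on $\mathbb{R}^n$, such that $\ell p$ is integrable. Let $\pi=\ell p/\int \ell p$ be the posterior density, $g=-\log \ell$, and $p_\sigma(x)=\int p(z)\phi_\sigma(x-z)\,dz$, where $\phi_\sigma$ is the density of $\mathcal N(0,\sigma^2I)$. Let $S:\mathbb{R}^n\times(0,\infty)\to\mathbb{R}^n$ be the score network. Assume the following. 1. $\log\ell$ is differentiable and $\nabla\log\ell$ is Lipschitz with constant $L_g>0$. 2. $\log p$ is differentiable and $\nabla\log p$ is Lipschitz with constant $L_p>0$. 3. For every $\sigma>0$, $S(\cdot,\sigma)$ is Lipschitz with constant $L_\sigma>0$, and $\|S(x,\sigma)-\nabla\log p_\sigma(x)\|_2\le\varepsilon_\sigma<\infty$ for all $x$. 4. There is a constant $C$ such that $\|\nabla\log p_\sigma(x)-\nabla\log p(x)\|_2\le\sigma C$ for all $\sigma>0$ and all $x$. 5. There is a constant $R_s$ such that $\|S(x,\sigma)\|_2\le R_s$ for all $\sigma>0$ and all $x$. Let $0\le K<N$ be integers,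 and let $(\alpha_k)_{k=0}^{N-1}$ and $(\sigma_k)_{k=0}^{N-1}$ be nonincreasing with $\alpha_K=\dots=\alpha_{N-1}=1$ and $\sigma_k>0$. Let $L_k=L_g+\max\{\alpha_kL_{\sigma_k},L_p\}$ and $L_{\max}=\max_{0\le k<N}L_k$, and let $\gamma>0$ satisfy $\gamma L_{\max}\le 1/\sqrt{32}$. Put $G_k(x)=\nabla g(x)-\alpha_kS(x,\sigma_k)$. Let $(B_t)_{t\ge0}$ be a standard Brownian motion in $\mathbb{R}^n$ independent of the random initial point $x_0$. Let $\nu_t$ be the law of the continuous interpolation of the APMC-RED iterates, defined by $$x_t=x_{k\gamma}-(t-k\gamma)\,G_k(x_{k\gamma})+\sqrt2\,(B_t-B_{k\gamma}),\qquad t\in[k\gamma,(k+1)\gamma],\ 0\le k<N .$$ Let $\mathrm{FI}(\nu\|\pi)=\int\|\nabla\log\frac{\nu(x)}{\pi(x)}\|_2^2\,\nu(x)\,dx$ if $\nu$ has a positive differentiable density $\nu(x)$, and $\mathrm{FI}(\nu\|\pi)=\infty$ otherwise. Let $\mathrm{KL}$ be the Kullback–Leibler divergence, with values in $[0,\infty]$.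 Then $t\mapsto\mathrm{FI}(\nu_t\|\pi)$ is (Lebesgue almost everywhere) measurable on $[0,N\gamma]$ and $$\frac1{N\gamma}\int_0^{N\gamma}\mathrm{FI}(\nu_t\|\pi)\,dt\le\frac{4\,\mathrm{KL}(\nu_0\|\pi)+\gamma\zeta}{N\gamma}+24\,n\,L_{\max}^2\,\gamma+36\,C^2\,\frac1N\sum_{k=0}^{N-1}\sigma_k^2+36\,\frac1N\sum_{k=0}^{N-1}\varepsilon_{\sigma_k}^2,$$ where $\zeta=36\sum_{k=0}^{K-1}(\alpha_k-1)^2R_s^2$. -/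

import Mathlib

open MeasureTheory ProbabilityTheory InformationTheory Set
open scoped ENNReal NNReal

namespace PMC

/-- The isotropic Gaussian density `φ_σ` of `N(0, σ² I)` on `ℝⁿ`. -/
noncomputable def gaussianDensity {n : ℕ} (σ : ℝ) (u : EuclideanSpace ℝ (Fin n)) : ℝ :=
  (√(2 * Real.pi * σ ^ 2) ^ n)⁻¹ * Real.exp (-‖u‖ ^ 2 / (2 * σ ^ 2))

/-- The smoothed prior `p_σ(x) = ∫ p(z) φ_σ(x - z) dz`. -/
noncomputable def smoothedPrior {n : ℕ} (p : EuclideanSpace ℝ (Fin n) → ℝ) (σ : ℝ)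
    (x : EuclideanSpace ℝ (Fin n)) : ℝ :=
  ∫ z, p z * gaussianDensity σ (x - z)

/-- The score `∇ log q` of a density `q`. -/
noncomputable def score {n : ℕ} (q : EuclideanSpace ℝ (Fin n) → ℝ)
    (x : EuclideanSpace ℝ (Fin n)) : EuclideanSpace ℝ (Fin n) :=
  gradient (fun y => Real.log (q y)) x

/-- The posterior density `π(x) = ℓ(x) p(x) / ∫ ℓ p`, where `ℓ(x) = ℓ(y | x)` is the likelihood
at the observed measurement `y`. -/
noncomputable def posteriorDensity {n : ℕ} (ℓ p : EuclideanSpace ℝ (Fin n) → ℝ)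
    (x : EuclideanSpace ℝ (Fin n)) : ℝ :=
  ℓ x * p x / ∫ z, ℓ z * p z

/-- The measure on `ℝⁿ` with density `q`. -/
noncomputable def densityMeasure {n : ℕ} (q : EuclideanSpace ℝ (Fin n) → ℝ) :
    Measure (EuclideanSpace ℝ (Fin n)) :=
  volume.withDensity fun x => ENNReal.ofReal (q x)

/-- `q` is a positive differentiable density of `ν`. Such a `q` is unique, being continuous. -/
structure IsSmoothDensity {n : ℕ} (ν : Measure (EuclideanSpace ℝ (Fin n)))
    (q : EuclideanSpace ℝ (Fin n) → ℝ) : Prop where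
  pos : ∀ x, 0 < q x
  differentiable : Differentiable ℝ q
  eq : ν = densityMeasure q

/-- The relative Fisher information `FI(ν ‖ π) = ∫ ‖∇ log (ν(x) / π(x))‖² ν(x) dx`, where `ν(x)` is
the positive differentiable density of `ν`; it is `∞` if `ν` has no such density. The infimum
only serves to pick that density: it runs over at most one function,
see `relFisherInfo_eq`. -/
noncomputable def relFisherInfo {n : ℕ} (ν : Measure (EuclideanSpace ℝ (Fin n)))
    (π : EuclideanSpace ℝ (Fin n) → ℝ) : ℝ≥0∞ :=
  ⨅ (q : EuclideanSpace ℝ (Fin n) → ℝ) (_ : IsSmoothDensity ν q),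
    ∫⁻ x, ‖gradient (fun y => Real.log (q y / π y)) x‖ₑ ^ 2 ∂ν

theorem IsSmoothDensity.unique {n : ℕ} {ν : Measure (EuclideanSpace ℝ (Fin n))}
    [IsFiniteMeasure ν] {q r : EuclideanSpace ℝ (Fin n) → ℝ}
    (hq : IsSmoothDensity ν q) (hr : IsSmoothDensity ν r) : q = r := by
  have hqm : Measurable fun x => ENNReal.ofReal (q x) :=
    ENNReal.measurable_ofReal.comp hq.differentiable.continuous.measurable
  have hrm : Measurable fun x => ENNReal.ofReal (r x) :=
    ENNReal.measurable_ofReal.comp hr.differentiable.continuous.measurable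
  have h : densityMeasure q = densityMeasure r := hq.eq.symm.trans hr.eq
  have hfin : ∫⁻ x, ENNReal.ofReal (q x) ≠ ∞ := by
    have h1 : densityMeasure q univ = ∫⁻ x, ENNReal.ofReal (q x) := by
      simp [densityMeasure]
    rw [← h1, ← hq.eq]
    exact measure_ne_top ν univ
  have hae := (withDensity_eq_iff hqm.aemeasurable hrm.aemeasurable hfin).1 h
  refine Continuous.ae_eq_iff_eq (μ := volume) hq.differentiable.continuous
    hr.differentiable.continuous |>.1 ?_
  filter_upwards [hae] with x hx
  exact (ENNReal.ofReal_eq_ofReal_iff (hq.pos x).le (hr.pos x).le).1 hx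

theorem relFisherInfo_eq {n : ℕ} {ν : Measure (EuclideanSpace ℝ (Fin n))} [IsFiniteMeasure ν]
    {q : EuclideanSpace ℝ (Fin n) → ℝ} (hq : IsSmoothDensity ν q)
    (π : EuclideanSpace ℝ (Fin n) → ℝ) :
    relFisherInfo ν π = ∫⁻ x, ‖gradient (fun y => Real.log (q y / π y)) x‖ₑ ^ 2 ∂ν := by
  refine le_antisymm (iInf₂_le q hq) (le_iInf₂ fun r hr => ?_)
  rw [hr.unique hq]

/-- `B` is a standard Brownian motion in `ℝⁿ`. -/
structure IsStdBrownianMotion {n : ℕ} {Ω : Type*} [MeasurableSpace Ω]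
    (B : ℝ≥0 → Ω → EuclideanSpace ℝ (Fin n)) (P : Measure Ω) : Prop where
  measurable : ∀ t, Measurable (B t)
  zero : ∀ᵐ ω ∂P, B 0 ω = 0
  indep_increments : HasIndepIncrements B P
  law_increment : ∀ s t : ℝ≥0, s ≤ t →
    P.map (fun ω => B t ω - B s ω) =
      (stdGaussian (EuclideanSpace ℝ (Fin n))).map fun z => √((t : ℝ) - s) • z
  continuous_paths : ∀ᵐ ω ∂P, Continuous fun t => B t ω

/-- The drift `G_k(x) = ∇g(x) - α_k S(x, σ_k)` with `g = -log ℓ`. -/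
noncomputable def drift {n : ℕ} (ℓ : EuclideanSpace ℝ (Fin n) → ℝ)
    (S : EuclideanSpace ℝ (Fin n) → ℝ → EuclideanSpace ℝ (Fin n)) (α σ : ℕ → ℝ) (k : ℕ)
    (x : EuclideanSpace ℝ (Fin n)) : EuclideanSpace ℝ (Fin n) :=
  gradient (fun y => -Real.log (ℓ y)) x - α k • S x (σ k)

/-- The iterates `x_{k+1} = x_k - γ G_k(x_k) + √(2γ) Z_k`, started at `X₀` and driven by the
standard Gaussian vectors `Z_k = (B_{(k+1)γ} - B_{kγ}) / √γ`. -/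
noncomputable def iterate {n : ℕ} {Ω : Type*} (γ : ℝ)
    (G : ℕ → EuclideanSpace ℝ (Fin n) → EuclideanSpace ℝ (Fin n))
    (X₀ : Ω → EuclideanSpace ℝ (Fin n)) (B : ℝ≥0 → Ω → EuclideanSpace ℝ (Fin n)) :
    ℕ → Ω → EuclideanSpace ℝ (Fin n)
  | 0, ω => X₀ ω
  | k + 1, ω =>
    iterate γ G X₀ B k ω - γ • G k (iterate γ G X₀ B k ω)
      + √2 • (B (((k : ℝ) + 1) * γ).toNNReal ω - B ((k : ℝ) * γ).toNNReal ω)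

/-- The continuous interpolation: for `kγ ≤ t < (k+1)γ`,
`x_t = x_{kγ} - (t - kγ) G_k(x_{kγ}) + √2 (B_t - B_{kγ})`, where `x_{kγ}` is the `k`-th iterate. -/
noncomputable def interpolation {n : ℕ} {Ω : Type*} (γ : ℝ)
    (G : ℕ → EuclideanSpace ℝ (Fin n) → EuclideanSpace ℝ (Fin n))
    (X₀ : Ω → EuclideanSpace ℝ (Fin n)) (B : ℝ≥0 → Ω → EuclideanSpace ℝ (Fin n))
    (t : ℝ) (ω : Ω) : EuclideanSpace ℝ (Fin n) :=
  iterate γ G X₀ B ⌊t / γ⌋₊ ω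
    - (t - ⌊t / γ⌋₊ * γ) • G ⌊t / γ⌋₊ (iterate γ G X₀ B ⌊t / γ⌋₊ ω)
    + √2 • (B t.toNNReal ω - B ((⌊t / γ⌋₊ : ℝ) * γ).toNNReal ω)

end PMC

namespace PMC

open Filter Topology

set_option linter.unusedSectionVars false

/-! Write `-gV` for the score of the posterior; `gV` is Lipschitz with constant `L = Lg + Lp ≤
Lmax`. During the step with drift `-G`, started from `y ∼ μ`, the interpolation at time `s` has the
Gaussian mixture density `mix μ G s`. It solves a continuity equation whose velocity at `x` is minus
the conditional expectation of `G y` given the endpoint `x`, minus the score of the mixture.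
Differentiating the relative entropy, integrating by parts and applying Young's inequality gives
`KL' ≤ -(3/4) FI + E‖gV x - G y‖²` (`integral_mul_mixDot_le`, for a truncated entropy).

The drift error is controlled by the Fisher information itself. The displacement `x - y` is Gaussian
noise minus `s • G y`, so the Lipschitz bound leaves a noise term, a multiple `(sL)²` of `E‖gV x‖²`,
and the bias `‖G - gV‖ ≤ e`. Gaussian integration by parts gives `E‖gV x‖² ≤ FI + 2nL`
(`integral_norm_sq_gV_le`). With `sL ≤ 1/√32` the error is at most `FI/4 + 12nL²s + 6e²`
(`integral_norm_sq_drift_sub_le`). Half of `FI` survives, and telescoping the entropy over the steps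
yields `∫ FI ≤ 2 KL + Σ γ(24nL²γ + 12e²)` (`sum_mixFisher_le`). The bias is at most `σC + ε + |α -
1| Rs`; squaring three terms costs a factor `3`, whence the constants `36`.

The initial law is only known to have finite entropy (otherwise the bound is trivial), so the formal
computation is justified by approximation. The logarithm is replaced by `M arctan(log / M)`: it is
bounded, so Fubini and the integration by parts apply, and the corresponding entropy is Lipschitz in
`L¹`, hence continuous at the start of a step (`tendsto_lintegral_mix_sub`), and lies below the true
one. The drift is square integrable because `exp(c‖gV‖²)` is integrable under the posterior for
small `c` and finite entropy transfers moments (`memLp_gV_of_klDiv_ne_top`). Letting `M → ∞` by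
monotone convergence recovers the full Fisher information (`tendsto_lintegral_dissipation`), and
only after that is a quarter of it absorbed. -/

/-- The heat kernel, the density of `N(0, 2sI)`. -/
noncomputable def heat {n : ℕ} (s : ℝ) (v : EuclideanSpace ℝ (Fin n)) : ℝ :=
  (4 * Real.pi * s) ^ (-(n : ℝ) / 2) * Real.exp (-‖v‖ ^ 2 / (4 * s))

/-- The centred Gaussian measure `N(0, 2sI)`. -/
noncomputable def gauss (n : ℕ) (s : ℝ) : Measure (EuclideanSpace ℝ (Fin n)) :=
  volume.withDensity fun v => ENNReal.ofReal (heat s v)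

/-! ### Gaussian measures and estimates for the heat kernel. -/

section Heat

variable {n : ℕ} {s : ℝ}

theorem heat_pos (hs : 0 < s) (v : EuclideanSpace ℝ (Fin n)) : 0 < heat s v := by
  unfold heat; positivity

@[fun_prop]
theorem continuous_heat (s : ℝ) : Continuous (heat (n := n) s) := by
  unfold heat; fun_prop

@[fun_prop]
theorem measurable_heat : Measurable fun p : ℝ × EuclideanSpace ℝ (Fin n) => heat p.1 p.2 := by
  unfold heat
  fun_prop

theorem integrable_exp_neg_mul_norm_sq {b : ℝ} (hb : 0 < b) :
    Integrable fun v : EuclideanSpace ℝ (Fin n) => Real.exp (-b * ‖v‖ ^ 2) := by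
  refine Integrable.of_integral_ne_zero ?_
  rw [GaussianFourier.integral_rexp_neg_mul_sq_norm hb]
  positivity

theorem integrable_heat (hs : 0 < s) : Integrable (heat (n := n) s) := by
  have := (integrable_exp_neg_mul_norm_sq (n := n) (b := (4 * s)⁻¹) (by positivity)).const_mul
    ((4 * Real.pi * s) ^ (-(n : ℝ) / 2))
  refine this.congr (ae_of_all _ fun v => ?_)
  simp only [heat]
  congr 2
  ring

theorem charFun_gauss (hs : 0 < s) (t : EuclideanSpace ℝ (Fin n)) :
    charFun (gauss n s) t = Complex.exp (-(s * ‖t‖ ^ 2 : ℝ)) := by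
  have hb : 0 < ((4 * s : ℝ)⁻¹ : ℂ).re := by
    rw [← Complex.ofReal_inv, Complex.ofReal_re]; positivity
  have key := GaussianFourier.integral_cexp_neg_mul_sq_norm_add hb Complex.I t
  rw [charFun_apply, gauss, integral_withDensity_eq_integral_toReal_smul (by fun_prop)
    (ae_of_all _ fun _ => ENNReal.ofReal_lt_top)]
  have h1 : ∀ v : EuclideanSpace ℝ (Fin n),
      (ENNReal.ofReal (heat s v)).toReal • Complex.exp ((inner ℝ v t : ℝ) * Complex.I)
      = ((4 * Real.pi * s : ℝ) ^ (-(n : ℝ) / 2) : ℝ) *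
        Complex.exp (-((4 * s : ℝ)⁻¹ : ℂ) * ‖v‖ ^ 2 + Complex.I * (inner ℝ t v : ℝ)) := by
    intro v
    rw [ENNReal.toReal_ofReal (heat_pos hs v).le, Complex.real_smul, heat, Complex.ofReal_mul,
      mul_assoc, Complex.ofReal_exp, ← Complex.exp_add, real_inner_comm]
    congr 2
    push_cast
    ring
  simp_rw [h1]
  rw [integral_const_mul, key, finrank_euclideanSpace, Fintype.card_fin]
  have h2 : ((Real.pi : ℂ) / ((4 * s : ℝ)⁻¹ : ℂ)) ^ ((n : ℂ) / 2)
      = ((4 * Real.pi * s : ℝ) ^ ((n : ℝ) / 2) : ℝ) := by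
    rw [Complex.ofReal_cpow (by positivity)]
    congr 1
    · push_cast
      rw [div_inv_eq_mul]; ring
    · push_cast; rfl
  rw [h2, ← mul_assoc, ← Complex.ofReal_mul, ← Real.rpow_add (by positivity)]
  rw [show -(n : ℝ) / 2 + n / 2 = 0 by ring, Real.rpow_zero, Complex.ofReal_one, one_mul]
  congr 1
  rw [Complex.I_sq]
  push_cast
  have : (s : ℂ) ≠ 0 := by exact_mod_cast hs.ne'
  field_simp

/-- Both sides have the characteristic function `exp(-s‖t‖²)`. The identity links the explicit
kernel with the law of the Brownian increments, and carries the moments of the standard Gaussian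
over to `gauss n s`. -/
theorem stdGaussian_map_smul (hs : 0 < s) :
    (stdGaussian (EuclideanSpace ℝ (Fin n))).map (fun z => √(2 * s) • z) = gauss n s := by
  have hf : IsFiniteMeasure (gauss n s) := by
    refine isFiniteMeasure_withDensity_ofReal (integrable_heat hs).2
  have : IsProbabilityMeasure ((stdGaussian (EuclideanSpace ℝ (Fin n))).map
      (fun z => √(2 * s) • z)) := Measure.isProbabilityMeasure_map (by fun_prop)
  apply Measure.ext_of_charFun
  ext t
  rw [charFun_map_smul, charFun_stdGaussian, charFun_gauss hs]
  congr 1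
  rw [norm_smul, Real.norm_eq_abs, ← Complex.ofReal_pow, mul_pow, sq_abs,
    Real.sq_sqrt (by positivity)]
  push_cast
  ring

theorem isProbabilityMeasure_gauss (hs : 0 < s) : IsProbabilityMeasure (gauss n s) := by
  rw [← stdGaussian_map_smul hs]
  exact Measure.isProbabilityMeasure_map (by fun_prop)

theorem memLp_id_gauss (hs : 0 < s) : MemLp id 2 (gauss n s) := by
  rw [← stdGaussian_map_smul hs, memLp_map_measure_iff (by fun_prop) (by fun_prop)]
  exact (IsGaussian.memLp_id (stdGaussian (EuclideanSpace ℝ (Fin n))) 2 (by simp)).const_smul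
    (√(2 * s))

theorem integral_id_gauss (hs : 0 < s) : ∫ v, v ∂gauss n s = 0 := by
  rw [← stdGaussian_map_smul hs, integral_map (by fun_prop) (by fun_prop), integral_smul,
    integral_id_stdGaussian, smul_zero]

theorem integral_norm_sq_gauss (hs : 0 < s) : ∫ v, ‖v‖ ^ 2 ∂gauss n s = 2 * s * n := by
  have h1 : ∫ v, ‖v‖ ^ 2 ∂stdGaussian (EuclideanSpace ℝ (Fin n)) = n := by
    have hL : MemLp id 2 (stdGaussian (EuclideanSpace ℝ (Fin n))) :=
      IsGaussian.memLp_id _ 2 (by simp)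
    have hi : ∀ i : Fin n, MemLp (fun v : EuclideanSpace ℝ (Fin n) => v i) 2
        (stdGaussian (EuclideanSpace ℝ (Fin n))) := fun i =>
      (EuclideanSpace.proj (𝕜 := ℝ) i).comp_memLp' hL
    simp_rw [EuclideanSpace.real_norm_sq_eq]
    rw [integral_finsetSum _ fun i _ => (hi i).integrable_sq]
    have h2 : ∀ i : Fin n, ∫ v : EuclideanSpace ℝ (Fin n), v i ^ 2
        ∂stdGaussian (EuclideanSpace ℝ (Fin n)) = 1 := by
      intro i
      have hv := variance_dual_stdGaussian (E := EuclideanSpace ℝ (Fin n))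
        (innerSL ℝ (EuclideanSpace.single i (1 : ℝ)))
      have h0 := integral_strongDual_stdGaussian (E := EuclideanSpace ℝ (Fin n))
        (innerSL ℝ (EuclideanSpace.single i (1 : ℝ)))
      rw [variance_of_integral_eq_zero (by fun_prop) h0] at hv
      simpa [innerSL_apply_apply, EuclideanSpace.inner_single_left] using hv
    simp [h2]
  rw [← stdGaussian_map_smul hs, integral_map (by fun_prop) (by fun_prop)]
  simp_rw [norm_smul, mul_pow]
  rw [integral_const_mul, h1, Real.norm_eq_abs, sq_abs, Real.sq_sqrt (by positivity)]

theorem integral_heat (hs : 0 < s) : ∫ v, heat (n := n) s v = 1 := by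
  have := (isProbabilityMeasure_gauss (n := n) hs).measure_univ
  rw [gauss, withDensity_apply _ MeasurableSet.univ, Measure.restrict_univ,
    ← ofReal_integral_eq_lintegral_ofReal (integrable_heat hs)
      (ae_of_all _ fun v => (heat_pos hs v).le)] at this
  exact ENNReal.ofReal_eq_one.1 this

theorem integrable_gauss_iff {F : Type*} [NormedAddCommGroup F] [NormedSpace ℝ F] (hs : 0 < s)
    (f : EuclideanSpace ℝ (Fin n) → F) :
    Integrable f (gauss n s) ↔ Integrable fun v => heat s v • f v := by
  rw [gauss, integrable_withDensity_iff_integrable_smul' (by fun_prop)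
    (ae_of_all _ fun _ => ENNReal.ofReal_lt_top)]
  simp_rw [ENNReal.toReal_ofReal (heat_pos hs _).le]

theorem hasFDerivAt_heat (s : ℝ) (v : EuclideanSpace ℝ (Fin n)) :
    HasFDerivAt (heat s) (-(heat s v / (2 * s)) • innerSL ℝ v) v := by
  have h1 : HasFDerivAt (fun v : EuclideanSpace ℝ (Fin n) => ‖v‖ ^ 2) (2 • innerSL ℝ v) v :=
    (hasStrictFDerivAt_norm_sq v).hasFDerivAt
  have h2 := ((h1.const_mul (-(4 * s)⁻¹)).exp).const_mul ((4 * Real.pi * s) ^ (-(n : ℝ) / 2))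
  refine (h2.congr_of_eventuallyEq (Eventually.of_forall fun w => ?_)).congr_fderiv ?_
  · simp only [heat]
    congr 2
    ring
  · ext w
    simp only [heat, _root_.smul_apply, smul_eq_mul, innerSL_apply_apply]
    rw [show -(4 * s)⁻¹ * ‖v‖ ^ 2 = -‖v‖ ^ 2 / (4 * s) by ring, nsmul_eq_mul]
    push_cast
    rw [show (4 * s)⁻¹ = (2 * s)⁻¹ / 2 by rw [show 4 * s = 2 * s * 2 by ring, mul_inv]; ring]
    ring

/-- The time derivative of the heat kernel along a straight line. -/
theorem hasDerivAt_heat_line (hs : 0 < s) (a g : EuclideanSpace ℝ (Fin n)) :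
    HasDerivAt (fun r => heat r (a + r • g))
      (heat s (a + s • g) * (‖a + s • g‖ ^ 2 / (4 * s ^ 2) - n / (2 * s)
        - inner ℝ (a + s • g) g / (2 * s))) s := by
  have h0 : HasDerivAt (fun r : ℝ => 4 * Real.pi * r) (4 * Real.pi) s := by
    simpa using (hasDerivAt_id s).const_mul (4 * Real.pi)
  have h1 := h0.rpow_const (p := -(n : ℝ) / 2) (Or.inl (by positivity))
  have h2 : HasDerivAt (fun r : ℝ => a + r • g) g s := by
    simpa using ((hasDerivAt_id s).smul_const g).const_add a
  have h3 := h2.norm_sq.neg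
  have h4 : HasDerivAt (fun r : ℝ => 4 * r) 4 s := by
    simpa using (hasDerivAt_id s).const_mul 4
  have h5 := h1.mul ((h3.div h4 (by positivity)).exp)
  refine h5.congr_deriv ?_
  simp only [heat, Pi.div_apply, Pi.neg_apply]
  rw [Real.rpow_sub_one (by positivity)]
  field_simp
  ring

/-- Bounds for the heat kernel that are uniform for times in a compact interval. -/
theorem exists_heat_bound {a b : ℝ} (ha : 0 < a) :
    ∃ C, ∀ s ∈ Icc a b, ∀ v : EuclideanSpace ℝ (Fin n),
      heat s v ≤ C ∧ heat s v * ‖v‖ ≤ C ∧ heat s v * ‖v‖ ^ 2 ≤ C := by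
  set c : ℝ := (4 * Real.pi * a) ^ (-(n : ℝ) / 2)
  have hc : 0 < c := by positivity
  refine ⟨c + c * (4 * b), fun s hs v => ?_⟩
  have hs0 : 0 < s := ha.trans_le hs.1
  have hb : 0 < b := hs0.trans_le hs.2
  have h1 : (4 * Real.pi * s) ^ (-(n : ℝ) / 2) ≤ c :=
    Real.rpow_le_rpow_of_nonpos (by positivity)
      (mul_le_mul_of_nonneg_left hs.1 (by positivity)) (by
        have : (0 : ℝ) ≤ n := n.cast_nonneg
        linarith)
  have h2 : Real.exp (-‖v‖ ^ 2 / (4 * s)) ≤ 1 :=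
    Real.exp_le_one_iff.2 (div_nonpos_of_nonpos_of_nonneg (by simp) (by positivity))
  -- This is `u ≤ exp u` for `u = ‖v‖² / (4s)`.
  have h3 : Real.exp (-‖v‖ ^ 2 / (4 * s)) * ‖v‖ ^ 2 ≤ 4 * b := by
    have h4 := Real.add_one_le_exp (‖v‖ ^ 2 / (4 * s))
    rw [neg_div, Real.exp_neg, inv_mul_le_iff₀ (Real.exp_pos _)]
    have h5 : ‖v‖ ^ 2 / (4 * s) ≤ Real.exp (‖v‖ ^ 2 / (4 * s)) := by linarith
    rw [div_le_iff₀ (by positivity)] at h5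
    refine h5.trans (mul_le_mul_of_nonneg_left ?_ (Real.exp_pos _).le)
    linarith [hs.2]
  have hA : heat s v ≤ c := by
    unfold heat
    calc _ ≤ c * 1 := mul_le_mul h1 h2 (Real.exp_pos _).le hc.le
      _ = c := mul_one c
  have hB : heat s v * ‖v‖ ^ 2 ≤ c * (4 * b) := by
    unfold heat
    rw [mul_assoc]
    exact mul_le_mul h1 h3 (by positivity) hc.le
  have hp := (heat_pos hs0 v).le
  refine ⟨by nlinarith, ?_, by nlinarith⟩
  have : ‖v‖ ≤ 1 + ‖v‖ ^ 2 := by nlinarith [sq_nonneg (‖v‖ - 1), sq_nonneg ‖v‖]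
  nlinarith

/-- Parabolic scaling: it reduces `L¹` translation estimates at every time to time `1`. -/
theorem heat_scale {r : ℝ} (hr : 0 < r) (v : EuclideanSpace ℝ (Fin n)) :
    heat (r ^ 2) (r • v) = (r ^ n)⁻¹ * heat 1 v := by
  simp only [heat, norm_smul, Real.norm_eq_abs, abs_of_pos hr, mul_one]
  rw [Real.mul_rpow (by positivity) (by positivity), ← Real.rpow_natCast r 2, ← Real.rpow_mul hr.le,
    show ((2 : ℕ) : ℝ) * (-(n : ℝ) / 2) = -n by push_cast; ring, Real.rpow_neg hr.le,
    Real.rpow_natCast, Real.rpow_natCast]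
  rw [show -(r * ‖v‖) ^ 2 / (4 * r ^ 2) = -‖v‖ ^ 2 / 4 by field_simp]
  ring

end Heat

/-! ### The continuity equation of a drifting heat kernel, in weak form. -/

/-- The velocity field in the continuity equation for the heat kernel with drift `-u`. -/
theorem integral_mul_heat_deriv_eq {n : ℕ} {s : ℝ} (hs : 0 < s)
    (m u : EuclideanSpace ℝ (Fin n))
    {f : EuclideanSpace ℝ (Fin n) → ℝ} {f' : EuclideanSpace ℝ (Fin n) → EuclideanSpace ℝ (Fin n)}
    (hf : ∀ x, HasGradientAt f (f' x) x) {c : ℝ} (hc : ∀ x, |f x| ≤ c)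
    (hint : Integrable fun x => heat s (x - m) * (‖f' x‖ * ‖u - (2 * s)⁻¹ • (x - m)‖))
    (hf' : Measurable f') :
    ∫ x, f x * (heat s (x - m) * (‖x - m‖ ^ 2 / (4 * s ^ 2) - n / (2 * s)
        - inner ℝ (x - m) u / (2 * s))) =
      -∫ x, heat s (x - m) * inner ℝ (f' x) (u - (2 * s)⁻¹ • (x - m)) := by
  set e : Fin n → EuclideanSpace ℝ (Fin n) := fun i => EuclideanSpace.single i 1 with he
  have hfc : Continuous f := continuous_iff_continuousAt.2 fun x => (hf x).continuousAt
  set w : EuclideanSpace ℝ (Fin n) → EuclideanSpace ℝ (Fin n) :=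
    fun x => u - (2 * s)⁻¹ • (x - m) with hw
  set k : EuclideanSpace ℝ (Fin n) → ℝ := fun x => heat s (x - m) with hk
  have hwc : Continuous w := by fun_prop
  have hkc : Continuous k := by fun_prop
  have hk0 : ∀ x, 0 ≤ k x := fun x => (heat_pos hs _).le
  have hkint : ∀ g : EuclideanSpace ℝ (Fin n) → ℝ, Integrable g (gauss n s) →
      Integrable fun x => k x * g (x - m) := fun g hg =>
    ((integrable_gauss_iff hs g).1 hg).comp_sub_right m
  have := isProbabilityMeasure_gauss (n := n) hs
  have hm2 := memLp_id_gauss (n := n) hs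
  have hsq : Integrable fun x => k x * ‖x - m‖ ^ 2 :=
    hkint (fun v => ‖v‖ ^ 2) (hm2.integrable_norm_pow (by norm_num))
  have hno : Integrable fun x => k x * ‖x - m‖ :=
    hkint (fun v => ‖v‖) (hm2.integrable (by norm_num)).norm
  have hk1 : Integrable k := by simpa using hkint (fun _ => 1) (integrable_const _)
  -- the `i`-th component of the flux and its derivative
  set g : Fin n → EuclideanSpace ℝ (Fin n) → ℝ := fun i x => k x * w x i with hg
  set g' : Fin n → EuclideanSpace ℝ (Fin n) → ℝ := fun i x =>
    k x * (-(2 * s)⁻¹ - (2 * s)⁻¹ * ((x - m) i * w x i)) with hg'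
  have hgd : ∀ i x, HasLineDerivAt ℝ (g i) (g' i x) x (e i) := by
    intro i x
    have h1 : HasFDerivAt k (-(heat s (x - m) / (2 * s)) • innerSL ℝ (x - m)) x := by
      have h0 := (hasFDerivAt_heat s (x - m)).comp x ((hasFDerivAt_id x).sub_const m)
      rwa [ContinuousLinearMap.comp_id] at h0
    have h2 : HasFDerivAt (fun x => w x i)
        (-((2 * s)⁻¹ • (EuclideanSpace.proj (𝕜 := ℝ) i :
          EuclideanSpace ℝ (Fin n) →L[ℝ] ℝ))) x := by
      have h3 : HasFDerivAt (fun x : EuclideanSpace ℝ (Fin n) => (x - m) i)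
          (EuclideanSpace.proj (𝕜 := ℝ) i : EuclideanSpace ℝ (Fin n) →L[ℝ] ℝ) x := by
        simpa using ((EuclideanSpace.proj (𝕜 := ℝ) i :
          EuclideanSpace ℝ (Fin n) →L[ℝ] ℝ).hasFDerivAt.sub_const (m i) (x := x))
      exact (h3.const_mul _).const_sub (u i)
    have h3 := (h1.mul h2).hasLineDerivAt (e i)
    convert! h3 using 1
    simp [g', e, hk, EuclideanSpace.inner_single_right]
    ring
  have hcomp : ∀ (z : EuclideanSpace ℝ (Fin n)) (i : Fin n), |z i| ≤ ‖z‖ := fun z i =>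
    PiLp.norm_apply_le z i
  have hwle : ∀ x, ‖w x‖ ≤ ‖u‖ + (2 * s)⁻¹ * ‖x - m‖ := by
    intro x
    refine (norm_sub_le _ _).trans ?_
    rw [norm_smul, Real.norm_of_nonneg (by positivity)]
  have hfg : ∀ i, Integrable fun x => f x * g i x := by
    intro i
    have hb : Integrable fun x => c * (k x * ‖u‖ + (2 * s)⁻¹ * (k x * ‖x - m‖)) :=
      ((hk1.mul_const _).add (hno.const_mul _)).const_mul c
    refine hb.mono' (by fun_prop) (ae_of_all _ fun x => ?_)
    rw [Real.norm_eq_abs, abs_mul, abs_mul, abs_of_nonneg (hk0 x)]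
    have h1 : k x * |w x i| ≤ k x * ‖u‖ + (2 * s)⁻¹ * (k x * ‖x - m‖) := by
      have := mul_le_mul_of_nonneg_left ((hcomp (w x) i).trans (hwle x)) (hk0 x)
      linarith
    exact mul_le_mul (hc x) h1 (by have := hk0 x; positivity) ((abs_nonneg _).trans (hc x))
  have hfg' : ∀ i, Integrable fun x => f x * g' i x := by
    intro i
    have hb : Integrable fun x => c * ((2 * s)⁻¹ * (k x + (k x * ‖x - m‖ * ‖u‖
        + (2 * s)⁻¹ * (k x * ‖x - m‖ ^ 2)))) :=
      ((hk1.add ((hno.mul_const _).add (hsq.const_mul _))).const_mul _).const_mul c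
    refine hb.mono' (by fun_prop) (ae_of_all _ fun x => ?_)
    rw [Real.norm_eq_abs, abs_mul]
    refine mul_le_mul (hc x) ?_ (abs_nonneg _) ((abs_nonneg _).trans (hc x))
    rw [abs_mul, abs_of_nonneg (hk0 x)]
    have h1 : |(x - m) i * w x i| ≤ ‖x - m‖ * (‖u‖ + (2 * s)⁻¹ * ‖x - m‖) := by
      rw [abs_mul]
      exact mul_le_mul (hcomp _ i) ((hcomp _ i).trans (hwle x)) (abs_nonneg _) (norm_nonneg _)
    have h2 : |-(2 * s)⁻¹ - (2 * s)⁻¹ * ((x - m) i * w x i)| ≤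
        (2 * s)⁻¹ * (1 + ‖x - m‖ * (‖u‖ + (2 * s)⁻¹ * ‖x - m‖)) := by
      rw [show -(2 * s)⁻¹ - (2 * s)⁻¹ * ((x - m) i * w x i) =
        -((2 * s)⁻¹ * (1 + (x - m) i * w x i)) by ring, abs_neg, abs_mul,
        abs_of_nonneg (by positivity : (0 : ℝ) ≤ (2 * s)⁻¹)]
      refine mul_le_mul_of_nonneg_left ((abs_add_le _ _).trans ?_) (by positivity)
      simpa using h1
    refine (mul_le_mul_of_nonneg_left h2 (hk0 x)).trans (le_of_eq ?_)
    ring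
  have hf'g : ∀ i, Integrable fun x => f' x i * g i x := by
    intro i
    refine hint.mono' (by fun_prop) (ae_of_all _ fun x => ?_)
    rw [Real.norm_eq_abs, abs_mul, abs_mul, abs_of_nonneg (hk0 x)]
    have := mul_le_mul (hcomp (f' x) i) (hcomp (w x) i) (abs_nonneg _) (norm_nonneg _)
    have := mul_le_mul_of_nonneg_left this (hk0 x)
    calc _ = k x * (|f' x i| * |w x i|) := by ring
      _ ≤ _ := this
  have hfd : ∀ i x, HasLineDerivAt ℝ f (f' x i) x (e i) := by
    intro i x
    have h1 := (hf x).hasFDerivAt.hasLineDerivAt (e i)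
    simpa [e, EuclideanSpace.inner_single_right] using h1
  -- Integrability of the three products replaces decay at infinity, so no boundary term appears and
  -- `f` need not be continuously differentiable.
  have hibp : ∀ i, ∫ x, f x * g' i x = -∫ x, f' x i * g i x := fun i =>
    integral_bilinear_hasLineDerivAt_right_eq_neg_left_of_integrable
      (B := ContinuousLinearMap.mul ℝ ℝ) (v := e i) (hf'g i) (hfg' i) (hfg i)
      (fun x _ => hfd i x) (fun x _ => hgd i x)
  have hinner : ∀ a b : EuclideanSpace ℝ (Fin n), inner ℝ a b = ∑ i, a i * b i := by
    intro a b
    simp [PiLp.inner_apply, mul_comm]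
  -- The divergence of the flux `k • w` is exactly the time derivative of the kernel: `-n / (2s)` is
  -- `k`'s factor from `div w`, and the other two terms come from `∇k · w`.
  have hL : ∀ x, f x * (k x * (‖x - m‖ ^ 2 / (4 * s ^ 2) - n / (2 * s)
        - inner ℝ (x - m) u / (2 * s))) = ∑ i, f x * g' i x := by
    intro x
    have hww : inner ℝ (x - m) (w x) = inner ℝ (x - m) u - (2 * s)⁻¹ * ‖x - m‖ ^ 2 := by
      rw [hw, inner_sub_right, inner_smul_right, real_inner_self_eq_norm_sq]
    rw [← Finset.mul_sum, ← Finset.mul_sum, Finset.sum_sub_distrib, ← Finset.mul_sum,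
      ← hinner, hww]
    simp only [Finset.sum_const, Finset.card_univ, Fintype.card_fin, nsmul_eq_mul]
    congr 2
    field_simp
    ring
  have hR : ∀ x, k x * inner ℝ (f' x) (w x) = ∑ i, f' x i * g i x := by
    intro x
    rw [hinner, Finset.mul_sum]
    refine Finset.sum_congr rfl fun i _ => ?_
    change _ = f' x i * (k x * w x i)
    ring
  rw [integral_congr_ae (ae_of_all _ hL), integral_congr_ae (ae_of_all _ hR),
    integral_finsetSum _ fun i _ => hfg' i, integral_finsetSum _ fun i _ => hf'g i,
    ← Finset.sum_neg_distrib]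
  exact Finset.sum_congr rfl fun i _ => hibp i

/-! ### The density of an Euler step, its gradient and its time derivative. -/

section EulerStep

variable {n : ℕ}

/-- The noise that brings `y` to `x` in an Euler step of length `s` with drift `-G`. -/
noncomputable def disp (G : EuclideanSpace ℝ (Fin n) → EuclideanSpace ℝ (Fin n)) (s : ℝ)
    (y x : EuclideanSpace ℝ (Fin n)) : EuclideanSpace ℝ (Fin n) :=
  x - (y - s • G y)

/-- The transition density of an Euler step of length `s` with drift `-G`. -/
noncomputable def kern (G : EuclideanSpace ℝ (Fin n) → EuclideanSpace ℝ (Fin n)) (s : ℝ)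
    (y x : EuclideanSpace ℝ (Fin n)) : ℝ :=
  heat s (disp G s y x)

/-- The time derivative of `kern`. -/
noncomputable def kernDot (G : EuclideanSpace ℝ (Fin n) → EuclideanSpace ℝ (Fin n)) (s : ℝ)
    (y x : EuclideanSpace ℝ (Fin n)) : ℝ :=
  kern G s y x * (‖disp G s y x‖ ^ 2 / (4 * s ^ 2) - n / (2 * s)
    - inner ℝ (disp G s y x) (G y) / (2 * s))

/-- The density after an Euler step of length `s` from the law `μ`. -/
noncomputable def mix (μ : Measure (EuclideanSpace ℝ (Fin n)))
    (G : EuclideanSpace ℝ (Fin n) → EuclideanSpace ℝ (Fin n)) (s : ℝ)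
    (x : EuclideanSpace ℝ (Fin n)) : ℝ :=
  ∫ y, kern G s y x ∂μ

/-- The gradient of `mix`. -/
noncomputable def mixGrad (μ : Measure (EuclideanSpace ℝ (Fin n)))
    (G : EuclideanSpace ℝ (Fin n) → EuclideanSpace ℝ (Fin n)) (s : ℝ)
    (x : EuclideanSpace ℝ (Fin n)) : EuclideanSpace ℝ (Fin n) :=
  ∫ y, (-(kern G s y x / (2 * s))) • disp G s y x ∂μ

/-- The time derivative of `mix`. -/
noncomputable def mixDot (μ : Measure (EuclideanSpace ℝ (Fin n)))
    (G : EuclideanSpace ℝ (Fin n) → EuclideanSpace ℝ (Fin n)) (s : ℝ)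
    (x : EuclideanSpace ℝ (Fin n)) : ℝ :=
  ∫ y, kernDot G s y x ∂μ

/-- The joint law of the two endpoints of an Euler step of length `s` from the law `μ`. -/
noncomputable def joint (μ : Measure (EuclideanSpace ℝ (Fin n)))
    (G : EuclideanSpace ℝ (Fin n) → EuclideanSpace ℝ (Fin n)) (s : ℝ) :
    Measure (EuclideanSpace ℝ (Fin n) × EuclideanSpace ℝ (Fin n)) :=
  (μ.prod (gauss n s)).map fun p => (p.1, p.1 - s • G p.1 + p.2)

theorem kern_pos (G : EuclideanSpace ℝ (Fin n) → EuclideanSpace ℝ (Fin n)) {s : ℝ} (hs : 0 < s)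
    (y x : EuclideanSpace ℝ (Fin n)) : 0 < kern G s y x :=
  heat_pos hs _

variable {μ : Measure (EuclideanSpace ℝ (Fin n))} [IsProbabilityMeasure μ]
  {G : EuclideanSpace ℝ (Fin n) → EuclideanSpace ℝ (Fin n)} {s : ℝ}

theorem measurable_disp (hG : Measurable G) :
    Measurable fun p : ℝ × EuclideanSpace ℝ (Fin n) × EuclideanSpace ℝ (Fin n) =>
      disp G p.1 p.2.1 p.2.2 := by
  unfold disp
  exact measurable_snd.snd.sub
    (measurable_snd.fst.sub (measurable_fst.smul (hG.comp measurable_snd.fst)))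

theorem measurable_kern (hG : Measurable G) :
    Measurable fun p : ℝ × EuclideanSpace ℝ (Fin n) × EuclideanSpace ℝ (Fin n) =>
      kern G p.1 p.2.1 p.2.2 :=
  measurable_heat.comp (measurable_fst.prodMk (measurable_disp hG))

theorem measurable_kernDot (hG : Measurable G) :
    Measurable fun p : ℝ × EuclideanSpace ℝ (Fin n) × EuclideanSpace ℝ (Fin n) =>
      kernDot G p.1 p.2.1 p.2.2 := by
  have h1 := measurable_kern hG
  have h2 := measurable_disp hG
  have h3 : Measurable fun p : ℝ × EuclideanSpace ℝ (Fin n) × EuclideanSpace ℝ (Fin n) =>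
      G p.2.1 := hG.comp measurable_snd.fst
  unfold kernDot
  fun_prop

theorem measurable_kern_prod (hG : Measurable G) (s : ℝ) :
    Measurable fun p : EuclideanSpace ℝ (Fin n) × EuclideanSpace ℝ (Fin n) =>
      kern G s p.1 p.2 := by
  have h : Measurable fun p : EuclideanSpace ℝ (Fin n) × EuclideanSpace ℝ (Fin n) =>
    (s, p.1, p.2) := by fun_prop
  exact (measurable_kern hG).comp h

theorem measurable_disp_prod (hG : Measurable G) (s : ℝ) :
    Measurable fun p : EuclideanSpace ℝ (Fin n) × EuclideanSpace ℝ (Fin n) =>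
      disp G s p.1 p.2 := by
  have h : Measurable fun p : EuclideanSpace ℝ (Fin n) × EuclideanSpace ℝ (Fin n) =>
    (s, p.1, p.2) := by fun_prop
  exact (measurable_disp hG).comp h

theorem measurable_kern_left (hG : Measurable G) (s : ℝ) (x : EuclideanSpace ℝ (Fin n)) :
    Measurable fun y => kern G s y x := by
  have h : Measurable fun y : EuclideanSpace ℝ (Fin n) => (s, y, x) := by fun_prop
  exact (measurable_kern hG).comp h

theorem measurable_disp_left (hG : Measurable G) (s : ℝ) (x : EuclideanSpace ℝ (Fin n)) :
    Measurable fun y => disp G s y x := by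
  have h : Measurable fun y : EuclideanSpace ℝ (Fin n) => (s, y, x) := by fun_prop
  exact (measurable_disp hG).comp h

theorem measurable_mix (hG : Measurable G) :
    Measurable fun p : ℝ × EuclideanSpace ℝ (Fin n) => mix μ G p.1 p.2 := by
  have hr : Measurable fun q : (ℝ × EuclideanSpace ℝ (Fin n)) × EuclideanSpace ℝ (Fin n) =>
      (q.1.1, q.2, q.1.2) := by fun_prop
  have h : Measurable fun q : (ℝ × EuclideanSpace ℝ (Fin n)) × EuclideanSpace ℝ (Fin n) =>
      kern G q.1.1 q.2 q.1.2 :=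
    (measurable_kern hG).comp hr
  exact h.stronglyMeasurable.integral_prod_right'.measurable

theorem measurable_mixGrad (hG : Measurable G) :
    Measurable fun p : ℝ × EuclideanSpace ℝ (Fin n) => mixGrad μ G p.1 p.2 := by
  have hr : Measurable fun q : (ℝ × EuclideanSpace ℝ (Fin n)) × EuclideanSpace ℝ (Fin n) =>
      (q.1.1, q.2, q.1.2) := by fun_prop
  have h1 := (measurable_kern hG).comp hr
  have h2 := (measurable_disp hG).comp hr
  have h : Measurable fun q : (ℝ × EuclideanSpace ℝ (Fin n)) × EuclideanSpace ℝ (Fin n) =>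
      (-(kern G q.1.1 q.2 q.1.2 / (2 * q.1.1))) • disp G q.1.1 q.2 q.1.2 :=
    (h1.div (by fun_prop)).neg.smul h2
  exact h.stronglyMeasurable.integral_prod_right'.measurable

theorem measurable_mixDot (hG : Measurable G) :
    Measurable fun p : ℝ × EuclideanSpace ℝ (Fin n) => mixDot μ G p.1 p.2 := by
  have hr : Measurable fun q : (ℝ × EuclideanSpace ℝ (Fin n)) × EuclideanSpace ℝ (Fin n) =>
      (q.1.1, q.2, q.1.2) := by fun_prop
  have h : Measurable fun q : (ℝ × EuclideanSpace ℝ (Fin n)) × EuclideanSpace ℝ (Fin n) =>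
      kernDot G q.1.1 q.2 q.1.2 :=
    (measurable_kernDot hG).comp hr
  exact h.stronglyMeasurable.integral_prod_right'.measurable

theorem measurable_mix_right (hG : Measurable G) (s : ℝ) : Measurable (mix μ G s) :=
  (measurable_mix hG).of_uncurry_left (f := mix μ G)

theorem measurable_mixGrad_right (hG : Measurable G) (s : ℝ) : Measurable (mixGrad μ G s) :=
  (measurable_mixGrad hG).of_uncurry_left (f := mixGrad μ G)

theorem integrable_kern (hG : Measurable G) (hs : 0 < s) (x : EuclideanSpace ℝ (Fin n)) :
    Integrable (fun y => kern G s y x) μ := by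
  obtain ⟨C, hC⟩ := exists_heat_bound (n := n) (a := s) (b := s) hs
  refine Integrable.of_bound (measurable_kern_left hG s x).aestronglyMeasurable C
    (ae_of_all _ fun y => ?_)
  rw [Real.norm_of_nonneg (kern_pos G hs _ _).le]
  exact (hC s (by simp) _).1

theorem integrable_kern_mul_norm_sq (hG : Measurable G) (hs : 0 < s)
    (x : EuclideanSpace ℝ (Fin n)) :
    Integrable (fun y => kern G s y x * ‖disp G s y x‖ ^ 2) μ := by
  obtain ⟨C, hC⟩ := exists_heat_bound (n := n) (a := s) (b := s) hs
  refine Integrable.of_bound ((measurable_kern_left hG s x).mul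
    ((measurable_disp_left hG s x).norm.pow_const 2)).aestronglyMeasurable C
    (ae_of_all _ fun y => ?_)
  rw [Real.norm_of_nonneg (mul_nonneg (kern_pos G hs _ _).le (by positivity))]
  exact (hC s (by simp) _).2.2

theorem integrable_kern_smul_disp (hG : Measurable G) (hs : 0 < s)
    (x : EuclideanSpace ℝ (Fin n)) :
    Integrable (fun y => kern G s y x • disp G s y x) μ := by
  obtain ⟨C, hC⟩ := exists_heat_bound (n := n) (a := s) (b := s) hs
  refine Integrable.of_bound ((measurable_kern_left hG s x).smul
    (measurable_disp_left hG s x)).aestronglyMeasurable C (ae_of_all _ fun y => ?_)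
  rw [norm_smul, Real.norm_of_nonneg (kern_pos G hs _ _).le]
  exact (hC s (by simp) _).2.1

theorem mix_pos (hG : Measurable G) (hs : 0 < s) (x : EuclideanSpace ℝ (Fin n)) :
    0 < mix μ G s x := by
  unfold mix
  rw [integral_pos_iff_support_of_nonneg (fun y => (kern_pos G hs _ _).le) (integrable_kern hG hs x)]
  have : Function.support (fun y => kern G s y x) = univ :=
    Function.support_eq_univ fun y => (kern_pos G hs _ _).ne'
  rw [this]; simp

/-- The product `heat s v * ‖v‖` is bounded, so differentiation under the integral is dominated by a
constant and no moment of `μ` is needed. -/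
theorem hasGradientAt_mix (hG : Measurable G) (hs : 0 < s) (x : EuclideanSpace ℝ (Fin n)) :
    HasGradientAt (mix μ G s) (mixGrad μ G s x) x := by
  obtain ⟨C, hC⟩ := exists_heat_bound (n := n) (a := s) (b := s) hs
  have h := hasFDerivAt_integral_of_dominated_of_fderiv_le (μ := μ) (x₀ := x) (s := univ)
    (F := fun x y => kern G s y x)
    (F' := fun x y => (-(kern G s y x / (2 * s))) • innerSL ℝ (disp G s y x))
    (bound := fun _ => C / (2 * s)) univ_mem
    (Eventually.of_forall fun x => (measurable_kern_left hG s x).aestronglyMeasurable)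
    (integrable_kern hG hs x)
    (((measurable_kern_left hG s x).div_const _).neg.smul
      ((innerSL ℝ).continuous.measurable.comp
        (measurable_disp_left hG s x))).aestronglyMeasurable
    (ae_of_all _ fun y x _ => by
      rw [norm_smul, innerSL_apply_norm, norm_neg, norm_div,
        Real.norm_of_nonneg (by positivity : 0 ≤ 2 * s),
        Real.norm_of_nonneg (kern_pos G hs _ _).le, div_mul_eq_mul_div]
      exact div_le_div_of_nonneg_right (hC s (by simp) _).2.1 (by positivity))
    (integrable_const _)
    (ae_of_all _ fun y x _ => by
      have h0 := (hasFDerivAt_heat s (disp G s y x)).comp x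
        ((hasFDerivAt_id x).sub_const (y - s • G y))
      rwa [ContinuousLinearMap.comp_id] at h0)
  rw [hasGradientAt_iff_hasFDerivAt]
  refine h.congr_fderiv ?_
  have h2 : Integrable (fun y => (-(kern G s y x / (2 * s))) • disp G s y x) μ := by
    refine ((integrable_kern_smul_disp hG hs x).smul (-(2 * s)⁻¹)).congr (ae_of_all _ fun y => ?_)
    simp only [smul_smul, Pi.smul_apply]
    congr 1
    ring
  have h3 := (innerSL ℝ (E := EuclideanSpace ℝ (Fin n))).integral_comp_comm h2
  ext w
  rw [mixGrad, InnerProductSpace.toDual_apply_apply, ← innerSL_apply_apply ℝ, ← h3]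
  congr 1
  refine integral_congr_ae (ae_of_all _ fun y => ?_)
  simp

/-- Moving the time also moves the centre `y - s • G y`, which puts a factor `G y` into the
derivative. The bounds on the heat kernel are uniform on `[s/2, 2s]`, so integrability of `G`
suffices for domination. -/
theorem integrable_kernDot_and_hasDerivAt_mix (hG : Measurable G) (hGi : Integrable G μ)
    (hs : 0 < s) (x : EuclideanSpace ℝ (Fin n)) :
    Integrable (fun y => kernDot G s y x) μ ∧
      HasDerivAt (fun r => mix μ G r x) (mixDot μ G s x) s := by
  obtain ⟨C, hC⟩ := exists_heat_bound (n := n) (a := s / 2) (b := 2 * s) (by positivity)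
  have hC0 : 0 ≤ C := by
    have h1 := (hC s ⟨by linarith, by linarith⟩ 0).1
    exact (heat_pos hs _).le.trans h1
  have hm : Measurable fun y : EuclideanSpace ℝ (Fin n) => (s, y, x) := by fun_prop
  have hnhd : Icc (s / 2) (2 * s) ∈ 𝓝 s := Icc_mem_nhds (by linarith) (by linarith)
  refine hasDerivAt_integral_of_dominated_loc_of_deriv_le (μ := μ) (x₀ := s)
    (s := Icc (s / 2) (2 * s))
    (F := fun r y => kern G r y x) (F' := fun r y => kernDot G r y x)
    (bound := fun y => C * (1 / s ^ 2 + n / s) + C / s * ‖G y‖) hnhd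
    (Eventually.of_forall fun r => (measurable_kern_left hG r x).aestronglyMeasurable)
    (integrable_kern hG hs x)
    ((measurable_kernDot hG).comp hm).aestronglyMeasurable
    (ae_of_all _ fun y r hr => ?_)
    ((integrable_const _).add (hGi.norm.const_mul _))
    (ae_of_all _ fun y r hr => ?_)
  · have hr0 : 0 < r := by linarith [hr.1]
    set v := disp G r y x with hv
    obtain ⟨h1, h2, h3⟩ := hC r hr v
    have hk : 0 ≤ kern G r y x := (heat_pos hr0 _).le
    have hin : |inner ℝ v (G y)| ≤ ‖v‖ * ‖G y‖ := abs_real_inner_le_norm v (G y)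
    have hi : 1 / (2 * r) ≤ 1 / s := one_div_le_one_div_of_le hs (by linarith [hr.1])
    have hi2 : 1 / (4 * r ^ 2) ≤ 1 / s ^ 2 :=
      one_div_le_one_div_of_le (by positivity) (by nlinarith [hr.1])
    have e : kernDot G r y x = 1 / (4 * r ^ 2) * (heat r v * ‖v‖ ^ 2) - 1 / (2 * r) * n * heat r v
        - 1 / (2 * r) * (heat r v * inner ℝ v (G y)) := by
      simp only [kernDot, kern, ← hv]; ring
    have hh : 0 ≤ heat r v := hk
    have a1 : 1 / (4 * r ^ 2) * (heat r v * ‖v‖ ^ 2) ≤ 1 / s ^ 2 * C :=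
      mul_le_mul hi2 h3 (by positivity) (by positivity)
    have a2 : 1 / (2 * r) * n * heat r v ≤ 1 / s * n * C :=
      mul_le_mul (mul_le_mul_of_nonneg_right hi n.cast_nonneg) h1 hh (by positivity)
    have a3 : |1 / (2 * r) * (heat r v * inner ℝ v (G y))| ≤ 1 / s * (C * ‖G y‖) := by
      rw [abs_mul, abs_mul, abs_of_nonneg hh, abs_of_nonneg (by positivity : 0 ≤ 1 / (2 * r))]
      refine mul_le_mul hi ?_ (by positivity) (by positivity)
      calc heat r v * |inner ℝ v (G y)| ≤ heat r v * (‖v‖ * ‖G y‖) :=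
            mul_le_mul_of_nonneg_left hin hh
        _ = heat r v * ‖v‖ * ‖G y‖ := by ring
        _ ≤ C * ‖G y‖ := mul_le_mul_of_nonneg_right h2 (norm_nonneg _)
    have b1 : 0 ≤ 1 / (4 * r ^ 2) * (heat r v * ‖v‖ ^ 2) := by positivity
    have b2 : 0 ≤ 1 / (2 * r) * n * heat r v := by positivity
    rw [Real.norm_eq_abs, e]
    refine (abs_sub _ _).trans ((add_le_add_left (abs_sub _ _) _).trans ?_)
    rw [abs_of_nonneg b1, abs_of_nonneg b2]
    calc _ ≤ 1 / s ^ 2 * C + 1 / s * n * C + 1 / s * (C * ‖G y‖) :=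
          add_le_add (add_le_add a1 a2) a3
      _ = _ := by ring
  · have hr0 : 0 < r := by linarith [hr.1]
    have h := hasDerivAt_heat_line hr0 (x - y) (G y)
    have e : ∀ t, disp G t y x = x - y + t • G y := fun t => by simp only [disp]; abel
    simp only [kernDot, kern, e]
    exact h

end EulerStep

theorem integrable_inner_of_memLp {α E : Type*} [MeasurableSpace α] {ρ : Measure α}
    [NormedAddCommGroup E] [InnerProductSpace ℝ E] {f g : α → E} (hf : MemLp f 2 ρ)
    (hg : MemLp g 2 ρ) : Integrable (fun a => inner ℝ (f a) (g a)) ρ := by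
  refine (hf.norm.integrable_mul hg.norm).mono' (hf.1.inner hg.1) (ae_of_all _ fun a => ?_)
  exact norm_inner_le_norm _ _

/-! ### The joint law of the endpoints of a step; the score as a conditional expectation. -/

section Joint

variable {n : ℕ}

/-- The score of `mix`. -/
noncomputable def mixScore (μ : Measure (EuclideanSpace ℝ (Fin n)))
    (G : EuclideanSpace ℝ (Fin n) → EuclideanSpace ℝ (Fin n)) (s : ℝ)
    (x : EuclideanSpace ℝ (Fin n)) : EuclideanSpace ℝ (Fin n) :=
  (mix μ G s x)⁻¹ • mixGrad μ G s x

variable {μ : Measure (EuclideanSpace ℝ (Fin n))} [IsProbabilityMeasure μ]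
  {G : EuclideanSpace ℝ (Fin n) → EuclideanSpace ℝ (Fin n)} {s : ℝ}

theorem measurable_mixScore_right (hG : Measurable G) (s : ℝ) : Measurable (mixScore μ G s) :=
  (measurable_mix_right hG s).inv.smul (measurable_mixGrad_right hG s)

theorem measurable_eulerMap (hG : Measurable G) (s : ℝ) :
    Measurable fun p : EuclideanSpace ℝ (Fin n) × EuclideanSpace ℝ (Fin n) =>
      (p.1, p.1 - s • G p.1 + p.2) := by
  have : Measurable fun p : EuclideanSpace ℝ (Fin n) × EuclideanSpace ℝ (Fin n) => G p.1 :=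
    hG.comp measurable_fst
  fun_prop

/-- For fixed `y`, the translation from the noise to the endpoint preserves Lebesgue measure. With a
density over the product `μ × volume`, one may integrate in either order, hence also condition on
the endpoint. -/
theorem joint_eq_withDensity (hG : Measurable G) (hs : 0 < s) :
    joint μ G s = (μ.prod volume).withDensity fun p => ENNReal.ofReal (kern G s p.1 p.2) := by
  have := isProbabilityMeasure_gauss (n := n) hs
  have hk := (measurable_kern_prod hG s).ennreal_ofReal
  refine Measure.ext_of_lintegral _ fun F hF => ?_
  rw [joint, lintegral_map hF (measurable_eulerMap hG s),
    lintegral_withDensity_eq_lintegral_mul _ hk hF,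
    lintegral_prod _ (hF.fun_comp (measurable_eulerMap hG s)).aemeasurable,
    lintegral_prod _ (hk.mul hF).aemeasurable]
  refine lintegral_congr fun y => ?_
  have hFy : Measurable fun z => F (y, z) := hF.comp measurable_prodMk_left
  simp only
  rw [gauss, lintegral_withDensity_eq_lintegral_mul _ (by fun_prop)
    (hFy.fun_comp (measurable_const_add _))]
  rw [← lintegral_sub_right_eq_self _ (y - s • G y)]
  refine lintegral_congr fun x => ?_
  simp only [Pi.mul_apply, kern, disp]
  rw [show y - s • G y + (x - (y - s • G y)) = x by abel]

theorem isProbabilityMeasure_joint (hG : Measurable G) (hs : 0 < s) :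
    IsProbabilityMeasure (joint μ G s) := by
  have := isProbabilityMeasure_gauss (n := n) hs
  exact Measure.isProbabilityMeasure_map (measurable_eulerMap hG s).aemeasurable

theorem lintegral_joint_symm (hG : Measurable G) (hs : 0 < s)
    {F : EuclideanSpace ℝ (Fin n) × EuclideanSpace ℝ (Fin n) → ℝ≥0∞} (hF : Measurable F) :
    ∫⁻ p, F p ∂joint μ G s = ∫⁻ x, ∫⁻ y, ENNReal.ofReal (kern G s y x) * F (y, x) ∂μ := by
  have hk := (measurable_kern_prod hG s).ennreal_ofReal
  rw [joint_eq_withDensity hG hs, lintegral_withDensity_eq_lintegral_mul _ hk hF,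
    lintegral_prod_symm _ (hk.mul hF).aemeasurable]
  rfl

theorem ofReal_mix (hG : Measurable G) (hs : 0 < s) (x : EuclideanSpace ℝ (Fin n)) :
    ENNReal.ofReal (mix μ G s x) = ∫⁻ y, ENNReal.ofReal (kern G s y x) ∂μ :=
  ofReal_integral_eq_lintegral_ofReal (integrable_kern hG hs x)
    (ae_of_all _ fun y => (kern_pos G hs y x).le)

theorem map_snd_joint (hG : Measurable G) (hs : 0 < s) :
    (joint μ G s).map Prod.snd = densityMeasure (mix μ G s) := by
  refine Measure.ext_of_lintegral _ fun F hF => ?_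
  rw [lintegral_map hF measurable_snd, lintegral_joint_symm hG hs (hF.fun_comp measurable_snd),
    densityMeasure, lintegral_withDensity_eq_lintegral_mul _
      (measurable_mix_right hG s).ennreal_ofReal hF]
  refine lintegral_congr fun x => ?_
  rw [Pi.mul_apply, ofReal_mix hG hs, ← lintegral_mul_const _
    (measurable_kern_left hG s x).ennreal_ofReal]

theorem map_fst_joint (hG : Measurable G) (hs : 0 < s) :
    (joint μ G s).map Prod.fst = μ := by
  have := isProbabilityMeasure_gauss (n := n) hs
  rw [joint, Measure.map_map measurable_fst (measurable_eulerMap hG s)]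
  exact Measure.fst_prod

theorem integrable_joint_iff (hG : Measurable G) (hs : 0 < s)
    {F : EuclideanSpace ℝ (Fin n) × EuclideanSpace ℝ (Fin n) → ℝ} :
    Integrable F (joint μ G s) ↔
      Integrable (fun p => kern G s p.1 p.2 * F p) (μ.prod volume) := by
  rw [joint_eq_withDensity hG hs, integrable_withDensity_iff_integrable_smul'
    (measurable_kern_prod hG s).ennreal_ofReal (ae_of_all _ fun _ => ENNReal.ofReal_lt_top)]
  simp_rw [ENNReal.toReal_ofReal (kern_pos G hs _ _).le, smul_eq_mul]

theorem integral_joint (hG : Measurable G) (hs : 0 < s)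
    {F : EuclideanSpace ℝ (Fin n) × EuclideanSpace ℝ (Fin n) → ℝ}
    (hF : Integrable F (joint μ G s)) :
    ∫ p, F p ∂joint μ G s = ∫ y, ∫ x, kern G s y x * F (y, x) ∂volume ∂μ := by
  rw [← integral_prod _ ((integrable_joint_iff hG hs).1 hF), joint_eq_withDensity hG hs,
    integral_withDensity_eq_integral_toReal_smul (measurable_kern_prod hG s).ennreal_ofReal
      (ae_of_all _ fun _ => ENNReal.ofReal_lt_top)]
  simp_rw [ENNReal.toReal_ofReal (kern_pos G hs _ _).le, smul_eq_mul]

theorem integral_joint_symm (hG : Measurable G) (hs : 0 < s)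
    {F : EuclideanSpace ℝ (Fin n) × EuclideanSpace ℝ (Fin n) → ℝ}
    (hF : Integrable F (joint μ G s)) :
    ∫ p, F p ∂joint μ G s = ∫ x, ∫ y, kern G s y x * F (y, x) ∂μ := by
  rw [← integral_prod_symm _ ((integrable_joint_iff hG hs).1 hF), joint_eq_withDensity hG hs,
    integral_withDensity_eq_integral_toReal_smul (measurable_kern_prod hG s).ennreal_ofReal
      (ae_of_all _ fun _ => ENNReal.ofReal_lt_top)]
  simp_rw [ENNReal.toReal_ofReal (kern_pos G hs _ _).le, smul_eq_mul]

theorem memLp_fst_joint (hG : Measurable G) (hs : 0 < s)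
    {f : EuclideanSpace ℝ (Fin n) → EuclideanSpace ℝ (Fin n)} (hf : MemLp f 2 μ) :
    MemLp (fun p => f p.1) 2 (joint μ G s) := by
  have h : MemLp f 2 ((joint μ G s).map Prod.fst) := by rwa [map_fst_joint hG hs]
  exact h.comp_of_map measurable_fst.aemeasurable

/-- The noise can be read off from the two endpoints. -/
theorem map_disp_joint (hG : Measurable G) (hs : 0 < s) :
    (joint μ G s).map (fun p => disp G s p.1 p.2) = gauss n s := by
  have := isProbabilityMeasure_gauss (n := n) hs
  rw [joint, Measure.map_map (measurable_disp_prod hG s) (measurable_eulerMap hG s)]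
  have : ((fun p : EuclideanSpace ℝ (Fin n) × EuclideanSpace ℝ (Fin n) => disp G s p.1 p.2) ∘
      fun p => (p.1, p.1 - s • G p.1 + p.2)) = Prod.snd := by
    ext1 p
    simp [disp]
  rw [this]
  exact Measure.snd_prod

theorem memLp_disp_joint (hG : Measurable G) (hs : 0 < s) :
    MemLp (fun p => disp G s p.1 p.2) 2 (joint μ G s) := by
  have h := memLp_id_gauss (n := n) hs
  rw [← map_disp_joint (μ := μ) hG hs] at h
  exact h.comp_of_map (measurable_disp_prod hG s).aemeasurable

theorem integral_norm_sq_disp (hG : Measurable G) (hs : 0 < s) :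
    ∫ p, ‖disp G s p.1 p.2‖ ^ 2 ∂joint μ G s = 2 * s * n := by
  rw [← integral_norm_sq_gauss hs, ← map_disp_joint (μ := μ) hG hs,
    integral_map (measurable_disp_prod hG s).aemeasurable (by fun_prop)]

theorem mixGrad_eq (x : EuclideanSpace ℝ (Fin n)) :
    mixGrad μ G s x = -(2 * s)⁻¹ • ∫ y, kern G s y x • disp G s y x ∂μ := by
  rw [mixGrad, ← integral_smul]
  refine integral_congr_ae (ae_of_all _ fun y => ?_)
  simp only [smul_smul]
  congr 1
  ring

/-- The Fisher information of a Gaussian mixture, pointwise. -/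
theorem norm_sq_mixScore_le (hG : Measurable G) (hs : 0 < s) (x : EuclideanSpace ℝ (Fin n)) :
    mix μ G s x * ‖mixScore μ G s x‖ ^ 2 ≤
      (4 * s ^ 2)⁻¹ * ∫ y, kern G s y x * ‖disp G s y x‖ ^ 2 ∂μ := by
  set q := mix μ G s x with hq
  have hq0 : 0 < q := mix_pos hG hs x
  set m := ∫ y, kern G s y x • disp G s y x ∂μ with hm
  -- `a` is the conditional mean of the noise given the endpoint `x`, and the score equals `-a /
  -- (2s)`. The estimate is the nonnegativity of the conditional variance.
  set a := q⁻¹ • m with ha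
  have h1 := integrable_kern_mul_norm_sq (μ := μ) hG hs x
  have h2 := integrable_kern_smul_disp (μ := μ) hG hs x
  have h3 := integrable_kern (μ := μ) hG hs x
  have hin : ∫ y, inner ℝ a (kern G s y x • disp G s y x) ∂μ = inner ℝ a m :=
    integral_inner h2 a
  have hpos : 0 ≤ ∫ y, kern G s y x * ‖disp G s y x - a‖ ^ 2 ∂μ :=
    integral_nonneg fun y => mul_nonneg (kern_pos G hs y x).le (by positivity)
  have h12 : Integrable (fun y => kern G s y x * ‖disp G s y x‖ ^ 2 -
      2 * inner ℝ a (kern G s y x • disp G s y x)) μ := h1.sub ((h2.const_inner a).const_mul 2)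
  have hexp : ∫ y, kern G s y x * ‖disp G s y x - a‖ ^ 2 ∂μ =
      ∫ y, kern G s y x * ‖disp G s y x‖ ^ 2 ∂μ - 2 * inner ℝ a m + q * ‖a‖ ^ 2 := by
    rw [← hin, hq, mix, ← integral_const_mul, ← integral_mul_const,
      ← integral_sub h1 ((h2.const_inner a).const_mul 2),
      ← integral_add h12 (h3.mul_const _)]
    refine integral_congr_ae (ae_of_all _ fun y => ?_)
    simp only [norm_sub_sq_real, inner_smul_right, real_inner_comm a]
    rw [real_inner_comm]
    ring
  have ham : inner ℝ a m = q * ‖a‖ ^ 2 := by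
    have : m = q • a := by rw [ha, smul_smul, mul_inv_cancel₀ hq0.ne', one_smul]
    rw [this, inner_smul_right, real_inner_self_eq_norm_sq]
  have hsc : mixScore μ G s x = -(2 * s)⁻¹ • a := by
    rw [mixScore, mixGrad_eq, ha, smul_comm]
  have hn : ‖mixScore μ G s x‖ ^ 2 = (4 * s ^ 2)⁻¹ * ‖a‖ ^ 2 := by
    rw [hsc, norm_smul, mul_pow, norm_neg, Real.norm_eq_abs, sq_abs]
    congr 1
    rw [inv_pow]; congr 1; ring
  rw [hn]
  have : q * ‖a‖ ^ 2 ≤ ∫ y, kern G s y x * ‖disp G s y x‖ ^ 2 ∂μ := by linarith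
  calc _ = (4 * s ^ 2)⁻¹ * (q * ‖a‖ ^ 2) := by ring
    _ ≤ _ := mul_le_mul_of_nonneg_left this (by positivity)

/-- Integrating the pointwise bound over `x` compares the score with the Gaussian noise, so for `s >
0` the score is square integrable whatever `μ` is. Since integrability is the claim, the computation
runs with lower integrals. -/
theorem memLp_mixScore (hG : Measurable G) (hs : 0 < s) :
    MemLp (fun p => mixScore μ G s p.2) 2 (joint μ G s) := by
  have hm : Measurable fun p : EuclideanSpace ℝ (Fin n) × EuclideanSpace ℝ (Fin n) =>
      mixScore μ G s p.2 := (measurable_mixScore_right hG s).comp measurable_snd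
  rw [memLp_two_iff_integrable_sq_norm hm.aestronglyMeasurable]
  refine ⟨(hm.norm.pow_const 2).aestronglyMeasurable, ?_⟩
  have hd : ∫⁻ p, ENNReal.ofReal (‖disp G s p.1 p.2‖ ^ 2) ∂joint μ G s < ∞ := by
    have := (memLp_disp_joint (μ := μ) hG hs).integrable_norm_pow (by norm_num)
    exact (hasFiniteIntegral_iff_ofReal (ae_of_all _ fun p => by positivity)).1 this.2
  rw [hasFiniteIntegral_iff_ofReal (ae_of_all _ fun p => by positivity)]
  rw [lintegral_joint_symm hG hs
    ((measurable_disp_prod hG s).norm.pow_const 2).ennreal_ofReal] at hd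
  rw [lintegral_joint_symm hG hs (hm.norm.pow_const 2).ennreal_ofReal]
  have hle : ∀ x, ∫⁻ y, ENNReal.ofReal (kern G s y x) *
      ENNReal.ofReal (‖mixScore μ G s x‖ ^ 2) ∂μ ≤ ENNReal.ofReal (4 * s ^ 2)⁻¹ *
        ∫⁻ y, ENNReal.ofReal (kern G s y x) * ENNReal.ofReal (‖disp G s y x‖ ^ 2) ∂μ := by
    intro x
    rw [lintegral_mul_const _ (measurable_kern_left hG s x).ennreal_ofReal, ← ofReal_mix hG hs,
      ← ENNReal.ofReal_mul (mix_pos hG hs x).le]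
    refine (ENNReal.ofReal_le_ofReal (norm_sq_mixScore_le hG hs x)).trans (le_of_eq ?_)
    rw [ENNReal.ofReal_mul (by positivity), ofReal_integral_eq_lintegral_ofReal
      (integrable_kern_mul_norm_sq hG hs x)
      (ae_of_all _ fun y => mul_nonneg (kern_pos G hs y x).le (by positivity))]
    congr 1
    refine lintegral_congr fun y => ?_
    rw [ENNReal.ofReal_mul (kern_pos G hs y x).le]
  refine (lintegral_mono hle).trans_lt ?_
  rw [lintegral_const_mul' _ _ ENNReal.ofReal_ne_top]
  exact ENNReal.mul_lt_top ENNReal.ofReal_lt_top hd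

/-- The score of the mixture is a conditional expectation. -/
theorem integral_inner_mixScore (hG : Measurable G) (hs : 0 < s)
    {g : EuclideanSpace ℝ (Fin n) → EuclideanSpace ℝ (Fin n)}
    (hg : MemLp (fun p => g p.2) 2 (joint μ G s)) :
    ∫ p, inner ℝ (mixScore μ G s p.2) (g p.2) ∂joint μ G s =
      -(2 * s)⁻¹ * ∫ p, inner ℝ (disp G s p.1 p.2) (g p.2) ∂joint μ G s := by
  have h1 : Integrable (fun p => inner ℝ (mixScore μ G s p.2) (g p.2)) (joint μ G s) :=
    integrable_inner_of_memLp (memLp_mixScore hG hs) hg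
  have h2 : Integrable (fun p => inner ℝ (disp G s p.1 p.2) (g p.2)) (joint μ G s) :=
    integrable_inner_of_memLp (memLp_disp_joint hG hs) hg
  rw [integral_joint_symm hG hs h1, integral_joint_symm hG hs h2, ← integral_const_mul]
  refine integral_congr_ae (ae_of_all _ fun x => ?_)
  simp only
  rw [integral_mul_const]
  have h3 : ∫ y, kern G s y x * inner ℝ (disp G s y x) (g x) ∂μ =
      inner ℝ (∫ y, kern G s y x • disp G s y x ∂μ) (g x) := by
    rw [real_inner_comm, ← integral_inner (integrable_kern_smul_disp hG hs x)]
    refine integral_congr_ae (ae_of_all _ fun y => ?_)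
    simp only [inner_smul_right]
    rw [real_inner_comm]
  rw [h3, mixScore, mixGrad_eq, inner_smul_left, inner_smul_left]
  change mix μ G s x * _ = _
  simp only [conj_trivial]
  rw [mul_inv_cancel_left₀ (mix_pos hG hs x).ne']

/-- A Gaussian integration by parts inequality for Lipschitz vector fields. -/
theorem integral_inner_disp_le (hG : Measurable G) (hs : 0 < s)
    {g : EuclideanSpace ℝ (Fin n) → EuclideanSpace ℝ (Fin n)} {L : ℝ}
    (hgc : Continuous g) (hL : ∀ x y, ‖g x - g y‖ ≤ L * ‖x - y‖)
    (hg : MemLp (fun p => g p.2) 2 (joint μ G s)) :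
    ∫ p, inner ℝ (disp G s p.1 p.2) (g p.2) ∂joint μ G s ≤ L * (2 * s * n) := by
  have := isProbabilityMeasure_gauss (n := n) hs
  have hT := measurable_eulerMap hG s
  have hz : MemLp (fun p : EuclideanSpace ℝ (Fin n) × EuclideanSpace ℝ (Fin n) => p.2) 2
      (μ.prod (gauss n s)) := (memLp_id_gauss hs).comp_snd μ
  have hg1 : MemLp (fun p : EuclideanSpace ℝ (Fin n) × EuclideanSpace ℝ (Fin n) =>
      g (p.1 - s • G p.1 + p.2)) 2 (μ.prod (gauss n s)) := hg.comp_of_map hT.aemeasurable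
  have hmp : Measurable fun p : EuclideanSpace ℝ (Fin n) × EuclideanSpace ℝ (Fin n) =>
      p.1 - s • G p.1 := by
    have : Measurable fun p : EuclideanSpace ℝ (Fin n) × EuclideanSpace ℝ (Fin n) => G p.1 :=
      hG.comp measurable_fst
    fun_prop
  have hd : MemLp (fun p : EuclideanSpace ℝ (Fin n) × EuclideanSpace ℝ (Fin n) =>
      g (p.1 - s • G p.1 + p.2) - g (p.1 - s • G p.1)) 2 (μ.prod (gauss n s)) := by
    refine (hz.norm.const_mul L).mono' ?_ (ae_of_all _ fun p => ?_)
    · exact ((hgc.measurable.comp (hmp.add measurable_snd)).sub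
        (hgc.measurable.comp hmp)).aestronglyMeasurable
    · simpa using hL (p.1 - s • G p.1 + p.2) (p.1 - s • G p.1)
  have hg0 : MemLp (fun p : EuclideanSpace ℝ (Fin n) × EuclideanSpace ℝ (Fin n) =>
      g (p.1 - s • G p.1)) 2 (μ.prod (gauss n s)) := by
    refine (hg1.sub hd).congr_norm ?_ (ae_of_all _ fun p => ?_)
    · exact (hgc.measurable.comp hmp).aestronglyMeasurable
    · simp
  -- The noise is centred and independent of the start, so it is orthogonal to `g` at the noise-free
  -- point. Only the increment of `g` caused by the noise remains, and the Lipschitz bound gives `L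
  -- * E‖z‖²` without differentiating `g`.
  have h0 : ∫ p, inner ℝ p.2 (g (p.1 - s • G p.1)) ∂(μ.prod (gauss n s)) = 0 := by
    rw [integral_prod _ (integrable_inner_of_memLp hz hg0)]
    refine integral_eq_zero_of_ae (ae_of_all _ fun y => ?_)
    simp only [Pi.zero_apply]
    simp_rw [real_inner_comm (g (y - s • G y))]
    have h := integral_inner (𝕜 := ℝ) ((memLp_id_gauss (n := n) hs).integrable (by norm_num))
      (g (y - s • G y))
    simp only [id] at h
    rw [h, integral_id_gauss hs, inner_zero_right]
  rw [joint, integral_map hT.aemeasurable]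
  · have e : ∀ p : EuclideanSpace ℝ (Fin n) × EuclideanSpace ℝ (Fin n),
        inner ℝ (disp G s p.1 (p.1 - s • G p.1 + p.2)) (g (p.1 - s • G p.1 + p.2)) =
        inner ℝ p.2 (g (p.1 - s • G p.1 + p.2) - g (p.1 - s • G p.1))
          + inner ℝ p.2 (g (p.1 - s • G p.1)) := by
      intro p
      rw [← inner_add_right, sub_add_cancel, disp, add_sub_cancel_left]
    simp only [e]
    rw [integral_add (integrable_inner_of_memLp hz hd) (integrable_inner_of_memLp hz hg0), h0, add_zero]
    have hsq : ∫ p, ‖p.2‖ ^ 2 ∂(μ.prod (gauss n s)) = 2 * s * n := by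
      rw [← integral_norm_sq_gauss hs, ← Measure.snd_prod (μ := μ) (ν := gauss n s), Measure.snd,
        integral_map measurable_snd.aemeasurable (by fun_prop)]
      simp
    rw [← hsq, ← integral_const_mul]
    refine integral_mono (integrable_inner_of_memLp hz hd)
      ((hz.integrable_norm_pow (by norm_num)).const_mul L) fun p => ?_
    have h1 := real_inner_le_norm p.2 (g (p.1 - s • G p.1 + p.2) - g (p.1 - s • G p.1))
    have h2 := hL (p.1 - s • G p.1 + p.2) (p.1 - s • G p.1)
    rw [add_sub_cancel_left] at h2
    have h3 := mul_le_mul_of_nonneg_left h2 (norm_nonneg p.2)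
    simp only
    nlinarith
  · exact ((measurable_disp_prod hG s).inner
      (hgc.measurable.comp measurable_snd)).aestronglyMeasurable

end Joint

/-! ### Entropy dissipation along a step and the error caused by the frozen drift. -/

section Dissipation

variable {n : ℕ} {μ : Measure (EuclideanSpace ℝ (Fin n))} [IsProbabilityMeasure μ]
  {G gV : EuclideanSpace ℝ (Fin n) → EuclideanSpace ℝ (Fin n)} {s : ℝ}

/-- The score of `mix` relative to a density with score `-gV`. -/
noncomputable def relScore (μ : Measure (EuclideanSpace ℝ (Fin n)))
    (G gV : EuclideanSpace ℝ (Fin n) → EuclideanSpace ℝ (Fin n)) (s : ℝ)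
    (x : EuclideanSpace ℝ (Fin n)) : EuclideanSpace ℝ (Fin n) :=
  mixScore μ G s x + gV x

theorem measurable_relScore_right (hG : Measurable G) (hgV : Measurable gV) (s : ℝ) :
    Measurable (relScore μ G gV s) :=
  (measurable_mixScore_right hG s).add hgV

theorem integrable_kernDot_prod (hG : Measurable G) (hG2 : MemLp G 2 μ) (hs : 0 < s) :
    Integrable (fun p : EuclideanSpace ℝ (Fin n) × EuclideanSpace ℝ (Fin n) =>
      kernDot G s p.1 p.2) (μ.prod volume) := by
  have := isProbabilityMeasure_joint (μ := μ) hG hs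
  have hd := memLp_disp_joint (μ := μ) hG hs
  refine (integrable_joint_iff hG hs).1 ?_
  exact (((hd.integrable_norm_pow (by norm_num)).div_const _).sub (integrable_const _)).sub
    ((integrable_inner_of_memLp hd (memLp_fst_joint hG hs hG2)).div_const _)

/-- The derivative of a relative entropy functional along an Euler step. -/
theorem integral_mul_mixDot_le (hG : Measurable G) (hG2 : MemLp G 2 μ) (hs : 0 < s)
    (hgVm : Measurable gV) (hgV : MemLp (fun p => gV p.2) 2 (joint μ G s))
    {f w : EuclideanSpace ℝ (Fin n) → ℝ} {c : ℝ}
    (hf : ∀ x, HasGradientAt f (w x • relScore μ G gV s x) x) (hc : ∀ x, |f x| ≤ c)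
    (hwm : Measurable w) (hw0 : ∀ x, 0 ≤ w x) (hw1 : ∀ x, w x ≤ 1) :
    ∫ x, f x * mixDot μ G s x ≤
      -(3 / 4) * ∫ p, w p.2 * ‖relScore μ G gV s p.2‖ ^ 2 ∂joint μ G s
        + ∫ p, ‖gV p.2 - G p.1‖ ^ 2 ∂joint μ G s := by
  have hP := isProbabilityMeasure_joint (μ := μ) hG hs
  have hd := memLp_disp_joint (μ := μ) hG hs
  have hG1 := memLp_fst_joint hG hs hG2
  have hu := memLp_mixScore (μ := μ) hG hs
  have hH : MemLp (fun p => relScore μ G gV s p.2) 2 (joint μ G s) := hu.add hgV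
  have hHm := measurable_relScore_right (μ := μ) hG hgVm s
  have hwHm : Measurable fun x => w x • relScore μ G gV s x := hwm.smul hHm
  have hfc : Continuous f := continuous_iff_continuousAt.2 fun x => (hf x).continuousAt
  have hwle : ∀ x, ‖w x • relScore μ G gV s x‖ ≤ ‖relScore μ G gV s x‖ := fun x => by
    rw [norm_smul, Real.norm_of_nonneg (hw0 x)]
    exact mul_le_of_le_one_left (norm_nonneg _) (hw1 x)
  have hwH : MemLp (fun p => w p.2 • relScore μ G gV s p.2) 2 (joint μ G s) :=
    hH.mono (hwHm.comp measurable_snd).aestronglyMeasurable (ae_of_all _ fun p => hwle p.2)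
  have hF : MemLp (fun p => G p.1 - (2 * s)⁻¹ • disp G s p.1 p.2) 2 (joint μ G s) :=
    hG1.sub (hd.const_smul (2 * s)⁻¹)
  -- exchange the order of integration
  have hkd := integrable_kernDot_prod hG hG2 hs
  have hfk : Integrable (fun p : EuclideanSpace ℝ (Fin n) × EuclideanSpace ℝ (Fin n) =>
      f p.2 * kernDot G s p.1 p.2) (μ.prod volume) :=
    hkd.bdd_mul (c := c) (hfc.comp continuous_snd).aestronglyMeasurable
      (ae_of_all _ fun p => hc p.2)
  have h1 : ∫ x, f x * mixDot μ G s x = ∫ y, ∫ x, f x * kernDot G s y x ∂volume ∂μ := by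
    rw [← integral_prod _ hfk, integral_prod_symm _ hfk]
    refine integral_congr_ae (ae_of_all _ fun x => ?_)
    simp only
    rw [integral_const_mul, mixDot]
  have hno : Integrable (fun p => ‖w p.2 • relScore μ G gV s p.2‖ *
      ‖G p.1 - (2 * s)⁻¹ • disp G s p.1 p.2‖) (joint μ G s) := hwH.norm.integrable_mul hF.norm
  -- Fubini gives integrability of the flux only for almost every start `y`, which is enough for the
  -- integration by parts below.
  have hae := ((integrable_joint_iff hG hs).1 hno).prod_right_ae
  have h2 : ∫ y, ∫ x, f x * kernDot G s y x ∂volume ∂μ =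
      ∫ y, -∫ x, kern G s y x * inner ℝ (w x • relScore μ G gV s x)
        (G y - (2 * s)⁻¹ • disp G s y x) ∂volume ∂μ := by
    refine integral_congr_ae ?_
    filter_upwards [hae] with y hy
    exact integral_mul_heat_deriv_eq hs (y - s • G y) (G y) hf hc hy hwHm
  have h3 : Integrable (fun p => inner ℝ (w p.2 • relScore μ G gV s p.2)
      (G p.1 - (2 * s)⁻¹ • disp G s p.1 p.2)) (joint μ G s) := integrable_inner_of_memLp hwH hF
  rw [h1, h2, integral_neg, ← integral_joint hG hs h3]
  -- Tested against functions of the endpoint, `-(2s)⁻¹ • disp` may be replaced by its conditional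
  -- expectation, the score of the mixture.
  have h4 : ∫ p, inner ℝ (w p.2 • relScore μ G gV s p.2)
      (G p.1 - (2 * s)⁻¹ • disp G s p.1 p.2) ∂joint μ G s =
      ∫ p, inner ℝ (w p.2 • relScore μ G gV s p.2) (G p.1 + mixScore μ G s p.2)
        ∂joint μ G s := by
    have h5 := integral_inner_mixScore hG hs (g := fun x => w x • relScore μ G gV s x) hwH
    simp only [inner_sub_right, inner_add_right, inner_smul_right _ (disp G s _ _)]
    rw [integral_sub (integrable_inner_of_memLp hwH hG1)
      ((integrable_inner_of_memLp hwH hd).const_mul _),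
      integral_add (integrable_inner_of_memLp hwH hG1) (integrable_inner_of_memLp hwH hu),
      integral_const_mul, sub_eq_add_neg]
    congr 1
    have c1 : ∀ p : EuclideanSpace ℝ (Fin n) × EuclideanSpace ℝ (Fin n),
        inner ℝ (mixScore μ G s p.2) (w p.2 • relScore μ G gV s p.2) =
          inner ℝ (w p.2 • relScore μ G gV s p.2) (mixScore μ G s p.2) :=
      fun p => real_inner_comm _ _
    have c2 : ∀ p : EuclideanSpace ℝ (Fin n) × EuclideanSpace ℝ (Fin n),
        inner ℝ (disp G s p.1 p.2) (w p.2 • relScore μ G gV s p.2) =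
          inner ℝ (w p.2 • relScore μ G gV s p.2) (disp G s p.1 p.2) :=
      fun p => real_inner_comm _ _
    simp only [c1, c2] at h5
    rw [h5, neg_mul]
  rw [h4, ← integral_neg, ← integral_const_mul]
  have hi1 : Integrable (fun p => w p.2 * ‖relScore μ G gV s p.2‖ ^ 2) (joint μ G s) := by
    refine (hH.integrable_norm_pow (by norm_num)).mono'
      ((hwm.comp measurable_snd).mul ((hHm.comp measurable_snd).norm.pow_const 2)
        ).aestronglyMeasurable (ae_of_all _ fun p => ?_)
    rw [Real.norm_of_nonneg (mul_nonneg (hw0 _) (by positivity))]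
    exact mul_le_of_le_one_left (by positivity) (hw1 _)
  have hi2 : Integrable (fun p => ‖gV p.2 - G p.1‖ ^ 2) (joint μ G s) :=
    (hgV.sub hG1).integrable_norm_pow (by norm_num)
  rw [← integral_add (hi1.const_mul _) hi2]
  refine integral_mono (integrable_inner_of_memLp hwH (hG1.add hu)).neg
    ((hi1.const_mul _).add hi2) fun p => ?_
  simp only
  set H := relScore μ G gV s p.2 with hHdef
  have e : G p.1 + mixScore μ G s p.2 = H - (gV p.2 - G p.1) := by
    rw [hHdef, relScore]; abel
  rw [e]
  set a := gV p.2 - G p.1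
  rw [inner_smul_left, inner_sub_right, real_inner_self_eq_norm_sq, conj_trivial]
  -- Young's inequality with this weight spends a quarter of the Fisher information, which leaves
  -- the factor `3/4`.
  have hy : inner ℝ H a ≤ ‖H‖ ^ 2 / 4 + ‖a‖ ^ 2 := by
    have := real_inner_le_norm H a
    nlinarith [sq_nonneg (‖H‖ / 2 - ‖a‖)]
  have hw := hw0 p.2
  have hw' := hw1 p.2
  nlinarith [mul_le_mul_of_nonneg_left hy hw, sq_nonneg ‖a‖,
    mul_nonneg (sub_nonneg.2 hw') (sq_nonneg ‖a‖)]

variable {L e : ℝ}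

/-- Split at `gV y`: the increment of `gV` is controlled by `x - y = disp - s • G y`, the rest is
the bias of the drift. -/
theorem norm_drift_sub_le (hs : 0 < s) (hL0 : 0 ≤ L)
    (hL : ∀ x y, ‖gV x - gV y‖ ≤ L * ‖x - y‖) (he : ∀ y, ‖G y - gV y‖ ≤ e)
    (y x : EuclideanSpace ℝ (Fin n)) :
    ‖gV x - G y‖ ≤ L * ‖disp G s y x‖ + L * s * ‖G y‖ + e := by
  have h1 : ‖x - y‖ ≤ ‖disp G s y x‖ + s * ‖G y‖ := by
    have : x - y = disp G s y x - s • G y := by simp only [disp]; abel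
    rw [this]
    refine (norm_sub_le _ _).trans (le_of_eq ?_)
    rw [norm_smul, Real.norm_of_nonneg hs.le]
  have h2 : ‖gV x - G y‖ ≤ ‖gV x - gV y‖ + ‖G y - gV y‖ := by
    have := norm_sub_le (gV x - gV y) (G y - gV y)
    rwa [sub_sub_sub_cancel_right] at this
  have h3 := mul_le_mul_of_nonneg_left h1 hL0
  have := hL x y
  have := he y
  linarith

/-- Propagates the finite second moment of `gV` from the start of a step to its end. -/
theorem memLp_gV_joint (hG : Measurable G) (hG2 : MemLp G 2 μ) (hs : 0 < s) (hL0 : 0 ≤ L)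
    (hgVm : Measurable gV)
    (hL : ∀ x y, ‖gV x - gV y‖ ≤ L * ‖x - y‖) (he : ∀ y, ‖G y - gV y‖ ≤ e) :
    MemLp (fun p => gV p.2) 2 (joint μ G s) := by
  have hP := isProbabilityMeasure_joint (μ := μ) hG hs
  have hd := (memLp_disp_joint (μ := μ) hG hs).norm
  have hG1 := (memLp_fst_joint hG hs hG2).norm
  refine (((hd.const_mul L).add (hG1.const_mul (L * s + 1))).add (memLp_const e)).mono'
    (hgVm.comp measurable_snd).aestronglyMeasurable (ae_of_all _ fun p => ?_)
  have h1 := norm_drift_sub_le hs hL0 hL he p.1 p.2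
  have h2 : ‖gV p.2‖ ≤ ‖gV p.2 - G p.1‖ + ‖G p.1‖ := by
    simpa using norm_add_le (gV p.2 - G p.1) (G p.1)
  simp only [Pi.add_apply]
  linarith

/-- A crude bound, uniform in `s ≤ γ` and free of the Fisher information. It serves only to know
that the accumulated drift error is finite. -/
theorem integral_norm_sq_drift_sub_le_of_le (hG : Measurable G) (hG2 : MemLp G 2 μ) (hs : 0 < s)
    (hL0 : 0 ≤ L) (hgVm : Measurable gV) (hL : ∀ x y, ‖gV x - gV y‖ ≤ L * ‖x - y‖)
    (he : ∀ y, ‖G y - gV y‖ ≤ e) {γ : ℝ} (hsγ : s ≤ γ) :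
    ∫ p, ‖gV p.2 - G p.1‖ ^ 2 ∂joint μ G s ≤
      3 * (L ^ 2 * (2 * γ * n) + (L * γ) ^ 2 * ∫ y, ‖G y‖ ^ 2 ∂μ + e ^ 2) := by
  have hP := isProbabilityMeasure_joint (μ := μ) hG hs
  have hd := (memLp_disp_joint (μ := μ) hG hs).integrable_norm_pow (by norm_num)
  have hG1 := (memLp_fst_joint hG hs hG2).integrable_norm_pow (by norm_num)
  have hgV := memLp_gV_joint hG hG2 hs hL0 hgVm hL he
  have hfst : ∫ p, ‖G p.1‖ ^ 2 ∂joint μ G s = ∫ y, ‖G y‖ ^ 2 ∂μ := by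
    conv_rhs => rw [← map_fst_joint (μ := μ) hG hs]
    rw [integral_map measurable_fst.aemeasurable
      (hG.norm.pow_const 2).aestronglyMeasurable]
  have hint : ∫ p, 3 * (L ^ 2 * ‖disp G s p.1 p.2‖ ^ 2 + (L * s) ^ 2 * ‖G p.1‖ ^ 2 + e ^ 2)
      ∂joint μ G s = 3 * (L ^ 2 * (2 * s * n) + (L * s) ^ 2 * ∫ y, ‖G y‖ ^ 2 ∂μ + e ^ 2) := by
    rw [integral_const_mul, integral_add ((hd.const_mul _).fun_add (hG1.const_mul _))
      (integrable_const _), integral_add (hd.const_mul _) (hG1.const_mul _),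
      integral_const_mul, integral_const_mul, integral_norm_sq_disp hG hs, hfst]
    simp
  calc _ ≤ 3 * (L ^ 2 * (2 * s * n) + (L * s) ^ 2 * ∫ y, ‖G y‖ ^ 2 ∂μ + e ^ 2) := by
        rw [← hint]
        refine integral_mono ((hgV.sub (memLp_fst_joint hG hs hG2)).integrable_norm_pow
          (by norm_num)) ((((hd.const_mul _).add (hG1.const_mul _)).add
          (integrable_const _)).const_mul 3) fun p => ?_
        have h1 := norm_drift_sub_le hs hL0 hL he p.1 p.2
        have h2 := pow_le_pow_left₀ (norm_nonneg _) h1 2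
        simp only
        refine h2.trans ?_
        nlinarith [sq_nonneg (L * ‖disp G s p.1 p.2‖ - L * s * ‖G p.1‖),
          sq_nonneg (L * ‖disp G s p.1 p.2‖ - e), sq_nonneg (L * s * ‖G p.1‖ - e)]
    _ ≤ _ := by
        have hI : 0 ≤ ∫ y, ‖G y‖ ^ 2 ∂μ := integral_nonneg fun y => by positivity
        gcongr

/-- Expand `‖mixScore + gV‖²` and drop `‖mixScore‖²`. The cross term is formally `-2 E div gV ≥
-2nL`; the conditional expectation formula and the Gaussian inequality for Lipschitz fields make
this rigorous without a divergence. -/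
theorem integral_norm_sq_gV_le (hG : Measurable G) (hs : 0 < s)
    (hgVc : Continuous gV) (hL : ∀ x y, ‖gV x - gV y‖ ≤ L * ‖x - y‖)
    (hgV : MemLp (fun p => gV p.2) 2 (joint μ G s)) :
    ∫ p, ‖gV p.2‖ ^ 2 ∂joint μ G s ≤
      ∫ p, ‖relScore μ G gV s p.2‖ ^ 2 ∂joint μ G s + 2 * n * L := by
  have hu := memLp_mixScore (μ := μ) hG hs
  have hH : MemLp (fun p => relScore μ G gV s p.2) 2 (joint μ G s) := hu.add hgV
  have hug := integrable_inner_of_memLp hu hgV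
  have hg2 := hgV.integrable_norm_pow (p := 2) (by norm_num)
  have h1 := integral_inner_mixScore hG hs hgV
  have h2 := integral_inner_disp_le hG hs hgVc hL hgV
  have h3 : ∫ p, ‖gV p.2‖ ^ 2 ∂joint μ G s +
      2 * ∫ p, inner ℝ (mixScore μ G s p.2) (gV p.2) ∂joint μ G s ≤
      ∫ p, ‖relScore μ G gV s p.2‖ ^ 2 ∂joint μ G s := by
    rw [← integral_const_mul, ← integral_add hg2 (hug.const_mul 2)]
    refine integral_mono (hg2.add (hug.const_mul 2)) (hH.integrable_norm_pow (by norm_num))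
      fun p => ?_
    simp only [relScore]
    rw [norm_add_sq_real]
    nlinarith [sq_nonneg ‖mixScore μ G s p.2‖]
  have h4 : (2 * s)⁻¹ * ∫ p, inner ℝ (disp G s p.1 p.2) (gV p.2) ∂joint μ G s ≤ n * L := by
    calc _ ≤ (2 * s)⁻¹ * (L * (2 * s * n)) := mul_le_mul_of_nonneg_left h2 (by positivity)
      _ = n * L := by field_simp
  rw [h1] at h3
  linarith

theorem integral_norm_sq_drift_sub_le (hG : Measurable G) (hG2 : MemLp G 2 μ) (hs : 0 < s)
    (hL0 : 0 ≤ L) (hgVc : Continuous gV) (hL : ∀ x y, ‖gV x - gV y‖ ≤ L * ‖x - y‖)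
    (he : ∀ y, ‖G y - gV y‖ ≤ e) (hsL : s * L ≤ 1 / √32) :
    ∫ p, ‖gV p.2 - G p.1‖ ^ 2 ∂joint μ G s ≤
      1 / 4 * ∫ p, ‖relScore μ G gV s p.2‖ ^ 2 ∂joint μ G s + 12 * n * L ^ 2 * s + 6 * e ^ 2 := by
  have hP := isProbabilityMeasure_joint (μ := μ) hG hs
  have hd := (memLp_disp_joint (μ := μ) hG hs).integrable_norm_pow (p := 2) (by norm_num)
  have hgV := memLp_gV_joint hG hG2 hs hL0 hgVc.measurable hL he
  have hg2 := hgV.integrable_norm_pow (p := 2) (by norm_num)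
  have hfi := integral_norm_sq_gV_le hG hs hgVc hL hgV
  set κ := s * L with hκ
  have hκ0 : 0 ≤ κ := by positivity
  have hκ2 : κ ^ 2 ≤ 1 / 32 := by
    have := pow_le_pow_left₀ hκ0 hsL 2
    rwa [div_pow, one_pow, Real.sq_sqrt (by norm_num)] at this
  -- Since `0.18² = 0.0324 > 1/32`.
  have hκ1 : κ ≤ 0.18 := by nlinarith
  set FI := ∫ p, ‖relScore μ G gV s p.2‖ ^ 2 ∂joint μ G s with hFI
  have hFI0 : 0 ≤ FI := integral_nonneg fun p => by positivity
  have hint : ∫ p, 9 / 2 * (L ^ 2 * ‖disp G s p.1 p.2‖ ^ 2 + κ ^ 2 * ‖gV p.2‖ ^ 2 + e ^ 2)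
      ∂joint μ G s = 9 / 2 * (L ^ 2 * (2 * s * n) +
        κ ^ 2 * ∫ p, ‖gV p.2‖ ^ 2 ∂joint μ G s + e ^ 2) := by
    rw [integral_const_mul, integral_add ((hd.const_mul _).fun_add (hg2.const_mul _))
      (integrable_const _), integral_add (hd.const_mul _) (hg2.const_mul _),
      integral_const_mul, integral_const_mul, integral_norm_sq_disp hG hs]
    simp
  -- Bounding `‖G y‖` by `‖gV x‖ + ‖gV x - G y‖` turns the drift estimate into `(1 - κ) d ≤ L v + κ
  -- g + e`. As `1 - κ ≥ 0.82` and `3 / 0.82² < 9/2`, squaring gives the constant `9/2`.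
  have hle : ∫ p, ‖gV p.2 - G p.1‖ ^ 2 ∂joint μ G s ≤ 9 / 2 * (L ^ 2 * (2 * s * n) +
        κ ^ 2 * ∫ p, ‖gV p.2‖ ^ 2 ∂joint μ G s + e ^ 2) := by
    rw [← hint]
    refine integral_mono ((hgV.sub (memLp_fst_joint hG hs hG2)).integrable_norm_pow
      (by norm_num)) ((((hd.const_mul _).add (hg2.const_mul _)).add
      (integrable_const _)).const_mul _) fun p => ?_
    have h1 := norm_drift_sub_le hs hL0 hL he p.1 p.2
    have h2 : ‖G p.1‖ ≤ ‖gV p.2‖ + ‖gV p.2 - G p.1‖ := by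
      have := norm_sub_le (gV p.2) (gV p.2 - G p.1)
      rwa [sub_sub_cancel] at this
    simp only
    set d := ‖gV p.2 - G p.1‖
    set v := ‖disp G s p.1 p.2‖
    set g := ‖gV p.2‖
    have hd0 : 0 ≤ d := norm_nonneg _
    have h3 : (1 - κ) * d ≤ L * v + κ * g + e := by
      have := mul_le_mul_of_nonneg_left h2 hκ0
      have e1 : L * s * ‖G p.1‖ = κ * ‖G p.1‖ := by rw [hκ]; ring
      nlinarith
    have h4 : 0.82 * d ≤ L * v + κ * g + e :=
      (mul_le_mul_of_nonneg_right (by linarith) hd0).trans h3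
    have h5 := pow_le_pow_left₀ (by positivity) h4 2
    nlinarith [sq_nonneg (L * v - κ * g), sq_nonneg (L * v - e), sq_nonneg (κ * g - e),
      sq_nonneg d]
  have h6 : κ ^ 2 * ∫ p, ‖gV p.2‖ ^ 2 ∂joint μ G s ≤ κ ^ 2 * (FI + 2 * n * L) :=
    mul_le_mul_of_nonneg_left hfi (by positivity)
  -- With this the noise terms add up to `(9/2) * 2.36 < 12`, while `(9/2) / 32 < 1/4` and `9/2 < 6`
  -- settle the other two.
  have h7 : κ ^ 2 * (2 * n * L) ≤ 0.36 * (n * L ^ 2 * s) := by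
    have e1 : κ ^ 2 * (2 * n * L) = κ * (2 * (n * L ^ 2 * s)) := by rw [hκ]; ring
    rw [e1]
    have : 0 ≤ n * L ^ 2 * s := by positivity
    nlinarith
  have h8 : κ ^ 2 * FI ≤ 1 / 32 * FI := mul_le_mul_of_nonneg_right hκ2 hFI0
  have h9 : 0 ≤ n * L ^ 2 * s := by positivity
  nlinarith [sq_nonneg e]

end Dissipation

/-! ### A bounded logarithm and the entropy it generates. -/

section Truncation

/-- A smooth bounded truncation of the identity. -/
noncomputable def trunc (M u : ℝ) : ℝ := M * Real.arctan (u / M)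

/-- The derivative of `trunc`. -/
noncomputable def truncDeriv (M u : ℝ) : ℝ := (1 + (u / M) ^ 2)⁻¹

/-- The entropy function whose derivative is the truncated logarithm. -/
noncomputable def truncEntropy (M h : ℝ) : ℝ := ∫ r in (1 : ℝ)..h, trunc M (Real.log r)

variable {M : ℝ}

theorem hasDerivAt_trunc (hM : 0 < M) (u : ℝ) : HasDerivAt (trunc M) (truncDeriv M u) u := by
  have h := (((hasDerivAt_id u).div_const M).arctan).const_mul M
  refine h.congr_deriv ?_
  simp only [truncDeriv, id]
  field_simp

theorem truncDeriv_nonneg (M u : ℝ) : 0 ≤ truncDeriv M u := by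
  unfold truncDeriv; positivity

theorem truncDeriv_le_one (M u : ℝ) : truncDeriv M u ≤ 1 :=
  inv_le_one_of_one_le₀ (by nlinarith [sq_nonneg (u / M)])

theorem abs_trunc_le (hM : 0 < M) (u : ℝ) : |trunc M u| ≤ M * (Real.pi / 2) := by
  rw [trunc, abs_mul, abs_of_pos hM]
  exact mul_le_mul_of_nonneg_left (abs_le.2 ⟨(Real.neg_pi_div_two_lt_arctan _).le,
    (Real.arctan_lt_pi_div_two _).le⟩) hM.le

theorem trunc_zero (M : ℝ) : trunc M 0 = 0 := by simp [trunc]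

theorem trunc_mono (hM : 0 < M) : Monotone (trunc M) := fun _ _ h =>
  mul_le_mul_of_nonneg_left (Real.arctan_strictMono.monotone
    (div_le_div_of_nonneg_right h hM.le)) hM.le

theorem monotone_sub_trunc (hM : 0 < M) : Monotone fun u => u - trunc M u :=
  monotone_of_hasDerivAt_nonneg (fun u => (hasDerivAt_id u).sub (hasDerivAt_trunc hM u))
    fun u => sub_nonneg.2 (truncDeriv_le_one M u)

theorem trunc_le_self (hM : 0 < M) {u : ℝ} (hu : 0 ≤ u) : trunc M u ≤ u := by
  have := monotone_sub_trunc hM hu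
  simp only [trunc_zero] at this
  linarith

theorem self_le_trunc (hM : 0 < M) {u : ℝ} (hu : u ≤ 0) : u ≤ trunc M u := by
  have := monotone_sub_trunc hM hu
  simp only [trunc_zero] at this
  linarith

theorem measurable_trunc (M : ℝ) : Measurable (trunc M) := by
  unfold trunc
  exact (Real.measurable_arctan.comp (measurable_id.div_const M)).const_mul M

theorem intervalIntegrable_trunc_log (hM : 0 < M) (a b : ℝ) :
    IntervalIntegrable (fun r => trunc M (Real.log r)) volume a b := by
  rw [intervalIntegrable_iff]
  have : IsFiniteMeasure (volume.restrict (uIoc a b)) :=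
    isFiniteMeasure_restrict.2 measure_Ioc_lt_top.ne
  refine Integrable.of_bound ((measurable_trunc M).comp
    Real.measurable_log).aestronglyMeasurable (M * (Real.pi / 2)) (ae_of_all _ fun r => ?_)
  exact abs_trunc_le hM _

theorem hasDerivAt_truncEntropy (hM : 0 < M) {h : ℝ} (hh : 0 < h) :
    HasDerivAt (truncEntropy M) (trunc M (Real.log h)) h := by
  refine intervalIntegral.integral_hasDerivAt_right (intervalIntegrable_trunc_log hM _ _)
    ⟨univ, univ_mem, ((measurable_trunc M).comp Real.measurable_log).aestronglyMeasurable⟩ ?_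
  exact (hasDerivAt_trunc hM _).continuousAt.comp (Real.continuousAt_log hh.ne')

theorem truncEntropy_one (M : ℝ) : truncEntropy M 1 = 0 := by simp [truncEntropy]

/-- The derivative is bounded, even near `0` and at infinity. This makes the truncated entropy
continuous in `L¹`, which the true entropy is not. -/
theorem abs_truncEntropy_sub_le (hM : 0 < M) (a b : ℝ) :
    |truncEntropy M a - truncEntropy M b| ≤ M * (Real.pi / 2) * |a - b| := by
  rw [truncEntropy, truncEntropy, intervalIntegral.integral_interval_sub_left
    (intervalIntegrable_trunc_log hM _ _) (intervalIntegrable_trunc_log hM _ _)]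
  exact intervalIntegral.norm_integral_le_of_norm_le_const
    (f := fun r => trunc M (Real.log r)) fun r _ => abs_trunc_le hM _

theorem continuous_truncEntropy (hM : 0 < M) : Continuous (truncEntropy M) := by
  have : LipschitzWith (Real.toNNReal (M * (Real.pi / 2))) (truncEntropy M) :=
    LipschitzWith.of_dist_le' fun a b => abs_truncEntropy_sub_le hM a b
  exact this.continuous

theorem truncEntropy_nonneg (hM : 0 < M) {h : ℝ} (hh : 0 ≤ h) : 0 ≤ truncEntropy M h := by
  rcases le_total 1 h with h1 | h1
  · refine intervalIntegral.integral_nonneg h1 fun r hr => ?_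
    have := trunc_mono hM (Real.log_nonneg hr.1)
    rwa [trunc_zero] at this
  · rw [truncEntropy, intervalIntegral.integral_symm, ← intervalIntegral.integral_neg]
    refine intervalIntegral.integral_nonneg h1 fun r hr => ?_
    have := trunc_mono hM (Real.log_nonpos (hh.trans hr.1) hr.2)
    rw [trunc_zero] at this
    linarith

/-- `klFun` is the same integral with the full logarithm, and truncation moves the logarithm towards
`0` on either side of `1`. -/
theorem truncEntropy_le_klFun (hM : 0 < M) {h : ℝ} (hh : 0 ≤ h) : truncEntropy M h ≤ klFun h := by
  have hk : klFun h = ∫ r in (1 : ℝ)..h, Real.log r := by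
    rw [integral_log, klFun_apply]
    simp
    ring
  rw [hk]
  rcases le_total 1 h with h1 | h1
  · refine intervalIntegral.integral_mono_on h1 (intervalIntegrable_trunc_log hM _ _)
      intervalIntegral.intervalIntegrable_log' fun r hr => ?_
    exact trunc_le_self hM (Real.log_nonneg hr.1)
  · rw [truncEntropy, intervalIntegral.integral_symm, intervalIntegral.integral_symm h 1,
      neg_le_neg_iff]
    refine intervalIntegral.integral_mono_on h1 intervalIntegral.intervalIntegrable_log'
      (intervalIntegrable_trunc_log hM _ _) fun r hr => ?_
    exact self_le_trunc hM (Real.log_nonpos (hh.trans hr.1) hr.2)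

end Truncation

/-! ### Differentiating the truncated relative entropy in time. -/

section EntropyDecay

variable {n : ℕ} {μ : Measure (EuclideanSpace ℝ (Fin n))} [IsProbabilityMeasure μ]
  {G gV : EuclideanSpace ℝ (Fin n) → EuclideanSpace ℝ (Fin n)} {s M : ℝ}
  {π : EuclideanSpace ℝ (Fin n) → ℝ}

/-- The truncated logarithm of the relative density after an Euler step. -/
noncomputable def truncLog (μ : Measure (EuclideanSpace ℝ (Fin n)))
    (G : EuclideanSpace ℝ (Fin n) → EuclideanSpace ℝ (Fin n))
    (π : EuclideanSpace ℝ (Fin n) → ℝ) (M s : ℝ) (x : EuclideanSpace ℝ (Fin n)) : ℝ :=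
  trunc M (Real.log (mix μ G s x / π x))

/-- The weight in the gradient of `truncLog`. -/
noncomputable def truncWeight (μ : Measure (EuclideanSpace ℝ (Fin n)))
    (G : EuclideanSpace ℝ (Fin n) → EuclideanSpace ℝ (Fin n))
    (π : EuclideanSpace ℝ (Fin n) → ℝ) (M s : ℝ) (x : EuclideanSpace ℝ (Fin n)) : ℝ :=
  truncDeriv M (Real.log (mix μ G s x / π x))

theorem measurable_log_mix_div (hG : Measurable G) (hπ : Measurable π) :
    Measurable fun p : ℝ × EuclideanSpace ℝ (Fin n) => Real.log (mix μ G p.1 p.2 / π p.2) :=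
  Real.measurable_log.comp ((measurable_mix hG).div (hπ.comp measurable_snd))

theorem measurable_truncLog (hG : Measurable G) (hπ : Measurable π) (M : ℝ) :
    Measurable fun p : ℝ × EuclideanSpace ℝ (Fin n) => truncLog μ G π M p.1 p.2 :=
  (measurable_trunc M).comp (measurable_log_mix_div hG hπ)

theorem measurable_truncWeight (hG : Measurable G) (hπ : Measurable π) (M : ℝ) :
    Measurable fun p : ℝ × EuclideanSpace ℝ (Fin n) => truncWeight μ G π M p.1 p.2 := by
  have h := measurable_log_mix_div (μ := μ) hG hπ
  unfold truncWeight truncDeriv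
  fun_prop

theorem hasGradientAt_log_mix_div (hG : Measurable G) (hs : 0 < s) (hπ0 : ∀ x, 0 < π x)
    (hπ : ∀ x, HasGradientAt (fun y => Real.log (π y)) (-gV x) x)
    (x : EuclideanSpace ℝ (Fin n)) :
    HasGradientAt (fun y => Real.log (mix μ G s y / π y)) (relScore μ G gV s x) x := by
  have h1 := (hasGradientAt_mix (μ := μ) hG hs x).hasFDerivAt.log (mix_pos hG hs x).ne'
  have h2 := h1.sub (hπ x).hasFDerivAt
  rw [hasGradientAt_iff_hasFDerivAt]
  refine (h2.congr_of_eventuallyEq (Eventually.of_forall fun y => ?_)).congr_fderiv ?_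
  · exact Real.log_div (mix_pos hG hs y).ne' (hπ0 y).ne'
  · simp [relScore, mixScore]

theorem hasGradientAt_truncLog (hG : Measurable G) (hs : 0 < s) (hπ0 : ∀ x, 0 < π x)
    (hπ : ∀ x, HasGradientAt (fun y => Real.log (π y)) (-gV x) x) (hM : 0 < M)
    (x : EuclideanSpace ℝ (Fin n)) :
    HasGradientAt (truncLog μ G π M s) (truncWeight μ G π M s x • relScore μ G gV s x) x := by
  have h1 := (hasGradientAt_log_mix_div (μ := μ) hG hs hπ0 hπ x).hasFDerivAt
  have h2 := (hasDerivAt_trunc hM (Real.log (mix μ G s x / π x))).comp_hasFDerivAt x h1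
  rw [hasGradientAt_iff_hasFDerivAt]
  refine h2.congr_fderiv ?_
  simp [truncWeight]

theorem hasDerivAt_entropyDensity (hG : Measurable G) (hGi : Integrable G μ) (hs : 0 < s)
    (hπ0 : ∀ x, 0 < π x) (hM : 0 < M) (x : EuclideanSpace ℝ (Fin n)) :
    HasDerivAt (fun r => π x * truncEntropy M (mix μ G r x / π x))
      (truncLog μ G π M s x * mixDot μ G s x) s := by
  have h1 := (integrable_kernDot_and_hasDerivAt_mix hG hGi hs x).2.div_const (π x)
  have h2 := (hasDerivAt_truncEntropy hM (div_pos (mix_pos (μ := μ) hG hs x) (hπ0 x))).comp s h1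
  refine (h2.const_mul (π x)).congr_deriv ?_
  simp only [truncLog]
  field_simp [(hπ0 x).ne']

theorem integrable_mix (hG : Measurable G) (hs : 0 < s) : Integrable (mix μ G s) := by
  have h : Integrable (fun _ => (1 : ℝ)) (joint μ G s) := by
    have := isProbabilityMeasure_joint (μ := μ) hG hs
    exact integrable_const _
  have h2 := ((integrable_joint_iff hG hs).1 h).integral_prod_right
  simp only [mul_one] at h2
  exact h2

/-- The entropy function is Lipschitz and vanishes at `1`, so its perspective is bounded by a
multiple of `|q - π|`. -/
theorem integrable_entropyDensity (hπm : Measurable π) (hπi : Integrable π) (hπ0 : ∀ x, 0 < π x)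
    (hM : 0 < M) {q : EuclideanSpace ℝ (Fin n) → ℝ} (hqm : Measurable q) (hq : Integrable q) :
    Integrable fun x => π x * truncEntropy M (q x / π x) := by
  refine ((hq.sub hπi).abs.const_mul (M * (Real.pi / 2))).mono'
    (hπm.mul ((continuous_truncEntropy hM).measurable.comp (hqm.div hπm))).aestronglyMeasurable
    (ae_of_all _ fun x => ?_)
  have h := abs_truncEntropy_sub_le hM (q x / π x) 1
  rw [truncEntropy_one, sub_zero] at h
  rw [Real.norm_eq_abs, abs_mul, abs_of_pos (hπ0 x)]
  have e : |q x - π x| = π x * |q x / π x - 1| := by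
    rw [← abs_of_pos (hπ0 x), ← abs_mul, abs_of_pos (hπ0 x)]
    congr 1
    field_simp [(hπ0 x).ne']
  simp only [Pi.sub_apply]
  rw [e]
  calc _ ≤ π x * (M * (Real.pi / 2) * |q x / π x - 1|) :=
        mul_le_mul_of_nonneg_left h (hπ0 x).le
    _ = _ := by ring

/-- The bound is locally uniform in `s > 0` but of order `1/s` at `0`. Hence the entropy balance is
set up on `[a, b]` with `a > 0`, and the limit `a → 0` is taken separately. -/
theorem integral_abs_mixDot_le (hG : Measurable G) (hG2 : MemLp G 2 μ) (hs : 0 < s) :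
    ∫ x, |mixDot μ G s x| ≤
      n / s + (2 * s)⁻¹ * (2 * s * n + ∫ y, ‖G y‖ ^ 2 ∂μ) := by
  have hP := isProbabilityMeasure_joint (μ := μ) hG hs
  have hk := integrable_kernDot_prod hG hG2 hs
  have hd := (memLp_disp_joint (μ := μ) hG hs).integrable_norm_pow (p := 2) (by norm_num)
  have hG1 := (memLp_fst_joint hG hs hG2).integrable_norm_pow (p := 2) (by norm_num)
  have hfst : ∫ p, ‖G p.1‖ ^ 2 ∂joint μ G s = ∫ y, ‖G y‖ ^ 2 ∂μ := by
    conv_rhs => rw [← map_fst_joint (μ := μ) hG hs]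
    rw [integral_map measurable_fst.aemeasurable
      (hG.norm.pow_const 2).aestronglyMeasurable]
  have hb : Integrable (fun p => ‖disp G s p.1 p.2‖ ^ 2 / (4 * s ^ 2) + n / (2 * s) +
      (2 * s)⁻¹ * (‖disp G s p.1 p.2‖ ^ 2 + ‖G p.1‖ ^ 2)) (joint μ G s) :=
    ((hd.div_const _).add (integrable_const _)).add ((hd.add hG1).const_mul _)
  calc ∫ x, |mixDot μ G s x| ≤ ∫ x, ∫ y, |kernDot G s y x| ∂μ := by
        refine integral_mono hk.integral_prod_right.abs hk.abs.integral_prod_right fun x => ?_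
        exact abs_integral_le_integral_abs
    _ ≤ ∫ x, ∫ y, kern G s y x * (‖disp G s y x‖ ^ 2 / (4 * s ^ 2) + n / (2 * s) +
          (2 * s)⁻¹ * (‖disp G s y x‖ ^ 2 + ‖G y‖ ^ 2)) ∂μ := by
        have hb' := (integrable_joint_iff hG hs).1 hb
        refine integral_mono_ae hk.abs.integral_prod_right hb'.integral_prod_right ?_
        filter_upwards [hk.prod_left_ae, hb'.prod_left_ae] with x hx1 hx2
        refine integral_mono hx1.abs hx2 fun y => ?_
        simp only [kernDot]
        rw [abs_mul, abs_of_pos (kern_pos G hs y x)]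
        refine mul_le_mul_of_nonneg_left ?_ (kern_pos G hs y x).le
        refine (abs_sub _ _).trans (add_le_add ((abs_sub _ _).trans ?_) ?_)
        · rw [abs_of_nonneg (by positivity), abs_of_nonneg (by positivity)]
        · rw [abs_div, abs_of_pos (by positivity : 0 < 2 * s), div_eq_inv_mul]
          refine mul_le_mul_of_nonneg_left ?_ (by positivity)
          have := abs_real_inner_le_norm (disp G s y x) (G y)
          nlinarith [sq_nonneg (‖disp G s y x‖ - ‖G y‖), sq_nonneg (‖disp G s y x‖),
            sq_nonneg (‖G y‖)]
    _ = _ := by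
        rw [← integral_joint_symm hG hs hb, integral_add ((hd.div_const _).fun_add
          (integrable_const _)) ((hd.fun_add hG1).const_mul _),
          integral_add (hd.div_const _) (integrable_const _), integral_const_mul,
          integral_add hd hG1, integral_div, integral_norm_sq_disp hG hs, hfst]
        simp
        field_simp
        ring

theorem integrable_mixDot_prod (hG : Measurable G) (hG2 : MemLp G 2 μ) {a b : ℝ} (ha : 0 < a) :
    Integrable (fun p : ℝ × EuclideanSpace ℝ (Fin n) => mixDot μ G p.1 p.2)
      ((volume.restrict (Ioc a b)).prod volume) := by
  have hm := measurable_mixDot (μ := μ) hG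
  rw [integrable_prod_iff hm.aestronglyMeasurable]
  have hpos : ∀ᵐ s ∂volume.restrict (Ioc a b), s ∈ Ioc a b :=
    ae_restrict_mem measurableSet_Ioc
  refine ⟨?_, ?_⟩
  · filter_upwards [hpos] with s hs
    exact (integrable_kernDot_prod hG hG2 (ha.trans hs.1)).integral_prod_right
  · refine Integrable.of_bound (hm.norm.stronglyMeasurable.integral_prod_right'
      ).aestronglyMeasurable (n / a + (2 * a)⁻¹ * (2 * b * n + ∫ y, ‖G y‖ ^ 2 ∂μ)) ?_
    filter_upwards [hpos] with s hs
    have hs0 : 0 < s := ha.trans hs.1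
    have hI : 0 ≤ ∫ y, ‖G y‖ ^ 2 ∂μ := integral_nonneg fun y => by positivity
    rw [Real.norm_of_nonneg (integral_nonneg fun x => norm_nonneg _)]
    refine (integral_abs_mixDot_le hG hG2 hs0).trans ?_
    have h1 := hs.1.le
    have h2 := hs.2
    gcongr

/-- The change of the truncated relative entropy along an Euler step. -/
theorem integral_entropyDensity_sub (hG : Measurable G) (hG2 : MemLp G 2 μ) (hπm : Measurable π)
    (hπi : Integrable π) (hπ0 : ∀ x, 0 < π x) (hM : 0 < M) {a b : ℝ} (ha : 0 < a) (hab : a ≤ b) :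
    IntegrableOn (fun s => ∫ x, truncLog μ G π M s x * mixDot μ G s x) (Ioc a b) ∧
    (∫ x, π x * truncEntropy M (mix μ G b x / π x)) -
        (∫ x, π x * truncEntropy M (mix μ G a x / π x)) =
       ∫ s in Ioc a b, ∫ x, truncLog μ G π M s x * mixDot μ G s x := by
  have hint : Integrable (fun p : ℝ × EuclideanSpace ℝ (Fin n) =>
      truncLog μ G π M p.1 p.2 * mixDot μ G p.1 p.2) ((volume.restrict (Ioc a b)).prod volume) :=
    (integrable_mixDot_prod hG hG2 ha).bdd_mul (c := M * (Real.pi / 2))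
      (measurable_truncLog hG hπm M).aestronglyMeasurable
      (ae_of_all _ fun p => abs_trunc_le hM _)
  refine ⟨hint.integral_prod_left, ?_⟩
  rw [← integral_sub (integrable_entropyDensity hπm hπi hπ0 hM
      (measurable_mix_right hG b) (integrable_mix hG (ha.trans_le hab)))
    (integrable_entropyDensity hπm hπi hπ0 hM (measurable_mix_right hG a) (integrable_mix hG ha)),
    ← integral_prod _ hint, integral_prod_symm _ hint]
  refine integral_congr_ae ?_
  -- After exchanging the integrals, the fundamental theorem of calculus applies in time for almost
  -- every `x`.
  filter_upwards [hint.prod_left_ae] with x hx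
  rw [← intervalIntegral.integral_of_le hab]
  refine (intervalIntegral.integral_eq_sub_of_hasDerivAt
    (f := fun r => π x * truncEntropy M (mix μ G r x / π x)) (fun s hs => ?_) ?_).symm
  · rw [uIcc_of_le hab] at hs
    exact hasDerivAt_entropyDensity hG (hG2.integrable (by norm_num)) (ha.trans_le hs.1) hπ0 hM x
  · rw [intervalIntegrable_iff, uIoc_of_le hab]
    exact hx

end EntropyDecay

/-! ### `L¹` continuity of the density at the start of a step. -/

section ApproximateIdentity

variable {n : ℕ}

/-- The `L¹` modulus of continuity of translations. -/
noncomputable def transModulus (f : EuclideanSpace ℝ (Fin n) → ℝ) (u : EuclideanSpace ℝ (Fin n)) :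
    ℝ≥0∞ :=
  ∫⁻ x, ‖f (x - u) - f x‖ₑ

theorem transModulus_zero (f : EuclideanSpace ℝ (Fin n) → ℝ) : transModulus f 0 = 0 := by
  simp [transModulus]

theorem transModulus_le {f : EuclideanSpace ℝ (Fin n) → ℝ} (hf : Measurable f)
    (u : EuclideanSpace ℝ (Fin n)) : transModulus f u ≤ 2 * ∫⁻ x, ‖f x‖ₑ := by
  calc transModulus f u ≤ ∫⁻ x, (‖f (x - u)‖ₑ + ‖f x‖ₑ) := lintegral_mono fun x => enorm_sub_le
    _ = 2 * ∫⁻ x, ‖f x‖ₑ := by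
      rw [lintegral_add_right _ hf.enorm, lintegral_sub_right_eq_self (fun x => ‖f x‖ₑ) u, two_mul]

theorem continuous_transModulus {f : EuclideanSpace ℝ (Fin n) → ℝ} (hf : Integrable f) :
    Continuous (transModulus f) := by
  let g : EuclideanSpace ℝ (Fin n) → C(EuclideanSpace ℝ (Fin n), EuclideanSpace ℝ (Fin n)) :=
    ContinuousMap.curry ⟨fun p : EuclideanSpace ℝ (Fin n) × EuclideanSpace ℝ (Fin n) => p.2 - p.1,
      by fun_prop⟩
  have hg : Continuous g := ContinuousMap.continuous _
  have hgm : ∀ u, MeasurePreserving (g u) volume volume := fun u =>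
    measurePreserving_sub_right volume u
  have hfm : MemLp f 1 volume := memLp_one_iff_integrable.2 hf
  have h := (continuous_const (y := hfm.toLp f)).compMeasurePreservingLp hg hgm ENNReal.one_ne_top
  have h2 : Continuous fun u => edist (Lp.compMeasurePreserving (g u) (hgm u) (hfm.toLp f))
      (hfm.toLp f) := h.edist continuous_const
  convert! h2 using 2 with u
  rw [Lp.toLp_compMeasurePreserving, Lp.edist_toLp_toLp, eLpNorm_one_eq_lintegral_enorm]
  rfl

/-- By parabolic scaling, translating the kernel of time `a` by `u` costs as much as translating
that of time `1` by `u / √a`. -/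
theorem transModulus_heat {a : ℝ} (ha : 0 < a) (u : EuclideanSpace ℝ (Fin n)) :
    transModulus (heat a) u = transModulus (heat 1) ((√a)⁻¹ • u) := by
  have hr : 0 < √a := Real.sqrt_pos.2 ha
  have hm : Measure.map (fun x : EuclideanSpace ℝ (Fin n) => √a • x) volume =
      ENNReal.ofReal |((√a) ^ n)⁻¹| • volume := by
    have := Measure.map_addHaar_smul (volume : Measure (EuclideanSpace ℝ (Fin n))) hr.ne'
    rwa [finrank_euclideanSpace, Fintype.card_fin] at this
  have h1 : ∫⁻ x, ‖heat a (√a • x - u) - heat a (√a • x)‖ₑ =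
      ENNReal.ofReal |((√a) ^ n)⁻¹| * transModulus (heat a) u := by
    rw [transModulus, ← smul_eq_mul, ← lintegral_smul_measure, ← hm, lintegral_map (by fun_prop)
      (by fun_prop)]
  have h2 : ∫⁻ x, ‖heat a (√a • x - u) - heat a (√a • x)‖ₑ =
      ENNReal.ofReal |((√a) ^ n)⁻¹| * transModulus (heat 1) ((√a)⁻¹ • u) := by
    rw [transModulus, ← lintegral_const_mul _ (by fun_prop)]
    refine lintegral_congr fun x => ?_
    have e : √a • x - u = √a • (x - (√a)⁻¹ • u) := by
      rw [smul_sub, smul_smul, mul_inv_cancel₀ hr.ne', one_smul]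
    have hs := fun v : EuclideanSpace ℝ (Fin n) => heat_scale hr v
    rw [Real.sq_sqrt ha.le] at hs
    rw [e, hs, hs, ← mul_sub, enorm_mul, Real.enorm_eq_ofReal_abs]
  rw [h1] at h2
  have h0 : ENNReal.ofReal |((√a) ^ n)⁻¹| ≠ 0 := by
    rw [Ne, ENNReal.ofReal_eq_zero, not_le]; positivity
  exact (ENNReal.mul_right_inj h0 ENNReal.ofReal_ne_top).1 h2

variable {G : EuclideanSpace ℝ (Fin n) → EuclideanSpace ℝ (Fin n)}

/-- The drift translates the kernel by `a • G y`, which after rescaling by `√a` is a translation of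
size `√a ‖G y‖`. So the noise dominates the drift at short times. -/
theorem lintegral_mix_sub_mix_zero_le {μ : Measure (EuclideanSpace ℝ (Fin n))}
    [IsProbabilityMeasure μ] (hG : Measurable G) {a : ℝ} (ha : 0 < a) :
    ∫⁻ x, ‖mix μ G a x - mix μ (fun _ => 0) a x‖ₑ ≤
      ∫⁻ y, transModulus (heat 1) (-√a • G y) ∂μ := by
  have hk : Measurable fun p : EuclideanSpace ℝ (Fin n) × EuclideanSpace ℝ (Fin n) =>
      ‖kern G a p.2 p.1 - kern (fun _ => 0) a p.2 p.1‖ₑ :=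
    (((measurable_kern_prod hG a).comp measurable_swap).sub
      ((measurable_kern_prod measurable_const a).comp measurable_swap)).enorm
  calc _ ≤ ∫⁻ x, ∫⁻ y, ‖kern G a y x - kern (fun _ => 0) a y x‖ₑ ∂μ := by
        refine lintegral_mono fun x => ?_
        rw [mix, mix, ← integral_sub (integrable_kern hG ha x)
          (integrable_kern measurable_const ha x)]
        exact enorm_integral_le_lintegral_enorm _
    _ = ∫⁻ y, ∫⁻ x, ‖kern G a y x - kern (fun _ => 0) a y x‖ₑ ∂volume ∂μ :=
        lintegral_lintegral_swap hk.aemeasurable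
    _ = _ := by
        refine lintegral_congr fun y => ?_
        have h := transModulus_heat ha (-a • G y)
        rw [smul_smul] at h
        have e : (√a)⁻¹ * -a = -√a := by
          have := Real.sqrt_pos.2 ha
          rw [inv_mul_eq_iff_eq_mul₀ this.ne', mul_neg, Real.mul_self_sqrt ha.le]
        rw [e] at h
        rw [← h, transModulus, ← lintegral_add_right_eq_self _ y]
        refine lintegral_congr fun x => ?_
        simp only [kern, disp, smul_zero, sub_zero, neg_smul, sub_neg_eq_add]
        rw [add_sub_cancel_right, show x + y - (y - a • G y) = x + a • G y by abel]

theorem isProbabilityMeasure_densityMeasure {f : EuclideanSpace ℝ (Fin n) → ℝ}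
    (hf0 : ∀ x, 0 ≤ f x) (hfi : Integrable f) (hf1 : ∫ x, f x = 1) :
    IsProbabilityMeasure (densityMeasure f) := by
  refine ⟨?_⟩
  rw [densityMeasure, withDensity_apply _ MeasurableSet.univ, Measure.restrict_univ,
    ← ofReal_integral_eq_lintegral_ofReal hfi (ae_of_all _ hf0), hf1, ENNReal.ofReal_one]

/-- Without drift the step is a convolution, and the usual mollifier estimate averages the
translation modulus of `f` over the noise. -/
theorem lintegral_mix_zero_sub_le {f : EuclideanSpace ℝ (Fin n) → ℝ} (hfm : Measurable f)
    (hf0 : ∀ x, 0 ≤ f x) (hfi : Integrable f) {a : ℝ} (ha : 0 < a) :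
    ∫⁻ x, ‖mix (densityMeasure f) (fun _ => 0) a x - f x‖ₑ ≤
      ∫⁻ z, transModulus f (√(2 * a) • z) ∂stdGaussian (EuclideanSpace ℝ (Fin n)) := by
  have hk : Measurable fun p : EuclideanSpace ℝ (Fin n) × EuclideanSpace ℝ (Fin n) =>
      ENNReal.ofReal (heat a p.2) * ‖f (p.1 - p.2) - f p.1‖ₑ := by
    have : Measurable fun p : EuclideanSpace ℝ (Fin n) × EuclideanSpace ℝ (Fin n) => heat a p.2 :=
      (continuous_heat a).measurable.comp measurable_snd
    fun_prop
  obtain ⟨C, hC⟩ := exists_heat_bound (n := n) (a := a) (b := a) ha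
  have hpt : ∀ x, mix (densityMeasure f) (fun _ => 0) a x - f x =
      ∫ z, heat a z * (f (x - z) - f x) := by
    intro x
    have h1 : mix (densityMeasure f) (fun _ => 0) a x = ∫ z, heat a z * f (x - z) := by
      rw [mix, densityMeasure, integral_withDensity_eq_integral_toReal_smul hfm.ennreal_ofReal
        (ae_of_all _ fun _ => ENNReal.ofReal_lt_top), ← integral_sub_left_eq_self _ _ x]
      refine integral_congr_ae (ae_of_all _ fun z => ?_)
      simp only [kern, disp, smul_zero, sub_zero]
      rw [ENNReal.toReal_ofReal (hf0 _), sub_sub_cancel, smul_eq_mul, mul_comm]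
    have h2 : Integrable fun z => heat a z * f (x - z) :=
      (hfi.comp_sub_left x).bdd_mul (c := C) (continuous_heat a).aestronglyMeasurable
        (ae_of_all _ fun z => by
          rw [Real.norm_of_nonneg (heat_pos ha z).le]; exact (hC a (by simp) z).1)
    simp_rw [mul_sub]
    rw [integral_sub h2 ((integrable_heat ha).mul_const _), integral_mul_const, integral_heat ha,
      one_mul, h1]
  calc _ ≤ ∫⁻ x, ∫⁻ z, ENNReal.ofReal (heat a z) * ‖f (x - z) - f x‖ₑ := by
        refine lintegral_mono fun x => ?_
        rw [hpt]
        refine (enorm_integral_le_lintegral_enorm _).trans (le_of_eq ?_)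
        refine lintegral_congr fun z => ?_
        rw [enorm_mul, Real.enorm_of_nonneg (heat_pos ha z).le]
    _ = ∫⁻ z, ∫⁻ x, ENNReal.ofReal (heat a z) * ‖f (x - z) - f x‖ₑ :=
        lintegral_lintegral_swap hk.aemeasurable
    _ = ∫⁻ z, transModulus f z ∂gauss n a := by
        rw [gauss, lintegral_withDensity_eq_lintegral_mul _ (by fun_prop)
          (continuous_transModulus hfi).measurable]
        refine lintegral_congr fun z => ?_
        rw [lintegral_const_mul' _ _ ENNReal.ofReal_ne_top]
        rfl
    _ = _ := by
        rw [← stdGaussian_map_smul ha, lintegral_map (continuous_transModulus hfi).measurable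
          (by fun_prop)]

/-- An Euler step of vanishing length changes the density by little in `L¹`. -/
theorem tendsto_lintegral_mix_sub {f : EuclideanSpace ℝ (Fin n) → ℝ} (hfm : Measurable f)
    (hf0 : ∀ x, 0 ≤ f x) (hfi : Integrable f) (hf1 : ∫ x, f x = 1) (hG : Measurable G) :
    Tendsto (fun a => ∫⁻ x, ‖mix (densityMeasure f) G a x - f x‖ₑ) (𝓝[>] 0) (𝓝 0) := by
  have hP := isProbabilityMeasure_densityMeasure hf0 hfi hf1
  set μ := densityMeasure f
  have hf2 : ∫⁻ x, ‖f x‖ₑ ≠ ∞ := hfi.2.ne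
  have hh := integrable_heat (n := n) one_pos
  have hh2 : ∫⁻ x, ‖heat (n := n) 1 x‖ₑ ≠ ∞ := hh.2.ne
  have hsq : Tendsto (fun a : ℝ => √a) (𝓝[>] 0) (𝓝 0) := by
    have := (Real.continuous_sqrt.tendsto 0)
    rw [Real.sqrt_zero] at this
    exact this.mono_left nhdsWithin_le_nhds
  have hsq2 : Tendsto (fun a : ℝ => √(2 * a)) (𝓝[>] 0) (𝓝 0) := by
    have h : Continuous fun a : ℝ => √(2 * a) := by fun_prop
    have := h.tendsto 0
    simp only [mul_zero, Real.sqrt_zero] at this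
    exact this.mono_left nhdsWithin_le_nhds
  -- The modulus never exceeds twice the `L¹` norm, so dominated convergence needs no moment of `G`.
  have t1 : Tendsto (fun a => ∫⁻ y, transModulus (heat 1) (-√a • G y) ∂μ) (𝓝[>] 0) (𝓝 0) := by
    have := tendsto_lintegral_filter_of_dominated_convergence (μ := μ) (l := 𝓝[>] (0 : ℝ))
      (F := fun a y => transModulus (heat 1) (-√a • G y)) (f := fun _ => 0)
      (fun _ => 2 * ∫⁻ x, ‖heat (n := n) 1 x‖ₑ)
      (Eventually.of_forall fun a => (continuous_transModulus hh).measurable.comp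
        (hG.const_smul (-√a)))
      (Eventually.of_forall fun a => ae_of_all _ fun y => transModulus_le (by fun_prop) _)
      (by
        rw [lintegral_const, measure_univ, mul_one]
        exact ENNReal.mul_ne_top (by simp) hh2)
      (ae_of_all _ fun y => by
        have h1 : Tendsto (fun a : ℝ => -√a • G y) (𝓝[>] 0) (𝓝 0) := by
          have := (hsq.neg).smul_const (G y)
          simpa using this
        have := ((continuous_transModulus hh).tendsto 0).comp h1
        rwa [transModulus_zero] at this)
    simpa using this
  have t2 : Tendsto (fun a => ∫⁻ z, transModulus f (√(2 * a) • z)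
      ∂stdGaussian (EuclideanSpace ℝ (Fin n))) (𝓝[>] 0) (𝓝 0) := by
    have := tendsto_lintegral_filter_of_dominated_convergence
      (μ := stdGaussian (EuclideanSpace ℝ (Fin n))) (l := 𝓝[>] (0 : ℝ))
      (F := fun a z => transModulus f (√(2 * a) • z)) (f := fun _ => 0)
      (fun _ => 2 * ∫⁻ x, ‖f x‖ₑ)
      (Eventually.of_forall fun a => (continuous_transModulus hfi).measurable.comp
        (measurable_const_smul (√(2 * a))))
      (Eventually.of_forall fun a => ae_of_all _ fun y => transModulus_le hfm _)
      (by
        rw [lintegral_const, measure_univ, mul_one]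
        exact ENNReal.mul_ne_top (by simp) hf2)
      (ae_of_all _ fun z => by
        have h1 : Tendsto (fun a : ℝ => √(2 * a) • z) (𝓝[>] 0) (𝓝 0) := by
          have := hsq2.smul_const z
          simpa using this
        have := ((continuous_transModulus hfi).tendsto 0).comp h1
        rwa [transModulus_zero] at this)
    simpa using this
  have t3 := t1.add t2
  rw [add_zero] at t3
  refine tendsto_of_tendsto_of_tendsto_of_le_of_le' tendsto_const_nhds t3
    (Eventually.of_forall fun _ => zero_le) ?_
  filter_upwards [self_mem_nhdsWithin] with a ha
  refine le_trans ?_ (add_le_add (lintegral_mix_sub_mix_zero_le hG ha)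
    (lintegral_mix_zero_sub_le hfm hf0 hfi ha))
  have hm : Measurable fun x => ‖mix μ G a x - mix μ (fun _ => 0) a x‖ₑ :=
    ((measurable_mix_right hG a).sub (measurable_mix_right measurable_const a)).enorm
  rw [← lintegral_add_left hm]
  refine lintegral_mono fun x => ?_
  have : mix μ G a x - f x =
      (mix μ G a x - mix μ (fun _ => 0) a x) + (mix μ (fun _ => 0) a x - f x) := by ring
  rw [this]
  exact enorm_add_le _ _

end ApproximateIdentity

/-! ### Entropy balance over a full step, in `ℝ≥0∞`. -/

section OneStep

variable {n : ℕ}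

/-- The truncated relative Fisher information after an Euler step. -/
noncomputable def dissipation (μ : Measure (EuclideanSpace ℝ (Fin n)))
    (G gV : EuclideanSpace ℝ (Fin n) → EuclideanSpace ℝ (Fin n))
    (π : EuclideanSpace ℝ (Fin n) → ℝ) (M s : ℝ) : ℝ≥0∞ :=
  ∫⁻ x, ENNReal.ofReal (mix μ G s x * (truncWeight μ G π M s x * ‖relScore μ G gV s x‖ ^ 2))

/-- The relative Fisher information after an Euler step. -/
noncomputable def mixFisher (μ : Measure (EuclideanSpace ℝ (Fin n)))
    (G gV : EuclideanSpace ℝ (Fin n) → EuclideanSpace ℝ (Fin n)) (s : ℝ) : ℝ≥0∞ :=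
  ∫⁻ x, ENNReal.ofReal (mix μ G s x * ‖relScore μ G gV s x‖ ^ 2)

/-- The mean square error of the drift along an Euler step. -/
noncomputable def driftError (μ : Measure (EuclideanSpace ℝ (Fin n)))
    (G gV : EuclideanSpace ℝ (Fin n) → EuclideanSpace ℝ (Fin n)) (s : ℝ) : ℝ≥0∞ :=
  ∫⁻ x, ∫⁻ y, ENNReal.ofReal (kern G s y x * ‖gV x - G y‖ ^ 2) ∂μ

/-- The truncated relative entropy of the density `q` with respect to the density `π`. -/
noncomputable def truncKL (π : EuclideanSpace ℝ (Fin n) → ℝ) (M : ℝ)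
    (q : EuclideanSpace ℝ (Fin n) → ℝ) : ℝ≥0∞ :=
  ∫⁻ x, ENNReal.ofReal (π x * truncEntropy M (q x / π x))

variable {μ : Measure (EuclideanSpace ℝ (Fin n))} [IsProbabilityMeasure μ]
  {G gV : EuclideanSpace ℝ (Fin n) → EuclideanSpace ℝ (Fin n)} {s M : ℝ}
  {π : EuclideanSpace ℝ (Fin n) → ℝ}

theorem measurable_mixScore (hG : Measurable G) :
    Measurable fun p : ℝ × EuclideanSpace ℝ (Fin n) => mixScore μ G p.1 p.2 :=
  (measurable_mix hG).inv.smul (measurable_mixGrad hG)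

theorem measurable_relScore (hG : Measurable G) (hgV : Measurable gV) :
    Measurable fun p : ℝ × EuclideanSpace ℝ (Fin n) => relScore μ G gV p.1 p.2 :=
  (measurable_mixScore hG).add (hgV.comp measurable_snd)

theorem measurable_dissipation_integrand (hG : Measurable G) (hgV : Measurable gV)
    (hπ : Measurable π) (M : ℝ) :
    Measurable fun p : ℝ × EuclideanSpace ℝ (Fin n) => ENNReal.ofReal
      (mix μ G p.1 p.2 * (truncWeight μ G π M p.1 p.2 * ‖relScore μ G gV p.1 p.2‖ ^ 2)) :=
  ((measurable_mix hG).mul ((measurable_truncWeight hG hπ M).mul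
    ((measurable_relScore hG hgV).norm.pow_const 2))).ennreal_ofReal

theorem measurable_dissipation (hG : Measurable G) (hgV : Measurable gV)
    (hπ : Measurable π) (M : ℝ) : Measurable (dissipation μ G gV π M) :=
  (measurable_dissipation_integrand hG hgV hπ M).lintegral_prod_right'

theorem measurable_mixFisher (hG : Measurable G) (hgV : Measurable gV) :
    Measurable (mixFisher μ G gV) := by
  have h : Measurable fun p : ℝ × EuclideanSpace ℝ (Fin n) => ENNReal.ofReal
      (mix μ G p.1 p.2 * ‖relScore μ G gV p.1 p.2‖ ^ 2) :=
    ((measurable_mix hG).mul ((measurable_relScore hG hgV).norm.pow_const 2)).ennreal_ofReal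
  exact h.lintegral_prod_right'

theorem measurable_driftError (hG : Measurable G) (hgV : Measurable gV) :
    Measurable (driftError μ G gV) := by
  have hr : Measurable fun q : (ℝ × EuclideanSpace ℝ (Fin n)) × EuclideanSpace ℝ (Fin n) =>
      (q.1.1, q.2, q.1.2) := by fun_prop
  have h1 := (measurable_kern hG).comp hr
  have h2 : Measurable fun q : (ℝ × EuclideanSpace ℝ (Fin n)) × EuclideanSpace ℝ (Fin n) =>
      ‖gV q.1.2 - G q.2‖ ^ 2 :=
    (((hgV.comp measurable_fst.snd).sub (hG.comp measurable_snd)).norm).pow_const 2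
  have h : Measurable fun q : (ℝ × EuclideanSpace ℝ (Fin n)) × EuclideanSpace ℝ (Fin n) =>
      ENNReal.ofReal (kern G q.1.1 q.2 q.1.2 * ‖gV q.1.2 - G q.2‖ ^ 2) :=
    (h1.mul h2).ennreal_ofReal
  exact h.lintegral_prod_right'.lintegral_prod_right'

theorem ofReal_integral_joint_snd (hG : Measurable G) (hs : 0 < s)
    {g : EuclideanSpace ℝ (Fin n) → ℝ} (hgm : Measurable g) (hg0 : ∀ x, 0 ≤ g x)
    (hg : Integrable (fun p => g p.2) (joint μ G s)) :
    ENNReal.ofReal (∫ p, g p.2 ∂joint μ G s) = ∫⁻ x, ENNReal.ofReal (mix μ G s x * g x) := by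
  rw [ofReal_integral_eq_lintegral_ofReal hg (ae_of_all _ fun p => hg0 p.2),
    lintegral_joint_symm hG hs (hgm.fun_comp measurable_snd).ennreal_ofReal]
  refine lintegral_congr fun x => ?_
  simp only
  rw [lintegral_mul_const _ (measurable_kern_left hG s x).ennreal_ofReal, ← ofReal_mix hG hs,
    ENNReal.ofReal_mul (mix_pos hG hs x).le]

theorem ofReal_integral_drift (hG : Measurable G) (hgV : Measurable gV) (hs : 0 < s)
    (h : Integrable (fun p => ‖gV p.2 - G p.1‖ ^ 2) (joint μ G s)) :
    ENNReal.ofReal (∫ p, ‖gV p.2 - G p.1‖ ^ 2 ∂joint μ G s) = driftError μ G gV s := by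
  have hm : Measurable fun p : EuclideanSpace ℝ (Fin n) × EuclideanSpace ℝ (Fin n) =>
      ‖gV p.2 - G p.1‖ ^ 2 :=
    (((hgV.comp measurable_snd).sub (hG.comp measurable_fst)).norm).pow_const 2
  rw [ofReal_integral_eq_lintegral_ofReal h (ae_of_all _ fun p => by positivity),
    lintegral_joint_symm hG hs hm.ennreal_ofReal]
  refine lintegral_congr fun x => lintegral_congr fun y => ?_
  rw [ENNReal.ofReal_mul (kern_pos G hs y x).le]

theorem truncKL_eq (hπm : Measurable π) (hπi : Integrable π) (hπ0 : ∀ x, 0 < π x) (hM : 0 < M)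
    {q : EuclideanSpace ℝ (Fin n) → ℝ} (hqm : Measurable q) (hq : Integrable q)
    (hq0 : ∀ x, 0 ≤ q x) :
    truncKL π M q = ENNReal.ofReal (∫ x, π x * truncEntropy M (q x / π x)) :=
  (ofReal_integral_eq_lintegral_ofReal (integrable_entropyDensity hπm hπi hπ0 hM hqm hq)
    (ae_of_all _ fun x => mul_nonneg (hπ0 x).le
      (truncEntropy_nonneg hM (div_nonneg (hq0 x) (hπ0 x).le)))).symm

theorem truncKL_le_add (hπm : Measurable π) (hπ0 : ∀ x, 0 < π x) (hM : 0 < M)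
    {q r : EuclideanSpace ℝ (Fin n) → ℝ} (hrm : Measurable r) :
    truncKL π M q ≤ truncKL π M r + ENNReal.ofReal (M * (Real.pi / 2)) * ∫⁻ x, ‖q x - r x‖ₑ := by
  have hm : Measurable fun x => ENNReal.ofReal (π x * truncEntropy M (r x / π x)) :=
    (hπm.mul ((continuous_truncEntropy hM).measurable.comp (hrm.div hπm))).ennreal_ofReal
  rw [truncKL, truncKL, ← lintegral_const_mul' _ _ ENNReal.ofReal_ne_top, ← lintegral_add_left hm]
  refine lintegral_mono fun x => ?_
  rw [Real.enorm_eq_ofReal_abs, ← ENNReal.ofReal_mul (by positivity)]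
  refine le_trans (ENNReal.ofReal_le_ofReal ?_) ENNReal.ofReal_add_le
  have h := (abs_le.1 (abs_truncEntropy_sub_le hM (q x / π x) (r x / π x))).2
  have e : π x * |q x / π x - r x / π x| = |q x - r x| := by
    rw [← abs_of_pos (hπ0 x), ← abs_mul, abs_of_pos (hπ0 x)]
    congr 1
    field_simp [(hπ0 x).ne']
  have := mul_le_mul_of_nonneg_left h (hπ0 x).le
  rw [← e]
  nlinarith

variable {L e : ℝ}

theorem driftError_le_const (hG : Measurable G) (hG2 : MemLp G 2 μ) (hs : 0 < s)
    (hL0 : 0 ≤ L) (hgVc : Continuous gV) (hL : ∀ x y, ‖gV x - gV y‖ ≤ L * ‖x - y‖)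
    (he : ∀ y, ‖G y - gV y‖ ≤ e) {γ : ℝ} (hsγ : s ≤ γ) :
    driftError μ G gV s ≤ ENNReal.ofReal
      (3 * (L ^ 2 * (2 * γ * n) + (L * γ) ^ 2 * ∫ y, ‖G y‖ ^ 2 ∂μ + e ^ 2)) := by
  have hgV := memLp_gV_joint hG hG2 hs hL0 hgVc.measurable hL he
  rw [← ofReal_integral_drift hG hgVc.measurable hs
    ((hgV.sub (memLp_fst_joint hG hs hG2)).integrable_norm_pow (by norm_num))]
  exact ENNReal.ofReal_le_ofReal
    (integral_norm_sq_drift_sub_le_of_le hG hG2 hs hL0 hgVc.measurable hL he hsγ)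

/-- The bound contains the untruncated Fisher information. It can therefore be absorbed only once
the truncation has been removed. -/
theorem driftError_le (hG : Measurable G) (hG2 : MemLp G 2 μ) (hs : 0 < s)
    (hL0 : 0 ≤ L) (hgVc : Continuous gV) (hL : ∀ x y, ‖gV x - gV y‖ ≤ L * ‖x - y‖)
    (he : ∀ y, ‖G y - gV y‖ ≤ e) {γ : ℝ} (hsγ : s ≤ γ) (hγL : γ * L ≤ 1 / √32) :
    driftError μ G gV s ≤ ENNReal.ofReal (1 / 4) * mixFisher μ G gV s +
      ENNReal.ofReal (12 * n * L ^ 2 * γ + 6 * e ^ 2) := by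
  have hgV := memLp_gV_joint hG hG2 hs hL0 hgVc.measurable hL he
  have hH : MemLp (fun p => relScore μ G gV s p.2) 2 (joint μ G s) :=
    (memLp_mixScore hG hs).add hgV
  have hγ : 0 < γ := hs.trans_le hsγ
  have hF := ofReal_integral_joint_snd hG hs (g := fun x => ‖relScore μ G gV s x‖ ^ 2)
    ((measurable_relScore_right hG hgVc.measurable s).norm.pow_const 2)
    (fun x => by positivity) (hH.integrable_norm_pow (by norm_num))
  rw [← ofReal_integral_drift hG hgVc.measurable hs
    ((hgV.sub (memLp_fst_joint hG hs hG2)).integrable_norm_pow (by norm_num)), mixFisher, ← hF,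
    ← ENNReal.ofReal_mul (by norm_num), ← ENNReal.ofReal_add
      (mul_nonneg (by norm_num) (integral_nonneg fun p => by positivity)) (by positivity)]
  refine ENNReal.ofReal_le_ofReal ?_
  have h := integral_norm_sq_drift_sub_le hG hG2 hs hL0 hgVc hL he
    ((mul_le_mul_of_nonneg_right hsγ hL0).trans hγL)
  have h2 : 12 * n * L ^ 2 * s ≤ 12 * n * L ^ 2 * γ :=
    mul_le_mul_of_nonneg_left hsγ (by positivity)
  linarith

theorem truncKL_decay_Ioc (hG : Measurable G) (hG2 : MemLp G 2 μ)
    (hL0 : 0 ≤ L) (hgVc : Continuous gV) (hL : ∀ x y, ‖gV x - gV y‖ ≤ L * ‖x - y‖)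
    (he : ∀ y, ‖G y - gV y‖ ≤ e) (hπm : Measurable π) (hπi : Integrable π) (hπ0 : ∀ x, 0 < π x)
    (hπ : ∀ x, HasGradientAt (fun y => Real.log (π y)) (-gV x) x) (hM : 0 < M)
    {a γ : ℝ} (ha : 0 < a) (haγ : a ≤ γ) :
    ENNReal.ofReal (3 / 4) * (∫⁻ s in Ioc a γ, dissipation μ G gV π M s) +
        truncKL π M (mix μ G γ) ≤
      truncKL π M (mix μ G a) + ∫⁻ s in Ioc a γ, driftError μ G gV s := by
  have hgVm := hgVc.measurable
  set D : ℝ → ℝ := fun s => ∫ p, ‖gV p.2 - G p.1‖ ^ 2 ∂joint μ G s with hDdef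
  set A : ℝ → ℝ := fun s => ∫ p, truncWeight μ G π M s p.2 * ‖relScore μ G gV s p.2‖ ^ 2
    ∂joint μ G s with hAdef
  set I : ℝ → ℝ := fun s => ∫ x, truncLog μ G π M s x * mixDot μ G s x with hIdef
  have hmem : ∀ᵐ s ∂volume.restrict (Ioc a γ), s ∈ Ioc a γ := ae_restrict_mem measurableSet_Ioc
  have hgV : ∀ s, 0 < s → MemLp (fun p => gV p.2) 2 (joint μ G s) := fun s hs =>
    memLp_gV_joint hG hG2 hs hL0 hgVm hL he
  have hwm : ∀ s, Measurable (truncWeight μ G π M s) := fun s =>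
    (measurable_truncWeight hG hπm M).of_uncurry_left (f := truncWeight μ G π M)
  have hDE : ∀ s, 0 < s → ENNReal.ofReal (D s) = driftError μ G gV s := fun s hs =>
    ofReal_integral_drift hG hgVm hs
      (((hgV s hs).sub (memLp_fst_joint hG hs hG2)).integrable_norm_pow (by norm_num))
  have hAE : ∀ s, 0 < s → ENNReal.ofReal (A s) = dissipation μ G gV π M s := by
    intro s hs
    refine ofReal_integral_joint_snd hG hs
      (g := fun x => truncWeight μ G π M s x * ‖relScore μ G gV s x‖ ^ 2)
      ((hwm s).mul ((measurable_relScore_right hG hgVm s).norm.pow_const 2))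
      (fun x => mul_nonneg (truncDeriv_nonneg _ _) (by positivity)) ?_
    have hH : MemLp (fun p => relScore μ G gV s p.2) 2 (joint μ G s) :=
      (memLp_mixScore hG hs).add (hgV s hs)
    refine (hH.integrable_norm_pow (p := 2) (by norm_num)).mono'
      (((hwm s).comp measurable_snd).mul (((measurable_relScore_right hG hgVm s).comp
        measurable_snd).norm.pow_const 2)).aestronglyMeasurable (ae_of_all _ fun p => ?_)
    have hw0 : 0 ≤ truncWeight μ G π M s p.2 := truncDeriv_nonneg _ _
    rw [Real.norm_of_nonneg (mul_nonneg hw0 (by positivity))]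
    exact mul_le_of_le_one_left (by positivity) (truncDeriv_le_one _ _)
  have hD0 : ∀ s, 0 ≤ D s := fun s => integral_nonneg fun p => by positivity
  have hA0 : ∀ s, 0 ≤ A s := fun s => integral_nonneg fun p =>
    mul_nonneg (truncDeriv_nonneg _ _) (by positivity)
  obtain ⟨hIint, hFI⟩ := integral_entropyDensity_sub hG hG2 hπm hπi hπ0 hM ha haγ
  have hkey : ∀ s, 0 < s → I s ≤ -(3 / 4) * A s + D s := fun s hs =>
    integral_mul_mixDot_le hG hG2 hs hgVm (hgV s hs)
      (fun x => hasGradientAt_truncLog hG hs hπ0 hπ hM x) (fun x => abs_trunc_le hM _) (hwm s)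
      (fun x => truncDeriv_nonneg _ _) (fun x => truncDeriv_le_one _ _)
  have hDm : AEStronglyMeasurable D (volume.restrict (Ioc a γ)) := by
    refine ((measurable_driftError (μ := μ) hG hgVm).ennreal_toReal.aestronglyMeasurable).congr ?_
    filter_upwards [hmem] with s hs
    rw [← hDE s (ha.trans hs.1), ENNReal.toReal_ofReal (hD0 s)]
  have hAm : AEStronglyMeasurable A (volume.restrict (Ioc a γ)) := by
    refine ((measurable_dissipation (μ := μ) hG hgVm hπm
      M).ennreal_toReal.aestronglyMeasurable).congr ?_
    filter_upwards [hmem] with s hs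
    rw [← hAE s (ha.trans hs.1), ENNReal.toReal_ofReal (hA0 s)]
  have hDi : IntegrableOn D (Ioc a γ) := by
    refine Integrable.of_bound hDm
      (3 * (L ^ 2 * (2 * γ * n) + (L * γ) ^ 2 * ∫ y, ‖G y‖ ^ 2 ∂μ + e ^ 2)) ?_
    filter_upwards [hmem] with s hs
    rw [Real.norm_of_nonneg (hD0 s)]
    exact integral_norm_sq_drift_sub_le_of_le hG hG2 (ha.trans hs.1) hL0 hgVm hL he hs.2
  -- Integrability of the dissipation in time follows from the differential inequality itself, as
  -- `(3/4) A ≤ D - I`.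
  have hAi : IntegrableOn A (Ioc a γ) := by
    refine Integrable.mono' ((hDi.sub hIint).const_mul (4 / 3)) hAm ?_
    filter_upwards [hmem] with s hs
    rw [Real.norm_of_nonneg (hA0 s)]
    have := hkey s (ha.trans hs.1)
    simp only [Pi.sub_apply]
    change A s ≤ 4 / 3 * (D s - I s)
    linarith
  have hint : ∫ s in Ioc a γ, I s ≤ -(3 / 4) * (∫ s in Ioc a γ, A s) + ∫ s in Ioc a γ, D s := by
    rw [← integral_const_mul, ← integral_add (hAi.const_mul _) hDi]
    refine integral_mono_ae hIint ((hAi.const_mul _).add hDi) ?_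
    filter_upwards [hmem] with s hs
    exact hkey s (ha.trans hs.1)
  have hAL : ENNReal.ofReal (∫ s in Ioc a γ, A s) = ∫⁻ s in Ioc a γ, dissipation μ G gV π M s := by
    rw [ofReal_integral_eq_lintegral_ofReal hAi (ae_of_all _ hA0)]
    refine lintegral_congr_ae ?_
    filter_upwards [hmem] with s hs using hAE s (ha.trans hs.1)
  have hDL : ENNReal.ofReal (∫ s in Ioc a γ, D s) = ∫⁻ s in Ioc a γ, driftError μ G gV s := by
    rw [ofReal_integral_eq_lintegral_ofReal hDi (ae_of_all _ hD0)]
    refine lintegral_congr_ae ?_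
    filter_upwards [hmem] with s hs using hDE s (ha.trans hs.1)
  have hq : ∀ t, 0 < t → truncKL π M (mix μ G t) =
      ENNReal.ofReal (∫ x, π x * truncEntropy M (mix μ G t x / π x)) := fun t ht =>
    truncKL_eq hπm hπi hπ0 hM (measurable_mix_right hG t) (integrable_mix hG ht)
      fun x => (mix_pos hG ht x).le
  have hq0 : ∀ t, 0 < t → 0 ≤ ∫ x, π x * truncEntropy M (mix μ G t x / π x) := fun t ht =>
    integral_nonneg fun x => mul_nonneg (hπ0 x).le
      (truncEntropy_nonneg hM (div_pos (mix_pos hG ht x) (hπ0 x)).le)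
  have hγ : 0 < γ := ha.trans_le haγ
  rw [hq γ hγ, hq a ha, ← hAL, ← hDL, ← ENNReal.ofReal_mul (by norm_num),
    ← ENNReal.ofReal_add (mul_nonneg (by norm_num) (integral_nonneg hA0)) (hq0 γ hγ),
    ← ENNReal.ofReal_add (hq0 a ha) (integral_nonneg hD0)]
  refine ENNReal.ofReal_le_ofReal ?_
  have hFI' : (∫ x, π x * truncEntropy M (mix μ G γ x / π x)) -
      (∫ x, π x * truncEntropy M (mix μ G a x / π x)) = ∫ s in Ioc a γ, I s := hFI
  linarith

/-- Decay of the truncated relative entropy along an Euler step. -/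
theorem truncKL_decay {f : EuclideanSpace ℝ (Fin n) → ℝ} (hfm : Measurable f)
    (hf0 : ∀ x, 0 ≤ f x) (hfi : Integrable f) (hf1 : ∫ x, f x = 1)
    (hG : Measurable G) (hG2 : MemLp G 2 (densityMeasure f))
    (hL0 : 0 ≤ L) (hgVc : Continuous gV) (hL : ∀ x y, ‖gV x - gV y‖ ≤ L * ‖x - y‖)
    (he : ∀ y, ‖G y - gV y‖ ≤ e) (hπm : Measurable π) (hπi : Integrable π) (hπ0 : ∀ x, 0 < π x)
    (hπ : ∀ x, HasGradientAt (fun y => Real.log (π y)) (-gV x) x) (hM : 0 < M)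
    {γ : ℝ} (hγ : 0 < γ) :
    ENNReal.ofReal (3 / 4) * (∫⁻ s in Ioc 0 γ, dissipation (densityMeasure f) G gV π M s) +
        truncKL π M (mix (densityMeasure f) G γ) ≤
      truncKL π M f + ∫⁻ s in Ioc 0 γ, driftError (densityMeasure f) G gV s := by
  have hP := isProbabilityMeasure_densityMeasure hf0 hfi hf1
  set μ := densityMeasure f with hμ
  have hlim := tendsto_lintegral_mix_sub hfm hf0 hfi hf1 hG
  set a : ℕ → ℝ := fun m => γ / (m + 1) with ha
  have ha0 : ∀ m, 0 < a m := fun m => by positivity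
  have haγ : ∀ m, a m ≤ γ := fun m => div_le_self hγ.le (by linarith [m.cast_nonneg (α := ℝ)])
  have hat : Tendsto a atTop (𝓝[>] 0) := by
    refine tendsto_nhdsWithin_iff.2 ⟨?_, Eventually.of_forall ha0⟩
    have h := (tendsto_one_div_add_atTop_nhds_zero_nat (𝕜 := ℝ)).const_mul γ
    simpa [ha, div_eq_mul_inv] using h
  have hanti : Antitone a := fun i j hij =>
    div_le_div_of_nonneg_left hγ.le (by positivity) (by simpa using hij)
  have hU : ⋃ m, Ioc (a m) γ = Ioc 0 γ := by
    ext t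
    simp only [mem_iUnion, mem_Ioc]
    constructor
    · rintro ⟨m, h1, h2⟩; exact ⟨(ha0 m).trans h1, h2⟩
    · rintro ⟨h1, h2⟩
      have := (tendsto_nhdsWithin_iff.1 hat).1.eventually_lt_const h1
      obtain ⟨m, hm⟩ := this.exists
      exact ⟨m, hm, h2⟩
  have hdm := measurable_dissipation (μ := μ) hG hgVc.measurable hπm M
  have t1 : Tendsto (fun m => ∫⁻ s in Ioc (a m) γ, dissipation μ G gV π M s) atTop
      (𝓝 (∫⁻ s in Ioc 0 γ, dissipation μ G gV π M s)) := by
    have h := tendsto_measure_iUnion_atTop (μ := volume.withDensity (dissipation μ G gV π M))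
      (s := fun m => Ioc (a m) γ) (fun i j hij => Ioc_subset_Ioc_left (hanti hij))
    rw [hU] at h
    simpa only [Function.comp_def, withDensity_apply _ measurableSet_Ioc] using h
  have t2 : Tendsto (fun m => ENNReal.ofReal (3 / 4) *
      (∫⁻ s in Ioc (a m) γ, dissipation μ G gV π M s) + truncKL π M (mix μ G γ)) atTop
      (𝓝 (ENNReal.ofReal (3 / 4) * (∫⁻ s in Ioc 0 γ, dissipation μ G gV π M s) +
        truncKL π M (mix μ G γ))) :=
    (ENNReal.Tendsto.const_mul t1 (Or.inr ENNReal.ofReal_ne_top)).add_const _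
  have t3 : Tendsto (fun m => truncKL π M f + ENNReal.ofReal (M * (Real.pi / 2)) *
      (∫⁻ x, ‖mix μ G (a m) x - f x‖ₑ) + ∫⁻ s in Ioc 0 γ, driftError μ G gV s) atTop
      (𝓝 (truncKL π M f + ENNReal.ofReal (M * (Real.pi / 2)) * 0 +
        ∫⁻ s in Ioc 0 γ, driftError μ G gV s)) :=
    ((ENNReal.Tendsto.const_mul (hlim.comp hat) (Or.inr ENNReal.ofReal_ne_top)).const_add
      _).add_const _
  rw [mul_zero, add_zero] at t3
  -- Only the entropy at the lower end needs continuity as `a m → 0`. The dissipation is recovered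
  -- by exhausting `Ioc 0 γ`, and the drift error is bounded by its integral over the whole step.
  refine le_of_tendsto_of_tendsto' t2 t3 fun m => ?_
  refine (truncKL_decay_Ioc hG hG2 hL0 hgVc hL he hπm hπi hπ0 hπ hM (ha0 m) (haγ m)).trans ?_
  exact add_le_add (truncKL_le_add hπm hπ0 hM hfm)
    (lintegral_mono_set (Ioc_subset_Ioc_left (ha0 m).le))

/-- The weights `1 / (1 + (u / M)²)` increase to `1` with `M`, so monotone convergence applies in
space and again in time. -/
theorem tendsto_lintegral_dissipation (hG : Measurable G) (hgVm : Measurable gV) (hπm : Measurable π)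
    (γ : ℝ) :
    Tendsto (fun m : ℕ => ∫⁻ s in Ioc 0 γ, dissipation μ G gV π (m + 1) s) atTop
      (𝓝 (∫⁻ s in Ioc 0 γ, mixFisher μ G gV s)) := by
  have hwmono : ∀ u : ℝ, Monotone fun m : ℕ => truncDeriv ((m : ℝ) + 1) u := by
    intro u i j hij
    refine inv_anti₀ (by positivity) ?_
    rw [div_pow, div_pow]
    have : (i : ℝ) ≤ j := by exact_mod_cast hij
    gcongr
  have hwlim : ∀ u : ℝ, Tendsto (fun m : ℕ => truncDeriv ((m : ℝ) + 1) u) atTop (𝓝 1) := by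
    intro u
    have h := (tendsto_one_div_add_atTop_nhds_zero_nat (𝕜 := ℝ)).const_mul u
    have h2 := ((h.pow 2).const_add 1).inv₀ (by simp)
    simpa [truncDeriv, div_eq_mul_inv] using h2
  have hmono : ∀ s ∈ Ioc 0 γ, ∀ x, Monotone fun m : ℕ => ENNReal.ofReal (mix μ G s x *
      (truncWeight μ G π (m + 1) s x * ‖relScore μ G gV s x‖ ^ 2)) := by
    intro s hs x i j hij
    exact ENNReal.ofReal_le_ofReal (mul_le_mul_of_nonneg_left
      (mul_le_mul_of_nonneg_right (hwmono _ hij) (by positivity)) (mix_pos hG hs.1 x).le)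
  have hdm : ∀ s, s ∈ Ioc 0 γ → Monotone fun m : ℕ => dissipation μ G gV π (m + 1) s :=
    fun s hs i j hij => lintegral_mono fun x => hmono s hs x hij
  have h2 : ∫⁻ s in Ioc 0 γ, ⨆ m : ℕ, dissipation μ G gV π (m + 1) s =
      ⨆ m : ℕ, ∫⁻ s in Ioc 0 γ, dissipation μ G gV π (m + 1) s := by
    refine lintegral_iSup' (fun m =>
      (measurable_dissipation hG hgVm hπm ((m : ℝ) + 1)).aemeasurable) ?_
    filter_upwards [ae_restrict_mem measurableSet_Ioc] with s hs using hdm s hs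
  have h3 := tendsto_atTop_iSup (f := fun m : ℕ => ∫⁻ s in Ioc 0 γ, dissipation μ G gV π (m + 1) s)
    fun i j hij => setLIntegral_mono' measurableSet_Ioc fun s hs => hdm s hs hij
  rw [← h2] at h3
  convert h3 using 2
  symm
  refine setLIntegral_congr_fun measurableSet_Ioc fun s hs => ?_
  simp only [dissipation, mixFisher]
  rw [← lintegral_iSup (fun m => (measurable_dissipation_integrand hG hgVm hπm
    ((m : ℝ) + 1)).of_uncurry_left (f := fun s x => ENNReal.ofReal (mix μ G s x *
      (truncWeight μ G π ((m : ℝ) + 1) s x * ‖relScore μ G gV s x‖ ^ 2))))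
    fun i j hij x => hmono s hs x hij]
  refine lintegral_congr fun x => ?_
  refine iSup_eq_of_tendsto (hmono s hs x) ?_
  have h := (((hwlim (Real.log (mix μ G s x / π x))).mul_const
    (‖relScore μ G gV s x‖ ^ 2)).const_mul (mix μ G s x))
  rw [one_mul] at h
  exact (ENNReal.continuous_ofReal.tendsto _).comp h

end OneStep

/-! ### Finite entropy gives second moments of the score. -/

section Moments

variable {n : ℕ} {gV : EuclideanSpace ℝ (Fin n) → EuclideanSpace ℝ (Fin n)}
  {π : EuclideanSpace ℝ (Fin n) → ℝ} {L b : ℝ}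

/-- The mean value inequality on the ball of radius `‖z‖` about `x`, where the gradient varies by at
most `L‖z‖`. It yields `L` in place of the sharp `L/2`, which is immaterial here. -/
theorem add_inner_sub_le_log (hL0 : 0 ≤ L) (hL : ∀ x y, ‖gV x - gV y‖ ≤ L * ‖x - y‖)
    (hπ : ∀ x, HasGradientAt (fun y => Real.log (π y)) (-gV x) x)
    (x z : EuclideanSpace ℝ (Fin n)) :
    Real.log (π x) + inner ℝ z (gV x) - L * ‖z‖ ^ 2 ≤ Real.log (π (x - z)) := by
  have h := (convex_closedBall (E := EuclideanSpace ℝ (Fin n)) x ‖z‖).norm_image_sub_le_of_norm_hasFDerivWithin_le'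
    (f := fun y => Real.log (π y)) (φ := InnerProductSpace.toDual ℝ _ (-gV x)) (C := L * ‖z‖)
    (x := x) (y := x - z) (fun y _ => (hπ y).hasFDerivAt.hasFDerivWithinAt) ?_ (by simp)
    (by simp)
  · have h2 := (abs_le.1 h).1
    simp only [sub_sub_cancel_left, norm_neg, map_neg, InnerProductSpace.toDual_apply_apply,
      neg_apply, neg_neg, real_inner_comm z] at h2
    nlinarith [real_inner_comm z (gV x)]
  · intro y hy
    rw [Metric.mem_closedBall, dist_eq_norm] at hy
    rw [← map_sub, LinearIsometryEquiv.norm_map, neg_sub_neg, norm_sub_rev]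
    exact (hL y x).trans (mul_le_mul_of_nonneg_left hy hL0)

theorem mul_exp_inner_le (hL0 : 0 ≤ L) (hL : ∀ x y, ‖gV x - gV y‖ ≤ L * ‖x - y‖)
    (hπ0 : ∀ x, 0 < π x) (hπ : ∀ x, HasGradientAt (fun y => Real.log (π y)) (-gV x) x)
    (x z : EuclideanSpace ℝ (Fin n)) :
    π x * Real.exp (inner ℝ z (gV x)) ≤ π (x - z) * Real.exp (L * ‖z‖ ^ 2) := by
  have h := add_inner_sub_le_log hL0 hL hπ x z
  conv_lhs => rw [← Real.exp_log (hπ0 x), ← Real.exp_add]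
  conv_rhs => rw [← Real.exp_log (hπ0 (x - z)), ← Real.exp_add]
  exact Real.exp_le_exp.2 (by linarith)

/-- Completing the square. -/
theorem lintegral_exp_inner (hb : 0 < b) (g : EuclideanSpace ℝ (Fin n)) :
    ∫⁻ z, ENNReal.ofReal (Real.exp (-b * ‖z‖ ^ 2 + inner ℝ z g)) =
      ENNReal.ofReal (Real.exp (‖g‖ ^ 2 / (4 * b))) *
        ∫⁻ z : EuclideanSpace ℝ (Fin n), ENNReal.ofReal (Real.exp (-b * ‖z‖ ^ 2)) := by
  rw [← lintegral_sub_right_eq_self (fun z : EuclideanSpace ℝ (Fin n) =>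
    ENNReal.ofReal (Real.exp (-b * ‖z‖ ^ 2))) ((2 * b)⁻¹ • g),
    ← lintegral_const_mul' _ _ ENNReal.ofReal_ne_top]
  refine lintegral_congr fun z => ?_
  rw [← ENNReal.ofReal_mul (Real.exp_pos _).le, ← Real.exp_add, norm_sub_sq_real, norm_smul,
    real_inner_smul_right, Real.norm_of_nonneg (by positivity)]
  congr 2
  field_simp
  ring

/-- Exponential integrability of the squared score of a density with Lipschitz score. -/
theorem lintegral_mul_exp_norm_sq_lt_top (hL0 : 0 ≤ L)
    (hL : ∀ x y, ‖gV x - gV y‖ ≤ L * ‖x - y‖) (hπm : Measurable π) (hπi : Integrable π)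
    (hπ0 : ∀ x, 0 < π x) (hπ : ∀ x, HasGradientAt (fun y => Real.log (π y)) (-gV x) x) :
    ∫⁻ x, ENNReal.ofReal (π x * Real.exp (‖gV x‖ ^ 2 / (4 * (L + 1)))) < ∞ := by
  have hb : 0 < L + 1 := by positivity
  set c := ∫⁻ z : EuclideanSpace ℝ (Fin n), ENNReal.ofReal (Real.exp (-(L + 1) * ‖z‖ ^ 2)) with hc
  have hc0 : c ≠ 0 := by
    rw [hc, ← ofReal_integral_eq_lintegral_ofReal (integrable_exp_neg_mul_norm_sq hb)
      (ae_of_all _ fun z => (Real.exp_pos _).le)]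
    have := integral_exp_pos (integrable_exp_neg_mul_norm_sq (n := n) hb)
    simpa using this
  have hctop : c ≠ ∞ := by
    rw [hc, ← ofReal_integral_eq_lintegral_ofReal (integrable_exp_neg_mul_norm_sq hb)
      (ae_of_all _ fun z => (Real.exp_pos _).le)]
    exact ENNReal.ofReal_ne_top
  have h1 : ∫⁻ z : EuclideanSpace ℝ (Fin n), ENNReal.ofReal (Real.exp (-1 * ‖z‖ ^ 2)) < ∞ := by
    rw [← ofReal_integral_eq_lintegral_ofReal (integrable_exp_neg_mul_norm_sq one_pos)
      (ae_of_all _ fun z => (Real.exp_pos _).le)]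
    exact ENNReal.ofReal_lt_top
  have h2 : ∫⁻ x, ENNReal.ofReal (π x) < ∞ := by
    rw [← ofReal_integral_eq_lintegral_ofReal hπi (ae_of_all _ fun x => (hπ0 x).le)]
    exact ENNReal.ofReal_lt_top
  -- Integrate `π x * exp⟨z, gV x⟩ ≤ π (x - z) * exp(L‖z‖²)` against `exp(-(L+1)‖z‖²)`. In `z`, the
  -- left side produces the exponential moment; on the right the surplus `1` in the exponent leaves
  -- an integrable Gaussian convolved with `π`.
  have key : (∫⁻ x, ENNReal.ofReal (π x * Real.exp (‖gV x‖ ^ 2 / (4 * (L + 1))))) * c ≤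
      (∫⁻ z : EuclideanSpace ℝ (Fin n), ENNReal.ofReal (Real.exp (-1 * ‖z‖ ^ 2))) *
        ∫⁻ x, ENNReal.ofReal (π x) := by
    calc (∫⁻ x, ENNReal.ofReal (π x * Real.exp (‖gV x‖ ^ 2 / (4 * (L + 1))))) * c
        = ∫⁻ x, ∫⁻ z, ENNReal.ofReal
            (π x * Real.exp (-(L + 1) * ‖z‖ ^ 2 + inner ℝ z (gV x))) := by
          rw [← lintegral_mul_const' _ _ hctop]
          refine lintegral_congr fun x => ?_
          simp_rw [ENNReal.ofReal_mul (hπ0 x).le]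
          rw [lintegral_const_mul' _ _ ENNReal.ofReal_ne_top, lintegral_exp_inner hb, mul_assoc]
      _ ≤ ∫⁻ x, ∫⁻ z, ENNReal.ofReal (Real.exp (-1 * ‖z‖ ^ 2) * π (x - z)) := by
          refine lintegral_mono fun x => lintegral_mono fun z => ENNReal.ofReal_le_ofReal ?_
          have h := mul_le_mul_of_nonneg_right (mul_exp_inner_le hL0 hL hπ0 hπ x z)
            (Real.exp_pos (-(L + 1) * ‖z‖ ^ 2)).le
          rw [mul_assoc, mul_assoc, ← Real.exp_add, ← Real.exp_add] at h
          rw [add_comm, mul_comm (Real.exp _) (π _)]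
          refine h.trans_eq ?_
          congr 2
          ring
      _ = ∫⁻ z, ∫⁻ x, ENNReal.ofReal (Real.exp (-1 * ‖z‖ ^ 2) * π (x - z)) := by
          refine lintegral_lintegral_swap (Measurable.aemeasurable ?_)
          have : Measurable fun p : EuclideanSpace ℝ (Fin n) × EuclideanSpace ℝ (Fin n) =>
            π (p.1 - p.2) := hπm.comp (measurable_fst.sub measurable_snd)
          unfold Function.uncurry
          fun_prop
      _ = _ := by
          rw [← lintegral_mul_const' _ _ h2.ne]
          refine lintegral_congr fun z => ?_
          simp_rw [ENNReal.ofReal_mul (Real.exp_pos _).le]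
          rw [lintegral_const_mul' _ _ ENNReal.ofReal_ne_top,
            lintegral_sub_right_eq_self (fun x => ENNReal.ofReal (π x)) z]
  by_contra h
  rw [not_lt, top_le_iff] at h
  rw [h, ENNReal.top_mul hc0] at key
  exact absurd (ENNReal.mul_lt_top h1 h2) (not_lt.2 key)

/-- The Fenchel–Young inequality: the convex conjugate of `klFun` is `exp a - 1`. -/
theorem mul_le_klFun_add_exp (a : ℝ) {h : ℝ} (hh : 0 ≤ h) : a * h ≤ klFun h + Real.exp a := by
  rw [klFun_apply]
  rcases hh.eq_or_lt with rfl | hh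
  · simp; positivity
  · have h1 := Real.add_one_le_exp (a - Real.log h)
    rw [Real.exp_sub, Real.exp_log hh, le_div_iff₀ hh] at h1
    linarith

variable {μ : Measure (EuclideanSpace ℝ (Fin n))} [IsProbabilityMeasure μ]

/-- Finite relative entropy forces a finite second moment of the score. -/
theorem memLp_gV_of_klDiv_ne_top (hL0 : 0 ≤ L) (hgVm : Measurable gV)
    (hL : ∀ x y, ‖gV x - gV y‖ ≤ L * ‖x - y‖) (hπm : Measurable π) (hπi : Integrable π)
    (hπ0 : ∀ x, 0 < π x) (hπ1 : ∫ x, π x = 1)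
    (hπ : ∀ x, HasGradientAt (fun y => Real.log (π y)) (-gV x) x)
    (hkl : klDiv μ (densityMeasure π) ≠ ∞) : MemLp gV 2 μ := by
  have hP := isProbabilityMeasure_densityMeasure (fun x => (hπ0 x).le) hπi hπ1
  have hac := (klDiv_ne_top_iff.1 hkl).1
  have hLD : μ.HaveLebesgueDecomposition (densityMeasure π) :=
    Measure.haveLebesgueDecomposition_of_sigmaFinite _ _
  set a : EuclideanSpace ℝ (Fin n) → ℝ := fun x => ‖gV x‖ ^ 2 / (4 * (L + 1)) with ha
  have ham : Measurable a := (hgVm.norm.pow_const 2).div_const _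
  have ha0 : ∀ x, 0 ≤ a x := fun x => by positivity
  have hexp : ∫⁻ x, ENNReal.ofReal (Real.exp (a x)) ∂densityMeasure π < ∞ := by
    rw [densityMeasure, lintegral_withDensity_eq_lintegral_mul _ hπm.ennreal_ofReal (by fun_prop)]
    refine lt_of_eq_of_lt (lintegral_congr fun x => ?_)
      (lintegral_mul_exp_norm_sq_lt_top hL0 hL hπm hπi hπ0 hπ)
    rw [Pi.mul_apply, ← ENNReal.ofReal_mul (hπ0 x).le]
  -- The entropy inequality: Young's inequality applied to `a` times the relative density bounds the
  -- moment under `μ` by the relative entropy plus the exponential moment under `π`.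
  have hfin : ∫⁻ x, ENNReal.ofReal (a x) ∂μ < ∞ := by
    rw [← lintegral_rnDeriv_mul hac (by fun_prop)]
    calc ∫⁻ x, μ.rnDeriv (densityMeasure π) x * ENNReal.ofReal (a x) ∂densityMeasure π
        ≤ ∫⁻ x, (ENNReal.ofReal (klFun (μ.rnDeriv (densityMeasure π) x).toReal) +
            ENNReal.ofReal (Real.exp (a x))) ∂densityMeasure π := by
          refine lintegral_mono_ae ?_
          filter_upwards [μ.rnDeriv_ne_top (densityMeasure π)] with x hx
          rw [← ENNReal.ofReal_toReal hx, ENNReal.toReal_ofReal ENNReal.toReal_nonneg,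
            ← ENNReal.ofReal_mul ENNReal.toReal_nonneg,
            ← ENNReal.ofReal_add (klFun_nonneg ENNReal.toReal_nonneg) (Real.exp_pos _).le, mul_comm]
          exact ENNReal.ofReal_le_ofReal (mul_le_klFun_add_exp _ ENNReal.toReal_nonneg)
      _ = klDiv μ (densityMeasure π) + ∫⁻ x, ENNReal.ofReal (Real.exp (a x)) ∂densityMeasure π := by
          rw [lintegral_add_right _ (by fun_prop), klDiv_eq_lintegral_klFun_of_ac hac]
      _ < ∞ := ENNReal.add_lt_top.2 ⟨hkl.lt_top, hexp⟩
  have hi : Integrable a μ := by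
    refine ⟨ham.aestronglyMeasurable, ?_⟩
    rwa [hasFiniteIntegral_iff_ofReal (ae_of_all _ ha0)]
  rw [memLp_two_iff_integrable_sq_norm hgVm.aestronglyMeasurable]
  refine (hi.mul_const (4 * (L + 1))).congr (ae_of_all _ fun x => ?_)
  simp only [ha]
  field_simp

/-- A measure absolutely continuous with respect to a density has a density, with smaller
truncated entropy. -/
theorem exists_density_truncKL_le (hπm : Measurable π) (hπi : Integrable π)
    (hπ0 : ∀ x, 0 < π x) (hπ1 : ∫ x, π x = 1) (hkl : klDiv μ (densityMeasure π) ≠ ∞) :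
    ∃ f : EuclideanSpace ℝ (Fin n) → ℝ, Measurable f ∧ (∀ x, 0 ≤ f x) ∧ Integrable f ∧
      ∫ x, f x = 1 ∧ μ = densityMeasure f ∧
      ∀ M, 0 < M → truncKL π M f ≤ klDiv μ (densityMeasure π) := by
  have hP := isProbabilityMeasure_densityMeasure (fun x => (hπ0 x).le) hπi hπ1
  have hac := (klDiv_ne_top_iff.1 hkl).1
  have hLD : μ.HaveLebesgueDecomposition (densityMeasure π) :=
    Measure.haveLebesgueDecomposition_of_sigmaFinite _ _
  set h := μ.rnDeriv (densityMeasure π) with hh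
  have hhm : Measurable h := Measure.measurable_rnDeriv _ _
  have hf0 : ∀ x, 0 ≤ π x * (h x).toReal := fun x =>
    mul_nonneg (hπ0 x).le ENNReal.toReal_nonneg
  have hfm : Measurable fun x => π x * (h x).toReal := hπm.mul hhm.ennreal_toReal
  have hμ : μ = densityMeasure fun x => π x * (h x).toReal := by
    conv_lhs => rw [← Measure.withDensity_rnDeriv_eq _ _ hac]
    rw [withDensity_congr_ae (g := fun x => ENNReal.ofReal (h x).toReal), densityMeasure,
      densityMeasure, ← withDensity_mul _ hπm.ennreal_ofReal hhm.ennreal_toReal.ennreal_ofReal]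
    · congr 1
      ext x
      simp only [Pi.mul_apply, ENNReal.ofReal_mul (hπ0 x).le]
    · filter_upwards [μ.rnDeriv_ne_top (densityMeasure π)] with x hx
      rw [ENNReal.ofReal_toReal hx]
  have h1 : ∫⁻ x, ENNReal.ofReal (π x * (h x).toReal) = 1 := by
    have h2 : μ univ = 1 := measure_univ
    rwa [hμ, densityMeasure, withDensity_apply _ MeasurableSet.univ, Measure.restrict_univ] at h2
  refine ⟨_, hfm, hf0, ⟨hfm.aestronglyMeasurable, ?_⟩, ?_, hμ, fun M hM => ?_⟩
  · rw [hasFiniteIntegral_iff_ofReal (ae_of_all _ hf0), h1]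
    exact ENNReal.one_lt_top
  · rw [integral_eq_lintegral_of_nonneg_ae (ae_of_all _ hf0) hfm.aestronglyMeasurable, h1,
      ENNReal.toReal_one]
  · have hkm : Measurable fun x => ENNReal.ofReal (klFun (h x).toReal) :=
      (measurable_klFun.comp hhm.ennreal_toReal).ennreal_ofReal
    have e : ∫⁻ x, ENNReal.ofReal (klFun (h x).toReal) ∂densityMeasure π =
        ∫⁻ x, ENNReal.ofReal (π x) * ENNReal.ofReal (klFun (h x).toReal) :=
      lintegral_withDensity_eq_lintegral_mul _ hπm.ennreal_ofReal hkm
    rw [klDiv_eq_lintegral_klFun_of_ac hac, e]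
    refine lintegral_mono fun x => ?_
    rw [mul_div_cancel_left₀ _ (hπ0 x).ne', ENNReal.ofReal_mul (hπ0 x).le]
    exact mul_le_mul_right (ENNReal.ofReal_le_ofReal
      (truncEntropy_le_klFun hM ENNReal.toReal_nonneg)) _

end Moments

theorem indepFun_prodMk_of_indepFun {Ω α β δ : Type*} [MeasurableSpace Ω] [MeasurableSpace α]
    [MeasurableSpace β] [MeasurableSpace δ] {P : Measure Ω} [IsProbabilityMeasure P]
    {X : Ω → α} {Y : Ω → β} {Z : Ω → δ} (hX : Measurable X) (hY : Measurable Y) (hZ : Measurable Z)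
    (h : IndepFun X (fun ω => (Y ω, Z ω)) P) (h' : IndepFun Y Z P) :
    IndepFun (fun ω => (X ω, Y ω)) Z P := by
  have h1 : IndepFun X Y P := h.comp measurable_id measurable_fst
  have := Measure.isProbabilityMeasure_map (μ := P) hX.aemeasurable
  have := Measure.isProbabilityMeasure_map (μ := P) hY.aemeasurable
  have := Measure.isProbabilityMeasure_map (μ := P) hZ.aemeasurable
  rw [indepFun_iff_map_prod_eq_prod_map_map (by fun_prop) (by fun_prop)] at h h' h1 ⊢
  rw [h', ← Measure.prodAssoc_prod] at h
  have e := congrArg (Measure.map MeasurableEquiv.prodAssoc.symm) h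
  rw [Measure.map_map (by fun_prop) (by fun_prop), Measure.map_map (by fun_prop) (by fun_prop),
    MeasurableEquiv.symm_comp_self, Measure.map_id] at e
  rw [h1, ← e]
  rfl

/-! ### The laws of the iterates and of their interpolation. -/

section Interpolation

variable {n : ℕ} {Ω : Type*} [MeasurableSpace Ω] {P : Measure Ω} [IsProbabilityMeasure P]

theorem map_euler_step {G : EuclideanSpace ℝ (Fin n) → EuclideanSpace ℝ (Fin n)}
    (hG : Measurable G) {s : ℝ} (hs : 0 < s) {X W : Ω → EuclideanSpace ℝ (Fin n)}
    (hX : Measurable X) (hW : Measurable W) (h : IndepFun X W P) (hWs : P.map W = gauss n s) :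
    P.map (fun ω => X ω - s • G (X ω) + W ω) = densityMeasure (mix (P.map X) G s) := by
  have := Measure.isProbabilityMeasure_map (μ := P) hX.aemeasurable
  rw [← map_snd_joint hG hs, joint, ← hWs,
    ← (indepFun_iff_map_prod_eq_prod_map_map (by fun_prop) (by fun_prop)).1 h,
    Measure.map_map (measurable_eulerMap hG s) (by fun_prop),
    Measure.map_map measurable_snd ((measurable_eulerMap hG s).comp (by fun_prop))]
  rfl

variable {B : ℝ≥0 → Ω → EuclideanSpace ℝ (Fin n)}

theorem IsStdBrownianMotion.map_sqrt_two_smul (hB : IsStdBrownianMotion B P) {r t : ℝ≥0} {s : ℝ}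
    (hs : 0 < s) (hst : (t : ℝ) - r = s) :
    P.map (fun ω => √2 • (B t ω - B r ω)) = gauss n s := by
  have hm := hB.measurable
  have hrt : r ≤ t := by
    rw [← NNReal.coe_le_coe]; linarith
  have e : (fun ω => √2 • (B t ω - B r ω)) = (fun z => √2 • z) ∘ fun ω => B t ω - B r ω := rfl
  rw [e, ← Measure.map_map (by fun_prop) (by fun_prop), hB.law_increment r t hrt,
    Measure.map_map (by fun_prop) (by fun_prop), ← stdGaussian_map_smul hs]
  congr 1
  ext1 z
  rw [Function.comp_apply, smul_smul, hst, Real.sqrt_mul (by norm_num)]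

variable {γ : ℝ} {N : ℕ} {G : ℕ → EuclideanSpace ℝ (Fin n) → EuclideanSpace ℝ (Fin n)}
  {X₀ : Ω → EuclideanSpace ℝ (Fin n)}

theorem measurable_iterate (hB : IsStdBrownianMotion B P) (hG : ∀ k < N, Measurable (G k))
    (hX₀ : Measurable X₀) {k : ℕ} (hk : k ≤ N) : Measurable (iterate γ G X₀ B k) := by
  have hm := hB.measurable
  induction k with
  | zero => exact hX₀
  | succ k ih =>
    have hi := ih (Nat.le_of_succ_le hk)
    have hk' := (hG k hk).comp hi
    exact (hi.sub (hk'.const_smul γ)).add (((hm _).sub (hm _)).const_smul √2)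

/-- The first iterates are functions of the initial point and of the past increments. -/
theorem exists_iterate_eq (hG : ∀ k < N, Measurable (G k)) {k : ℕ} (hk : k ≤ N)
    {τ : ℕ → ℝ≥0}
    (hτ : ∀ j ≤ k, τ j = ((j : ℝ) * γ).toNNReal) (m : ℕ) (hm : m ≤ k) :
    ∃ Φ : EuclideanSpace ℝ (Fin n) × (Finset.range k → EuclideanSpace ℝ (Fin n)) →
        EuclideanSpace ℝ (Fin n), Measurable Φ ∧
      ∀ ω, iterate γ G X₀ B m ω = Φ (X₀ ω, fun i => B (τ (i + 1)) ω - B (τ i) ω) := by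
  induction m with
  | zero => exact ⟨Prod.fst, measurable_fst, fun ω => rfl⟩
  | succ m ih =>
    obtain ⟨Φ, hΦ, h⟩ := ih (by omega)
    refine ⟨fun p => Φ p - γ • G m (Φ p) + √2 • p.2 ⟨m, Finset.mem_range.2 hm⟩, ?_, fun ω => ?_⟩
    · have h1 := (hG m (by omega)).comp hΦ
      have h2 : Measurable fun p : EuclideanSpace ℝ (Fin n) ×
          (Finset.range k → EuclideanSpace ℝ (Fin n)) => p.2 ⟨m, Finset.mem_range.2 hm⟩ := by
        fun_prop
      exact (hΦ.sub (h1.const_smul γ)).add (h2.const_smul √2)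
    · simp only [← h ω, hτ (m + 1) hm, hτ m (by omega)]
      rw [iterate]
      push_cast
      rfl

/-- The `k`-th iterate depends on the start and the increments up to `kγ`. The next increment is
independent of these jointly: of the past increments by Brownian independence, and of the start
because the start is independent of the whole path. -/
theorem indepFun_iterate_increment (hB : IsStdBrownianMotion B P) (hG : ∀ k < N, Measurable (G k))
    (hX₀ : Measurable X₀) (hX₀B : IndepFun X₀ (fun ω t => B t ω) P) (hγ : 0 ≤ γ)
    {k : ℕ} (hk : k ≤ N)
    {t : ℝ} (ht : k * γ ≤ t) :
    IndepFun (iterate γ G X₀ B k)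
      (fun ω => B t.toNNReal ω - B ((k : ℝ) * γ).toNNReal ω) P := by
  have hm := hB.measurable
  -- The grid up to `kγ`, frozen at `t` afterwards; its `k`-th increment is `B_t - B_{kγ}`.
  set τ : ℕ → ℝ≥0 := fun j => if j ≤ k then ((j : ℝ) * γ).toNNReal else t.toNNReal with hτdef
  have hτ : ∀ j ≤ k, τ j = ((j : ℝ) * γ).toNNReal := fun j hj => if_pos hj
  have hτ' : τ (k + 1) = t.toNNReal := if_neg (by omega)
  have hmono : Monotone τ := by
    intro i j hij
    simp only [hτdef]
    split_ifs with h1 h2 h2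
    · exact Real.toNNReal_mono (mul_le_mul_of_nonneg_right (by exact_mod_cast hij) hγ)
    · exact Real.toNNReal_mono ((mul_le_mul_of_nonneg_right (by exact_mod_cast h1) hγ).trans ht)
    · omega
    · rfl
  obtain ⟨Φ, hΦ, h⟩ := exists_iterate_eq (X₀ := X₀) (B := B) hG hk hτ k le_rfl
  set d : ℕ → Ω → EuclideanSpace ℝ (Fin n) := fun i ω => B (τ (i + 1)) ω - B (τ i) ω with hd
  have hdm : ∀ i, Measurable (d i) := fun i => (hm _).sub (hm _)
  have hind : iIndepFun d P := hB.indep_increments.nat hmono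
  have h1 : IndepFun (fun ω (i : Finset.range k) => d i ω) (d k) P :=
    (hind.indepFun_finset (Finset.range k) {k} (by simp) hdm).comp measurable_id
      (measurable_pi_apply (⟨k, Finset.mem_singleton_self k⟩ : ({k} : Finset ℕ)))
  have h2 : IndepFun X₀ (fun ω => ((fun i : Finset.range k => d i ω), d k ω)) P :=
    hX₀B.comp measurable_id (ψ := fun b : ℝ≥0 → EuclideanSpace ℝ (Fin n) =>
      ((fun i : Finset.range k => b (τ (i + 1)) - b (τ i)), b (τ (k + 1)) - b (τ k))) (by fun_prop)
  have h3 := (indepFun_prodMk_of_indepFun hX₀ (Y := fun ω (i : Finset.range k) => d i ω)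
    (measurable_pi_lambda _ fun i => hdm i) (hdm k) h2 h1).comp hΦ measurable_id
  have e1 : iterate γ G X₀ B k = Φ ∘ fun ω => (X₀ ω, fun i : Finset.range k => d i ω) := by
    ext1 ω
    exact h ω
  have e2 : (fun ω => B t.toNNReal ω - B ((k : ℝ) * γ).toNNReal ω) = id ∘ d k := by
    ext1 ω
    simp only [hd, Function.comp_apply, id_eq, hτ', hτ k le_rfl]
  rw [e1, e2]
  exact h3

theorem map_iterate_step (hB : IsStdBrownianMotion B P) (hG : ∀ k < N, Measurable (G k))
    (hX₀ : Measurable X₀) (hX₀B : IndepFun X₀ (fun ω t => B t ω) P) (hγ : 0 ≤ γ)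
    {k : ℕ} (hk : k < N)
    {s : ℝ} (hs : 0 < s) :
    P.map (fun ω => iterate γ G X₀ B k ω - s • G k (iterate γ G X₀ B k ω) +
        √2 • (B (k * γ + s).toNNReal ω - B ((k : ℝ) * γ).toNNReal ω)) =
      densityMeasure (mix (P.map (iterate γ G X₀ B k)) (G k) s) := by
  have hm := hB.measurable
  refine map_euler_step (hG k hk) hs (measurable_iterate hB hG hX₀ hk.le) (by fun_prop)
    ((indepFun_iterate_increment hB hG hX₀ hX₀B hγ hk.le (t := k * γ + s) (by linarith)).comp
      measurable_id (measurable_const_smul √2)) (hB.map_sqrt_two_smul hs ?_)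
  have : 0 ≤ (k : ℝ) * γ := by positivity
  rw [Real.coe_toNNReal _ (by positivity), Real.coe_toNNReal _ this]
  ring

theorem map_iterate_succ (hB : IsStdBrownianMotion B P) (hG : ∀ k < N, Measurable (G k))
    (hX₀ : Measurable X₀) (hX₀B : IndepFun X₀ (fun ω t => B t ω) P) (hγ : 0 < γ)
    {k : ℕ} (hk : k < N) :
    P.map (iterate γ G X₀ B (k + 1)) =
      densityMeasure (mix (P.map (iterate γ G X₀ B k)) (G k) γ) := by
  rw [← map_iterate_step hB hG hX₀ hX₀B hγ.le hk hγ]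
  congr 1
  ext1 ω
  rw [iterate, add_one_mul]

/-- Only interior times are covered: at `s = 0` there is no noise yet, and at `s = γ` the floor has
moved on to `k + 1`. The excluded times form a null set. -/
theorem map_interpolation (hB : IsStdBrownianMotion B P) (hG : ∀ k < N, Measurable (G k))
    (hX₀ : Measurable X₀) (hX₀B : IndepFun X₀ (fun ω t => B t ω) P) (hγ : 0 < γ)
    {k : ℕ} (hk : k < N)
    {s : ℝ} (hs : s ∈ Ioo 0 γ) :
    P.map (interpolation γ G X₀ B (k * γ + s)) =
      densityMeasure (mix (P.map (iterate γ G X₀ B k)) (G k) s) := by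
  have hfl : ⌊(k * γ + s) / γ⌋₊ = k := by
    have := hs.1
    rw [Nat.floor_eq_iff (by positivity), le_div_iff₀ hγ, div_lt_iff₀ hγ]
    constructor <;> nlinarith [hs.1, hs.2]
  rw [← map_iterate_step hB hG hX₀ hX₀B hγ.le hk hs.1]
  congr 1
  ext1 ω
  rw [interpolation, hfl, add_sub_cancel_left]

theorem interpolation_zero : interpolation γ G X₀ B 0 = X₀ := by
  ext1 ω
  simp [interpolation, iterate]

end Interpolation

/-! ### The relative Fisher information of a mixture and its integral over the steps. -/

section FisherInformation

variable {n : ℕ} {μ : Measure (EuclideanSpace ℝ (Fin n))} [IsProbabilityMeasure μ]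
  {G gV : EuclideanSpace ℝ (Fin n) → EuclideanSpace ℝ (Fin n)} {s : ℝ}
  {π : EuclideanSpace ℝ (Fin n) → ℝ}

theorem relFisherInfo_densityMeasure_mix (hG : Measurable G) (hgVm : Measurable gV) (hs : 0 < s)
    (hπ0 : ∀ x, 0 < π x) (hπ : ∀ x, HasGradientAt (fun y => Real.log (π y)) (-gV x) x) :
    relFisherInfo (densityMeasure (mix μ G s)) π = mixFisher μ G gV s := by
  have hP : IsProbabilityMeasure (densityMeasure (mix μ G s)) := by
    have := isProbabilityMeasure_joint (μ := μ) hG hs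
    rw [← map_snd_joint hG hs]
    exact Measure.isProbabilityMeasure_map measurable_snd.aemeasurable
  rw [relFisherInfo_eq (q := mix μ G s) ⟨mix_pos hG hs,
    fun x => (hasGradientAt_mix hG hs x).differentiableAt, rfl⟩]
  simp_rw [(hasGradientAt_log_mix_div hG hs hπ0 hπ _).gradient]
  have hm := (measurable_relScore_right (μ := μ) hG hgVm s).enorm.pow_const 2
  refine (lintegral_withDensity_eq_lintegral_mul _
    (measurable_mix_right hG s).ennreal_ofReal hm).trans (lintegral_congr fun x => ?_)
  rw [Pi.mul_apply, ENNReal.ofReal_mul (mix_pos hG hs x).le, ENNReal.ofReal_pow (norm_nonneg _),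
    ofReal_norm]

end FisherInformation

theorem integral_eq_one_of_densityMeasure {n : ℕ} {f : EuclideanSpace ℝ (Fin n) → ℝ}
    (hfm : Measurable f) (hf0 : ∀ x, 0 ≤ f x) [IsProbabilityMeasure (densityMeasure f)] :
    ∫ x, f x = 1 := by
  have h1 : ∫⁻ x, ENNReal.ofReal (f x) = 1 := by
    have h2 : densityMeasure f univ = 1 := measure_univ
    rwa [densityMeasure, withDensity_apply _ MeasurableSet.univ, Measure.restrict_univ] at h2
  rw [integral_eq_lintegral_of_nonneg_ae (ae_of_all _ hf0) hfm.aestronglyMeasurable, h1,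
    ENNReal.toReal_one]

theorem lintegral_Ioc_mul_eq_sum {φ : ℝ → ℝ≥0∞} {F : ℕ → ℝ → ℝ≥0∞} {γ : ℝ} (hγ : 0 < γ) {N : ℕ}
    (hF : ∀ k < N, Measurable (F k)) (h : ∀ k < N, ∀ s ∈ Ioo 0 γ, φ (k * γ + s) = F k s) :
    AEMeasurable φ (volume.restrict (Ioc 0 (N * γ))) ∧
      ∫⁻ t in Ioc 0 (N * γ), φ t = ∑ k ∈ Finset.range N, ∫⁻ s in Ioc 0 γ, F k s := by
  induction N with
  | zero => simp
  | succ N ih =>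
    obtain ⟨h1, h2⟩ := ih (fun k hk => hF k (by omega)) fun k hk => h k (by omega)
    have hU : Ioc 0 (((N + 1 : ℕ) : ℝ) * γ) = Ioc 0 (N * γ) ∪ Ioc (N * γ) (N * γ + γ) := by
      rw [Ioc_union_Ioc_eq_Ioc (by positivity) (by linarith)]
      push_cast
      rw [add_one_mul]
    have hae : φ =ᵐ[volume.restrict (Ioc (N * γ) (N * γ + γ))] fun t => F N (t - N * γ) := by
      rw [← Measure.restrict_congr_set Ioo_ae_eq_Ioc]
      filter_upwards [ae_restrict_mem measurableSet_Ioo] with t ht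
      rw [← h N (by omega) (t - N * γ) ⟨by linarith [ht.1], by linarith [ht.2]⟩,
        add_sub_cancel]
    have hm : Measurable fun t => F N (t - N * γ) :=
      (hF N (by omega)).comp (measurable_id.sub_const _)
    have e : ∫⁻ t in Ioc (N * γ) (N * γ + γ), F N (t - N * γ) = ∫⁻ s in Ioc 0 γ, F N s := by
      have := (measurePreserving_sub_right volume (N * γ)).setLIntegral_comp_preimage
        (measurableSet_Ioc (a := (0 : ℝ)) (b := γ)) (hF N (by omega))
      rw [← this, preimage_sub_const_Ioc, zero_add, add_comm γ]
    rw [hU]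
    refine ⟨aemeasurable_union_iff.2 ⟨h1, hm.aemeasurable.congr hae.symm⟩, ?_⟩
    rw [lintegral_union measurableSet_Ioc (Ioc_disjoint_Ioc_of_le le_rfl), h2,
      Finset.sum_range_succ, lintegral_congr_ae hae, e]

/-! ### Summation over the steps. -/

section Chain

variable {n : ℕ} {μ : ℕ → Measure (EuclideanSpace ℝ (Fin n))} [∀ k, IsProbabilityMeasure (μ k)]
  {G : ℕ → EuclideanSpace ℝ (Fin n) → EuclideanSpace ℝ (Fin n)}
  {gV : EuclideanSpace ℝ (Fin n) → EuclideanSpace ℝ (Fin n)}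
  {π : EuclideanSpace ℝ (Fin n) → ℝ} {L γ : ℝ} {e : ℕ → ℝ} {N : ℕ}

theorem memLp_of_memLp_gV {ν : Measure (EuclideanSpace ℝ (Fin n))} [IsFiniteMeasure ν]
    {H : EuclideanSpace ℝ (Fin n) → EuclideanSpace ℝ (Fin n)} {c : ℝ} (hH : Measurable H)
    (hgVm : Measurable gV) (hc : ∀ y, ‖H y - gV y‖ ≤ c) (h : MemLp gV 2 ν) : MemLp H 2 ν := by
  have h1 : MemLp (fun y => H y - gV y) 2 ν :=
    MemLp.of_bound (hH.sub hgVm).aestronglyMeasurable c (ae_of_all _ hc)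
  convert h1.add h using 1
  ext1 y
  simp

theorem memLp_gV_chain (hγ : 0 < γ) (hG : ∀ k < N, Measurable (G k))
    (hL0 : 0 ≤ L) (hgVm : Measurable gV) (hL : ∀ x y, ‖gV x - gV y‖ ≤ L * ‖x - y‖)
    (he : ∀ k < N, ∀ y, ‖G k y - gV y‖ ≤ e k)
    (hμ : ∀ k < N, μ (k + 1) = densityMeasure (mix (μ k) (G k) γ)) (h0 : MemLp gV 2 (μ 0)) :
    ∀ k ≤ N, MemLp gV 2 (μ k) := by
  intro k
  induction k with
  | zero => exact fun _ => h0
  | succ k ih =>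
    intro hk
    have h1 := memLp_gV_joint (hG k hk)
      (memLp_of_memLp_gV (hG k hk) hgVm (he k hk) (ih (by omega))) hγ hL0 hgVm hL (he k hk)
    rw [hμ k hk, ← map_snd_joint (hG k hk) hγ]
    exact (memLp_map_measure_iff hgVm.aestronglyMeasurable measurable_snd.aemeasurable).2 h1

/-- Decay of the truncated relative entropy along a chain of Euler steps. -/
theorem sum_dissipation_le (hγ : 0 < γ) (hG : ∀ k < N, Measurable (G k))
    (hL0 : 0 ≤ L) (hgVc : Continuous gV) (hL : ∀ x y, ‖gV x - gV y‖ ≤ L * ‖x - y‖)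
    (he : ∀ k < N, ∀ y, ‖G k y - gV y‖ ≤ e k) (hπm : Measurable π) (hπi : Integrable π)
    (hπ0 : ∀ x, 0 < π x) (hπ1 : ∫ x, π x = 1)
    (hπ : ∀ x, HasGradientAt (fun y => Real.log (π y)) (-gV x) x)
    (hμ : ∀ k < N, μ (k + 1) = densityMeasure (mix (μ k) (G k) γ))
    (hkl : klDiv (μ 0) (densityMeasure π) ≠ ∞) {M : ℝ} (hM : 0 < M) :
    ENNReal.ofReal (3 / 4) *
        ∑ k ∈ Finset.range N, ∫⁻ s in Ioc 0 γ, dissipation (μ k) (G k) gV π M s ≤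
      klDiv (μ 0) (densityMeasure π) +
        ∑ k ∈ Finset.range N, ∫⁻ s in Ioc 0 γ, driftError (μ k) (G k) gV s := by
  have hgV := memLp_gV_chain hγ hG hL0 hgVc.measurable hL he hμ
    (memLp_gV_of_klDiv_ne_top hL0 hgVc.measurable hL hπm hπi hπ0 hπ1 hπ hkl)
  obtain ⟨f₀, hf₀m, hf₀0, hf₀i, hf₀1, hf₀μ, hf₀kl⟩ :=
    exists_density_truncKL_le hπm hπi hπ0 hπ1 hkl
  -- The initial density comes from absolute continuity with respect to `π`; every later one is a
  -- Gaussian mixture.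
  set f : ℕ → EuclideanSpace ℝ (Fin n) → ℝ := fun k =>
    Nat.casesOn k f₀ fun k => mix (μ k) (G k) γ with hf
  have hfs : ∀ k, f (k + 1) = mix (μ k) (G k) γ := fun k => rfl
  have hprop : ∀ k ≤ N, Measurable (f k) ∧ (∀ x, 0 ≤ f k x) ∧ Integrable (f k) ∧
      ∫ x, f k x = 1 ∧ μ k = densityMeasure (f k) := by
    intro k hk
    cases k with
    | zero => exact ⟨hf₀m, hf₀0, hf₀i, hf₀1, hf₀μ⟩
    | succ k =>
      rw [hfs]
      have hm := measurable_mix_right (μ := μ k) (hG k hk) γ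
      have h0 : ∀ x, 0 ≤ mix (μ k) (G k) γ x := fun x => (mix_pos (hG k hk) hγ x).le
      have : IsProbabilityMeasure (densityMeasure (mix (μ k) (G k) γ)) := by
        rw [← hμ k hk]; infer_instance
      exact ⟨hm, h0, integrable_mix (hG k hk) hγ, integral_eq_one_of_densityMeasure hm h0, hμ k hk⟩
  have key : ∀ m ≤ N, ENNReal.ofReal (3 / 4) *
        (∑ k ∈ Finset.range m, ∫⁻ s in Ioc 0 γ, dissipation (μ k) (G k) gV π M s) +
          truncKL π M (f m) ≤
      truncKL π M (f 0) +
        ∑ k ∈ Finset.range m, ∫⁻ s in Ioc 0 γ, driftError (μ k) (G k) gV s := by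
    intro m
    induction m with
    | zero => simp
    | succ m ih =>
      intro hm
      obtain ⟨h1, h2, h3, h4, h5⟩ := hprop m (by omega)
      have hG2 : MemLp (G m) 2 (densityMeasure (f m)) := by
        rw [← h5]
        exact memLp_of_memLp_gV (hG m hm) hgVc.measurable (he m hm) (hgV m (by omega))
      have hstep := truncKL_decay h1 h2 h3 h4 (hG m hm) hG2 hL0 hgVc hL (he m hm) hπm hπi hπ0 hπ
        hM hγ
      rw [← h5, ← hfs] at hstep
      rw [Finset.sum_range_succ, Finset.sum_range_succ, mul_add, add_assoc]
      refine (add_le_add_right hstep _).trans ?_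
      rw [← add_assoc, ← add_assoc]
      exact add_le_add_left (ih (by omega)) _
  -- The final entropy is dropped; the initial truncated entropy is at most the true one, uniformly
  -- in `M`.
  exact le_self_add.trans ((key N le_rfl).trans (add_le_add_left (hf₀kl M hM) _))

/-- Bound on the accumulated relative Fisher information along a chain of Euler steps. -/
theorem sum_mixFisher_le (hγ : 0 < γ) (hG : ∀ k < N, Measurable (G k))
    (hL0 : 0 ≤ L) (hgVc : Continuous gV) (hL : ∀ x y, ‖gV x - gV y‖ ≤ L * ‖x - y‖)
    (hγL : γ * L ≤ 1 / √32)
    (he : ∀ k < N, ∀ y, ‖G k y - gV y‖ ≤ e k) (hπm : Measurable π) (hπi : Integrable π)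
    (hπ0 : ∀ x, 0 < π x) (hπ1 : ∫ x, π x = 1)
    (hπ : ∀ x, HasGradientAt (fun y => Real.log (π y)) (-gV x) x)
    (hμ : ∀ k < N, μ (k + 1) = densityMeasure (mix (μ k) (G k) γ))
    (hkl : klDiv (μ 0) (densityMeasure π) ≠ ∞) :
    ∑ k ∈ Finset.range N, ∫⁻ s in Ioc 0 γ, mixFisher (μ k) (G k) gV s ≤
      2 * klDiv (μ 0) (densityMeasure π) +
        ENNReal.ofReal (∑ k ∈ Finset.range N, γ * (24 * n * L ^ 2 * γ + 12 * e k ^ 2)) := by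
  have hgV := memLp_gV_chain hγ hG hL0 hgVc.measurable hL he hμ
    (memLp_gV_of_klDiv_ne_top hL0 hgVc.measurable hL hπm hπi hπ0 hπ1 hπ hkl)
  have hG2 : ∀ k < N, MemLp (G k) 2 (μ k) := fun k hk =>
    memLp_of_memLp_gV (hG k hk) hgVc.measurable (he k hk) (hgV k hk.le)
  set D := ∑ k ∈ Finset.range N, ∫⁻ s in Ioc 0 γ, driftError (μ k) (G k) gV s with hD
  set F := ∑ k ∈ Finset.range N, ∫⁻ s in Ioc 0 γ, mixFisher (μ k) (G k) gV s with hF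
  have h1 : ENNReal.ofReal (3 / 4) * F ≤ klDiv (μ 0) (densityMeasure π) + D := by
    have ht : Tendsto (fun m : ℕ => ENNReal.ofReal (3 / 4) * ∑ k ∈ Finset.range N,
        ∫⁻ s in Ioc 0 γ, dissipation (μ k) (G k) gV π (m + 1) s) atTop
        (𝓝 (ENNReal.ofReal (3 / 4) * F)) :=
      ENNReal.Tendsto.const_mul (tendsto_finsetSum _ fun k hk => tendsto_lintegral_dissipation
        (hG k (Finset.mem_range.1 hk)) hgVc.measurable hπm γ) (Or.inr ENNReal.ofReal_ne_top)
    exact le_of_tendsto' ht fun m =>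
      sum_dissipation_le hγ hG hL0 hgVc hL he hπm hπi hπ0 hπ1 hπ hμ hkl (by positivity)
  have hDtop : D ≠ ∞ := by
    refine ENNReal.sum_ne_top.2 fun k hk => ne_top_of_le_ne_top ?_
      (setLIntegral_mono' measurableSet_Ioc fun s hs =>
        driftError_le_const (hG k (Finset.mem_range.1 hk)) (hG2 k (Finset.mem_range.1 hk)) hs.1 hL0
          hgVc hL (he k (Finset.mem_range.1 hk)) hs.2)
    rw [setLIntegral_const]
    exact ENNReal.mul_ne_top ENNReal.ofReal_ne_top (by simp)
  -- Finiteness is needed to cancel `F/4` from both sides; it follows from the crude bound on the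
  -- drift error.
  have hFtop : F ≠ ∞ := by
    intro h
    rw [h, ENNReal.mul_top (by simp)] at h1
    exact (ENNReal.add_lt_top.2 ⟨hkl.lt_top, hDtop.lt_top⟩).not_ge h1
  have h2 : D ≤ ENNReal.ofReal (1 / 4) * F + ENNReal.ofReal
      (∑ k ∈ Finset.range N, γ * (12 * n * L ^ 2 * γ + 6 * e k ^ 2)) := by
    rw [hD, hF, Finset.mul_sum, ENNReal.ofReal_sum_of_nonneg (fun k _ => by positivity),
      ← Finset.sum_add_distrib]
    refine Finset.sum_le_sum fun k hk => ?_
    rw [Finset.mem_range] at hk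
    refine (setLIntegral_mono' measurableSet_Ioc fun s hs => driftError_le (hG k hk) (hG2 k hk)
      hs.1 hL0 hgVc hL (he k hk) hs.2 hγL).trans_eq ?_
    rw [lintegral_add_right _ measurable_const,
      lintegral_const_mul _ (measurable_mixFisher (hG k hk) hgVc.measurable), setLIntegral_const,
      Real.volume_Ioc, sub_zero, ← ENNReal.ofReal_mul' hγ.le, mul_comm γ]
  have e2 : ∑ k ∈ Finset.range N, γ * (24 * n * L ^ 2 * γ + 12 * e k ^ 2) =
      2 * ∑ k ∈ Finset.range N, γ * (12 * n * L ^ 2 * γ + 6 * e k ^ 2) := by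
    rw [Finset.mul_sum]
    exact Finset.sum_congr rfl fun k _ => by ring
  have hc0 : 0 ≤ ∑ k ∈ Finset.range N, γ * (12 * n * L ^ 2 * γ + 6 * e k ^ 2) :=
    Finset.sum_nonneg fun k _ => by positivity
  rw [e2]
  set c := ∑ k ∈ Finset.range N, γ * (12 * n * L ^ 2 * γ + 6 * e k ^ 2)
  have h3 := h1.trans (add_le_add_right h2 _)
  generalize klDiv (μ 0) (densityMeasure π) = Q at *
  clear_value F c
  lift F to ℝ≥0 using hFtop
  lift Q to ℝ≥0 using hkl
  rw [ENNReal.ofReal_mul (by norm_num)]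
  lift c to ℝ≥0 using hc0
  rw [ENNReal.ofReal, ENNReal.ofReal, ENNReal.ofReal_coe_nnreal] at h3
  rw [ENNReal.ofReal_coe_nnreal, ENNReal.ofReal_ofNat]
  -- All quantities are finite, so `(3/4) F ≤ Q + F/4 + c` gives `F ≤ 2Q + 2c`.
  have h4 : (3 / 4 : ℝ).toNNReal * F ≤ Q + ((1 / 4 : ℝ).toNNReal * F + c) := by exact_mod_cast h3
  have h5 : F ≤ 2 * Q + 2 * c := by
    rw [← NNReal.coe_le_coe] at h4 ⊢
    push_cast at h4 ⊢
    rw [Real.coe_toNNReal _ (by norm_num), Real.coe_toNNReal _ (by norm_num)] at h4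
    linarith
  calc (F : ℝ≥0∞) ≤ ((2 * Q + 2 * c : ℝ≥0) : ℝ≥0∞) := ENNReal.coe_le_coe.2 h5
    _ = 2 * Q + 2 * c := by push_cast; rfl

end Chain

/-! ### The score of the posterior and the drift of the algorithm. -/

section Posterior

variable {n : ℕ} {ℓ p q : EuclideanSpace ℝ (Fin n) → ℝ}

theorem hasGradientAt_log_score (hq : Differentiable ℝ fun x => Real.log (q x))
    (x : EuclideanSpace ℝ (Fin n)) : HasGradientAt (fun y => Real.log (q y)) (score q x) x :=
  (hq x).hasGradientAt

theorem continuous_of_differentiable_log (hq : Differentiable ℝ fun x => Real.log (q x))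
    (hq0 : ∀ x, 0 < q x) : Continuous q :=
  (Real.continuous_exp.comp hq.continuous).congr fun x => Real.exp_log (hq0 x)

theorem continuous_of_norm_sub_le {F : EuclideanSpace ℝ (Fin n) → EuclideanSpace ℝ (Fin n)} {L : ℝ}
    (h : ∀ x y, ‖F x - F y‖ ≤ L * ‖x - y‖) : Continuous F :=
  (LipschitzWith.of_dist_le' (K := L) fun x y => by
    simpa only [dist_eq_norm] using h x y).continuous

theorem integral_mul_pos (hℓ : ∀ x, 0 < ℓ x) (hp : ∀ x, 0 < p x)
    (h : Integrable fun x => ℓ x * p x) : 0 < ∫ x, ℓ x * p x := by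
  rw [integral_pos_iff_support_of_nonneg (fun x => (mul_pos (hℓ x) (hp x)).le) h]
  have e : Function.support (fun x => ℓ x * p x) = univ :=
    eq_univ_of_forall fun x => (mul_pos (hℓ x) (hp x)).ne'
  rw [e]
  exact Measure.measure_univ_pos.2 (NeZero.ne _)

theorem hasGradientAt_log_posteriorDensity (hℓ : ∀ x, 0 < ℓ x) (hp : ∀ x, 0 < p x)
    (h : Integrable fun x => ℓ x * p x) (hℓd : Differentiable ℝ fun x => Real.log (ℓ x))
    (hpd : Differentiable ℝ fun x => Real.log (p x)) (x : EuclideanSpace ℝ (Fin n)) :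
    HasGradientAt (fun y => Real.log (posteriorDensity ℓ p y)) (score ℓ x + score p x) x := by
  have hZ := integral_mul_pos hℓ hp h
  have e : (fun y => Real.log (posteriorDensity ℓ p y)) =
      fun y => Real.log (ℓ y) + Real.log (p y) - Real.log (∫ z, ℓ z * p z) := by
    ext1 y
    rw [posteriorDensity, Real.log_div (mul_pos (hℓ y) (hp y)).ne' hZ.ne',
      Real.log_mul (hℓ y).ne' (hp y).ne']
  rw [e, hasGradientAt_iff_hasFDerivAt, map_add]
  exact ((hasGradientAt_log_score hℓd x).hasFDerivAt.add
    (hasGradientAt_log_score hpd x).hasFDerivAt).sub_const _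

theorem drift_eq (hℓd : Differentiable ℝ fun x => Real.log (ℓ x))
    (S : EuclideanSpace ℝ (Fin n) → ℝ → EuclideanSpace ℝ (Fin n)) (α σ : ℕ → ℝ) (k : ℕ)
    (x : EuclideanSpace ℝ (Fin n)) :
    drift ℓ S α σ k x = -score ℓ x - α k • S x (σ k) := by
  have h : HasGradientAt (fun y => -Real.log (ℓ y)) (-score ℓ x) x := by
    rw [hasGradientAt_iff_hasFDerivAt, map_neg]
    exact (hasGradientAt_log_score hℓd x).hasFDerivAt.neg
  rw [drift, h.gradient]

end Posterior

end PMC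

/-! ### The main theorem: constants and assembly. -/

theorem theorem3 {n : ℕ}
    -- the likelihood `x ↦ ℓ(y | x)` at the observed measurement, and the prior density
    (ℓ p : EuclideanSpace ℝ (Fin n) → ℝ)
    (hℓ_pos : ∀ x, 0 < ℓ x) (hp_pos : ∀ x, 0 < p x)
    (hp_int : Integrable p) (hp_one : ∫ x, p x = 1)
    -- the posterior exists
    (hπ_int : Integrable fun x => ℓ x * p x)
    -- the log-likelihood has a Lipschitz continuous gradient
    (Lg : ℝ) (hLg : 0 < Lg) (hℓ_diff : Differentiable ℝ fun x => Real.log (ℓ x))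
    (hℓ_lip : ∀ x₁ x₂, ‖PMC.score ℓ x₁ - PMC.score ℓ x₂‖ ≤ Lg * ‖x₁ - x₂‖)
    -- the log-prior has a Lipschitz continuous gradient
    (Lp : ℝ) (hLp : 0 < Lp) (hp_diff : Differentiable ℝ fun x => Real.log (p x))
    (hp_lip : ∀ x₁ x₂, ‖PMC.score p x₁ - PMC.score p x₂‖ ≤ Lp * ‖x₁ - x₂‖)
    -- the score network, with its Lipschitz constants and its approximation errors
    (S : EuclideanSpace ℝ (Fin n) → ℝ → EuclideanSpace ℝ (Fin n))
    (LS : ℝ → ℝ) (hLS : ∀ s, 0 < s → 0 < LS s)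
    (hS_lip : ∀ s, 0 < s → ∀ x₁ x₂, ‖S x₁ s - S x₂ s‖ ≤ LS s * ‖x₁ - x₂‖)
    (ε : ℝ → ℝ)
    (hS_err : ∀ s, 0 < s → ∀ x, ‖S x s - PMC.score (PMC.smoothedPrior p s) x‖ ≤ ε s)
    -- the score mismatch
    (C : ℝ)
    (hC : ∀ s, 0 < s → ∀ x, ‖PMC.score (PMC.smoothedPrior p s) x - PMC.score p x‖ ≤ s * C)
    -- the output of the score network is bounded
    (Rs : ℝ) (hRs : ∀ s, 0 < s → ∀ x, ‖S x s‖ ≤ Rs)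
    -- the annealing schedules
    (N K : ℕ) (hKN : K < N) (α σ : ℕ → ℝ)
    (hα_anti : AntitoneOn α (Set.Iio N)) (hα_one : ∀ k, K ≤ k → k < N → α k = 1)
    (hσ_anti : AntitoneOn σ (Set.Iio N)) (hσ_pos : ∀ k, k < N → 0 < σ k)
    -- the step size
    (γ : ℝ) (hγ : 0 < γ)
    (Lmax : ℝ) (hLmax : Lmax = ⨆ k : Fin N, (Lg + max (α k * LS (σ k)) Lp))
    (hγL : γ * Lmax ≤ 1 / √32)
    -- the initial point and the driving Brownian motion
    {Ω : Type*} [MeasurableSpace Ω] (P : Measure Ω) [IsProbabilityMeasure P]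
    (B : ℝ≥0 → Ω → EuclideanSpace ℝ (Fin n)) (hB : PMC.IsStdBrownianMotion B P)
    (X₀ : Ω → EuclideanSpace ℝ (Fin n)) (hX₀ : Measurable X₀)
    (hX₀B : IndepFun X₀ (fun ω t => B t ω) P)
    -- the laws of the continuous interpolation
    (ν : ℝ → Measure (EuclideanSpace ℝ (Fin n)))
    (hν : ∀ t, ν t = P.map (PMC.interpolation γ (PMC.drift ℓ S α σ) X₀ B t)) :
    AEMeasurable (fun t => PMC.relFisherInfo (ν t) (PMC.posteriorDensity ℓ p))
        (volume.restrict (Set.Icc 0 (N * γ))) ∧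
    (∫⁻ t in Set.Icc 0 (N * γ), PMC.relFisherInfo (ν t) (PMC.posteriorDensity ℓ p))
          / ENNReal.ofReal (N * γ)
      ≤ (4 * klDiv (ν 0) (PMC.densityMeasure (PMC.posteriorDensity ℓ p))
            + ENNReal.ofReal
                (γ * (36 * ∑ k ∈ Finset.range K, (α k - 1) ^ 2 * Rs ^ 2)))
          / ENNReal.ofReal (N * γ)
        + ENNReal.ofReal (24 * n * Lmax ^ 2 * γ)
        + ENNReal.ofReal (36 * C ^ 2 * (1 / N * ∑ k ∈ Finset.range N, σ k ^ 2))
        + ENNReal.ofReal (36 * (1 / N * ∑ k ∈ Finset.range N, ε (σ k) ^ 2)) := by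
  have hγL0 : 0 ≤ Lg + Lp := by positivity
  -- The argument uses only the Lipschitz constant of `gV`; `Lmax` enters as an upper bound for it,
  -- and any index below `N` would do in place of `K`.
  have hLle : Lg + Lp ≤ Lmax := by
    rw [hLmax]
    refine le_trans ?_ (le_ciSup (Finite.bddAbove_range _) (⟨K, hKN⟩ : Fin N))
    exact add_le_add_right (le_max_right _ _) _
  have hN : 0 < N := by omega
  have hN' : (0 : ℝ) < N := by exact_mod_cast hN
  have hℓc := PMC.continuous_of_differentiable_log hℓ_diff hℓ_pos
  have hpc := PMC.continuous_of_differentiable_log hp_diff hp_pos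
  have hZ := PMC.integral_mul_pos hℓ_pos hp_pos hπ_int
  have hsℓ : Continuous (PMC.score ℓ) := PMC.continuous_of_norm_sub_le hℓ_lip
  have hsp : Continuous (PMC.score p) := PMC.continuous_of_norm_sub_le hp_lip
  set π := PMC.posteriorDensity ℓ p with hπdef
  have hπ0 : ∀ x, 0 < π x := fun x => div_pos (mul_pos (hℓ_pos x) (hp_pos x)) hZ
  have hπm : Measurable π := ((hℓc.mul hpc).div_const _).measurable
  have hπi : Integrable π := hπ_int.div_const _
  have hπ1 : ∫ x, π x = 1 := by
    simp only [hπdef, PMC.posteriorDensity]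
    rw [integral_div, div_self hZ.ne']
  set gV : EuclideanSpace ℝ (Fin n) → EuclideanSpace ℝ (Fin n) :=
    fun x => -(PMC.score ℓ x + PMC.score p x) with hgV
  have hgVc : Continuous gV := (hsℓ.add hsp).neg
  have hL : ∀ x y, ‖gV x - gV y‖ ≤ (Lg + Lp) * ‖x - y‖ := by
    intro x y
    have e : gV x - gV y =
        -((PMC.score ℓ x - PMC.score ℓ y) + (PMC.score p x - PMC.score p y)) := by
      simp only [hgV]; abel
    rw [e, norm_neg, add_mul]
    exact norm_add_le_of_le (hℓ_lip x y) (hp_lip x y)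
  have hπ : ∀ x, HasGradientAt (fun y => Real.log (π y)) (-gV x) x := by
    intro x
    simp only [hgV, neg_neg]
    exact PMC.hasGradientAt_log_posteriorDensity hℓ_pos hp_pos hπ_int hℓ_diff hp_diff x
  set G := PMC.drift ℓ S α σ with hGdef
  have hGe : ∀ k x, G k x = -PMC.score ℓ x - α k • S x (σ k) := PMC.drift_eq hℓ_diff S α σ
  have hG : ∀ k < N, Measurable (G k) := by
    intro k hk
    have hS : Continuous fun x => S x (σ k) :=
      PMC.continuous_of_norm_sub_le (hS_lip (σ k) (hσ_pos k hk))
    rw [funext (hGe k)]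
    exact (hsℓ.neg.sub (hS.const_smul (α k))).measurable
  -- Score mismatch, network error and annealing error: `α S` differs from `S` by `(α - 1) S`, which
  -- the bound on the network output controls.
  set e : ℕ → ℝ := fun k => σ k * C + ε (σ k) + |α k - 1| * Rs with he_def
  have he : ∀ k < N, ∀ y, ‖G k y - gV y‖ ≤ e k := by
    intro k hk y
    have hs := hσ_pos k hk
    have e1 : G k y - gV y = -(PMC.score (PMC.smoothedPrior p (σ k)) y - PMC.score p y) +
        -(S y (σ k) - PMC.score (PMC.smoothedPrior p (σ k)) y) + -((α k - 1) • S y (σ k)) := by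
      rw [hGe, sub_smul, one_smul]
      simp only [hgV]
      abel
    rw [e1]
    refine norm_add_le_of_le (norm_add_le_of_le ?_ ?_) ?_
    · rw [norm_neg]; exact hC _ hs y
    · rw [norm_neg]; exact hS_err _ hs y
    · rw [norm_neg, norm_smul, Real.norm_eq_abs]
      exact mul_le_mul_of_nonneg_left (hRs _ hs y) (abs_nonneg _)
  have he2 : ∀ k, e k ^ 2 ≤ 3 * (C ^ 2 * σ k ^ 2 + ε (σ k) ^ 2 + (α k - 1) ^ 2 * Rs ^ 2) := by
    intro k
    have h2 : (|α k - 1| * Rs) ^ 2 = (α k - 1) ^ 2 * Rs ^ 2 := by rw [mul_pow, sq_abs]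
    rw [← h2]
    simp only [he_def]
    nlinarith [sq_nonneg (σ k * C - ε (σ k)), sq_nonneg (σ k * C - |α k - 1| * Rs),
      sq_nonneg (ε (σ k) - |α k - 1| * Rs)]
  -- The index is cut off at `N` because the drifts are known to be measurable only for `k < N`,
  -- while every `μ k` has to be a probability measure.
  set μ : ℕ → Measure (EuclideanSpace ℝ (Fin n)) :=
    fun k => P.map (PMC.iterate γ G X₀ B (min k N)) with hμdef
  have hμP : ∀ k, IsProbabilityMeasure (μ k) := fun k => Measure.isProbabilityMeasure_map
    (PMC.measurable_iterate hB hG hX₀ (min_le_right k N)).aemeasurable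
  have hμk : ∀ k ≤ N, μ k = P.map (PMC.iterate γ G X₀ B k) := fun k hk => by
    simp only [hμdef, min_eq_left hk]
  have hμ : ∀ k < N, μ (k + 1) = PMC.densityMeasure (PMC.mix (μ k) (G k) γ) := fun k hk => by
    rw [hμk k hk.le, hμk (k + 1) hk, PMC.map_iterate_succ hB hG hX₀ hX₀B hγ hk]
  have hν0 : ν 0 = μ 0 := by
    rw [hν, PMC.interpolation_zero, hμk 0 (Nat.zero_le _)]
    rfl
  have hFI : ∀ k < N, ∀ s ∈ Ioo 0 γ,
      PMC.relFisherInfo (ν (k * γ + s)) π = PMC.mixFisher (μ k) (G k) gV s := by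
    intro k hk s hs
    rw [hν, PMC.map_interpolation hB hG hX₀ hX₀B hγ hk hs, ← hμk k hk.le,
      PMC.relFisherInfo_densityMeasure_mix (hG k hk) hgVc.measurable hs.1 hπ0 hπ]
  obtain ⟨hmeas, hint⟩ := PMC.lintegral_Ioc_mul_eq_sum
    (φ := fun t => PMC.relFisherInfo (ν t) π) hγ
    (fun k hk => PMC.measurable_mixFisher (μ := μ k) (hG k hk) hgVc.measurable) hFI
  rw [← Measure.restrict_congr_set (Ioc_ae_eq_Icc (α := ℝ) (μ := volume))]
  refine ⟨hmeas, ?_⟩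
  rw [hint, hν0]
  have hNγ : 0 < N * γ := by positivity
  have hNγ0 : ENNReal.ofReal (N * γ) ≠ 0 := (ENNReal.ofReal_pos.2 hNγ).ne'
  by_cases hkl : klDiv (μ 0) (PMC.densityMeasure π) = ∞
  · rw [hkl, ENNReal.mul_top (by norm_num), top_add, ENNReal.top_div_of_ne_top ENNReal.ofReal_ne_top]
    simp
  have hmain := PMC.sum_mixFisher_le hγ hG hγL0 hgVc hL
    ((mul_le_mul_of_nonneg_left hLle hγ.le).trans hγL) he hπm hπi hπ0 hπ1 hπ hμ hkl
  -- From index `K` on, the annealing weight is `1` and this error vanishes.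
  have hζ : ∑ k ∈ Finset.range N, (α k - 1) ^ 2 * Rs ^ 2 =
      ∑ k ∈ Finset.range K, (α k - 1) ^ 2 * Rs ^ 2 := by
    refine (Finset.sum_subset (Finset.range_mono hKN.le) fun k hk hk' => ?_).symm
    rw [Finset.mem_range] at hk hk'
    rw [hα_one k (by omega) hk]
    simp
  have hsum : ∑ k ∈ Finset.range N, γ * (24 * n * (Lg + Lp) ^ 2 * γ + 12 * e k ^ 2) ≤
      γ * (36 * ∑ k ∈ Finset.range K, (α k - 1) ^ 2 * Rs ^ 2) +
        (N * γ) * (24 * n * Lmax ^ 2 * γ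
          + 36 * C ^ 2 * (1 / N * ∑ k ∈ Finset.range N, σ k ^ 2)
          + 36 * (1 / N * ∑ k ∈ Finset.range N, ε (σ k) ^ 2)) := by
    calc ∑ k ∈ Finset.range N, γ * (24 * n * (Lg + Lp) ^ 2 * γ + 12 * e k ^ 2)
        ≤ ∑ k ∈ Finset.range N, (γ * (24 * n * Lmax ^ 2 * γ) + γ * 36 * C ^ 2 * σ k ^ 2 +
            γ * 36 * ε (σ k) ^ 2 + γ * 36 * ((α k - 1) ^ 2 * Rs ^ 2)) := by
          refine Finset.sum_le_sum fun k _ => ?_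
          have h1 : 24 * n * (Lg + Lp) ^ 2 * γ ≤ 24 * n * Lmax ^ 2 * γ := by gcongr
          have h2 := mul_le_mul_of_nonneg_left (add_le_add h1
            (mul_le_mul_of_nonneg_left (he2 k) (by norm_num : (0 : ℝ) ≤ 12))) hγ.le
          refine h2.trans_eq ?_
          ring
      _ = _ := by
          rw [Finset.sum_add_distrib, Finset.sum_add_distrib, Finset.sum_add_distrib,
            Finset.sum_const, Finset.card_range, nsmul_eq_mul, ← Finset.mul_sum, ← Finset.mul_sum,
            ← Finset.mul_sum, hζ]
          generalize ∑ k ∈ Finset.range K, (α k - 1) ^ 2 * Rs ^ 2 = z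
          field_simp
          ring
  have ha : 0 ≤ 24 * n * Lmax ^ 2 * γ := by positivity
  have hb : 0 ≤ 36 * C ^ 2 * (1 / N * ∑ k ∈ Finset.range N, σ k ^ 2) := by positivity
  have hc : 0 ≤ 36 * (1 / N * ∑ k ∈ Finset.range N, ε (σ k) ^ 2) := by positivity
  rw [add_assoc, add_assoc, ← ENNReal.ofReal_add hb hc, ← ENNReal.ofReal_add ha (add_nonneg hb hc),
    ENNReal.div_le_iff hNγ0 ENNReal.ofReal_ne_top, add_mul,
    ENNReal.div_mul_cancel hNγ0 ENNReal.ofReal_ne_top, ← ENNReal.ofReal_mul (by positivity),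
    add_assoc (4 * _), ← ENNReal.ofReal_add (by positivity) (by positivity)]
  -- The entropy appears with factor `2`, which is weakened to `4`.
  refine hmain.trans (add_le_add (mul_le_mul_left (by norm_num) _) (ENNReal.ofReal_le_ofReal ?_))
  refine hsum.trans_eq ?_
  ring
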